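/- Let $d\ge 1$, and let $p_0$ be a probability density on $\mathbb R^d$ belonging to the Sobolev space $\mathcal W^{s,2}(\mathbb R^d)$ for some $s\ge 0$; that is, $p_0$ is continuous at almost every point and $\int (1+\|\omega\|^2)^s|\mathcal F p_0(\omega)|^2\,d\omega<\infty$, where $\mathcal F p_0(\omega)=(2\pi)^{-d/2}\int p_0(x)e^{-ix^\top\omega}\,dx$. Let $\mathbb P_0$ be the distribution with density $p_0$, and let $X_1,X_2,\dots$ be independent random vectors with distribution $\mathbb P_0$ (the null hypothesis $H_0^{\rm GOF}$). Put $G_\nu(x,y)=\exp(-\nu\|x-y\|^2)$ and $$\bar G_\nu(x,y)=G_\nu(x,y)-\mathbb E_{X\sim\mathbb P_0}G_\nu(X,y)-\mathbb E_{X\sim\mathbb P_0}G_\nu(x,X)+\mathbb E_{X,X'\sim_{\rm iid}\mathbb P_0}G_\nu(X,X'),$$ $$\widehat{\gamma_\nu^2}=\frac1{n(n-1)}\sum_{1\le i\ne j\le n}\bar G_\nu(X_i,X_j),$$ \begin{align*} \tilde s^2_{n,\nu}=&\ \frac1{n(n-1)}\sum_{1\le i\ne j\le n}G_{2\nu}(X_i,X_j)-\frac{2(n-3)!}{n!}\sum_{|\{i,j_1,j_2\}|=3}G_\nu(X_i,X_{j_1})G_\nu(X_i,X_{j_2})\\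 &+\frac{(n-4)!}{n!}\sum_{|\{i_1,i_2,j_1,j_2\}|=4}G_\nu(X_{i_1},X_{j_1})G_\nu(X_{i_2},X_{j_2}), \end{align*} where all indices range over $1,\dots,n$, and let $\widehat s_{n,\nu}$ be the positive square root of $\max\{\tilde s^2_{n,\nu},1/n^2\}$ and $T^{\rm GOF}_{n,\nu}=\frac n{\sqrt2}\,\widehat s_{n,\nu}^{\,-1}\,\widehat{\gamma_\nu^2}$. Let $\nu_n$ be real numbers with $\nu_n\to\infty$ and $\nu_n=o(n^{4/d})$ as $n\to\infty$. Then $p_0\in L_2(\mathbb R^d)$ and, as $n\to\infty$, $$\frac n{\sqrt2}\Big(\frac{2\nu_n}{\pi}\Big)^{d/4}\widehat{\gamma_{\nu_n}^2}\to_d N\big(0,\|p_0\|_{L_2}^2\big)\qquad\text{and}\qquad T^{\rm GOF}_{n,\nu_n}\to_d N(0,1),$$ where $\|p_0\|_{L_2}^2=\int p_0(x)^2\,dx$. -/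

import Mathlib

open MeasureTheory ProbabilityTheory Filter Asymptotics
open scoped Topology Nat

noncomputable section

namespace GaussMMD

/-- Euclidean space `ℝᵈ` with the Euclidean norm. -/
abbrev Space (d : ℕ) : Type := EuclideanSpace ℝ (Fin d)

/-- `p` is a probability density on `ℝᵈ` with respect to Lebesgue measure (a function which is not
integrable has integral `0` in Mathlib, so the last clause includes integrability). -/
def IsDensity {d : ℕ} (p : Space d → ℝ) : Prop :=
  Measurable p ∧ (∀ x, 0 ≤ p x) ∧ ∫ x, p x = 1

/-- The distribution on `ℝᵈ` with density `p`. -/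
def densityMeasure {d : ℕ} (p : Space d → ℝ) : Measure (Space d) :=
  volume.withDensity fun x => ENNReal.ofReal (p x)

/-- The Fourier transform `(2π)^(-d/2) ∫ f(x) exp(-i xᵀω) dx` of an integrable function. -/
def fourierTransform {d : ℕ} (f : Space d → ℝ) (ω : Space d) : ℂ :=
  (((2 * Real.pi) ^ (-((d : ℝ) / 2)) : ℝ) : ℂ) *
    ∫ x, (f x : ℂ) * Complex.exp (-Complex.I * ((inner ℝ x ω : ℝ) : ℂ))

/-- The integrable function `f` belongs to the Sobolev space `W^{s,2}(ℝᵈ)`: it is continuous at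
almost every point and `∫ (1 + ‖ω‖²)^s ‖F(f)(ω)‖² dω` is finite. Integrability is part of the
definition because the Fourier transform is given by an absolutely convergent integral. -/
def MemSobolev {d : ℕ} (s : ℝ) (f : Space d → ℝ) : Prop :=
  Integrable f ∧ (∀ᵐ x, ContinuousAt f x) ∧
    Integrable fun ω : Space d => (1 + ‖ω‖ ^ 2) ^ s * ‖fourierTransform f ω‖ ^ 2

/-- The squared norm `‖f‖²_{L²} = ∫ f(x)² dx`. -/
def l2NormSq {d : ℕ} (f : Space d → ℝ) : ℝ := ∫ x, f x ^ 2

/-- The Gaussian kernel `G_ν(x, y) = exp(-ν ‖x - y‖²)`. -/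
def gaussKernel {d : ℕ} (ν : ℝ) (x y : Space d) : ℝ := Real.exp (-ν * ‖x - y‖ ^ 2)

/-- The kernel `Ḡ_ν(x, y; P₀)`, i.e. the Gaussian kernel centred with respect to `P₀`. -/
def centredKernel {d : ℕ} (ν : ℝ) (P₀ : Measure (Space d)) (x y : Space d) : ℝ :=
  gaussKernel ν x y - ∫ z, gaussKernel ν z y ∂P₀ - ∫ z, gaussKernel ν x z ∂P₀
    + ∫ z, gaussKernel ν z.1 z.2 ∂(P₀.prod P₀)

/-- The U-statistic `(n(n-1))⁻¹ ∑_{i ≠ j} Ḡ_ν(x_i, x_j; P₀)` of a sample `x` of size `n`. -/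
def mmdU {d n : ℕ} (ν : ℝ) (P₀ : Measure (Space d)) (x : Fin n → Space d) : ℝ :=
  1 / ((n : ℝ) * ((n : ℝ) - 1)) *
    ∑ i, ∑ j, if i ≠ j then centredKernel ν P₀ (x i) (x j) else 0

/-- The unbiased variance estimator `s̃²_{n,ν}`, a combination of three U-statistics. For `n < 3`
(resp. `n < 4`) the second (resp. third) sum is empty. -/
def varU {d n : ℕ} (ν : ℝ) (x : Fin n → Space d) : ℝ :=
  1 / ((n : ℝ) * ((n : ℝ) - 1)) *
      (∑ i, ∑ j, if i ≠ j then gaussKernel (2 * ν) (x i) (x j) else 0)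
    - 2 * ((n - 3)! : ℝ) / (n ! : ℝ) *
      (∑ i, ∑ j₁, ∑ j₂, if ({i, j₁, j₂} : Finset (Fin n)).card = 3 then
        gaussKernel ν (x i) (x j₁) * gaussKernel ν (x i) (x j₂) else 0)
    + ((n - 4)! : ℝ) / (n ! : ℝ) *
      (∑ i₁, ∑ i₂, ∑ j₁, ∑ j₂, if ({i₁, i₂, j₁, j₂} : Finset (Fin n)).card = 4 then
        gaussKernel ν (x i₁) (x j₁) * gaussKernel ν (x i₂) (x j₂) else 0)

/-- The truncated variance estimator `ŝ²_{n,ν} = max {s̃²_{n,ν}, 1/n²}`. -/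
def varHat {d n : ℕ} (ν : ℝ) (x : Fin n → Space d) : ℝ := max (varU ν x) (1 / (n : ℝ) ^ 2)

/-- The normalized statistic `(n/√2) (2ν/π)^(d/4) γ̂²_ν`. -/
def normalizedStat {d n : ℕ} (ν : ℝ) (P₀ : Measure (Space d)) (x : Fin n → Space d) : ℝ :=
  (n : ℝ) / √2 * (2 * ν / Real.pi) ^ ((d : ℝ) / 4) * mmdU ν P₀ x

/-- The studentized statistic `T_{n,ν} = (n/√2) ŝ_{n,ν}⁻¹ γ̂²_ν`. -/
def studentizedStat {d n : ℕ} (ν : ℝ) (P₀ : Measure (Space d)) (x : Fin n → Space d) : ℝ :=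
  (n : ℝ) / √2 * (√(varHat ν x))⁻¹ * mmdU ν P₀ x

end GaussMMD

end

/-!
With `c = (2ν/π)^(d/4)`, the function `c² G_ν²` is the Gaussian probability density `N(x, 1/(4ν))`,
so that `c² E G_ν(X, X')² = ∬ p₀(x) (c² G_ν²)(x, y) p₀(y)` is a smoothed version of `∫ p₀²` and tends
to `‖p₀‖²` as `ν → ∞`. Up to the factor `c/(√2 (n - 1))`, the normalized statistic is the sum over
ordered pairs of a degenerate kernel, and this limit is its asymptotic variance.

*Square integrability.* Writing the Gaussian density as a Fourier integral bounds the smoothed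
energy `∬ p₀(x) g_a(x - y) p₀(y)` by `∫ |F p₀|²`, uniformly in `a`
(`IsDensity.smoothedEnergy_le_fourier`). The smoothed densities converge to `p₀` at each of its
continuity points, hence almost everywhere, and Fatou's lemma gives `∫ p₀² < ∞`
(`MemSobolev.integrable_sq`). The same use of Fatou, with the elementary bound of the energy by
`∫ p₀²`, yields the limit of the second moment (`IsDensity.tendsto_second_moment`).

*Central limit theorem.* Let `h` be a degenerate symmetric kernel, `S_i = ∑_{j ≠ i} h(X_i, X_j)` and
`U = ∑ S_i`. The variable `U - 2 S_i` does not involve `X_i`, while `S_i` has mean zero given the other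
variables, so that `E S_i exp(is(U - 2 S_i)) = 0`. Expanding `exp(2is S_i)` gives Stein's identity
`E S_i exp(isU) ≈ 2is E S_i² exp(isU)`, with an error of order `s² E |S_i|³`. If `2 ∑ S_i²` concentrates
around a constant `L`, summation over `i` shows that the characteristic function of `U` nearly
satisfies `φ' = -L s φ`, and hence nearly equals `exp(-L t²/2)`. The concentration of `∑ S_i²` is a
second moment computation based on the orthogonality of degenerate terms with different supports
(`integral_sq_sum_le_of_degenerate`); it involves the Hilbert–Schmidt norm of the square of the
integral operator with kernel `h`. The result is `tendsto_integral_cexp_pairSum`.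

*Verification of its hypotheses.* Every error term is controlled by `c · sup_x ∫ G_ν(x, y) p₀(y) dy`
and `c/n` (`KernelAsymptotics`), the operator norm being estimated by Schur's test. The first quantity
tends to zero: truncating `p₀` at a level `k` leaves a bounded part, contributing `O(k ν^(-d/4))`, and
a tail of small `L²` norm. The second tends to zero because `ν = o(n^(4/d))`.

*Studentization.* In `c² s̃²` the first U-statistic converges to `‖p₀‖²` in mean by its variance bound,
and the other two are nonnegative with expectation `O((c · sup)²)`; the truncation at `1/n²` adds at
most `(c/n)²`. Since `‖p₀‖² > 0`, Slutsky's theorem finishes the proof.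
-/

set_option linter.unusedSectionVars false

noncomputable section

namespace GaussMMD

/-! ### Bounded measurable functions -/

/-- A measurable function with bounded range. On a probability space all moments of such a function
exist, and the class is closed under the operations used below. -/
structure BoundedMeasurable {α : Type*} [MeasurableSpace α] (f : α → ℝ) : Prop where
  measurable : Measurable f
  bounded : ∃ C, ∀ x, |f x| ≤ C

namespace BoundedMeasurable

variable {α β : Type*} [MeasurableSpace α] [MeasurableSpace β] {f g : α → ℝ}

lemma const (c : ℝ) : BoundedMeasurable fun _ : α => c := ⟨measurable_const, |c|, fun _ => le_rfl⟩

lemma add (hf : BoundedMeasurable f) (hg : BoundedMeasurable g) :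
    BoundedMeasurable fun x => f x + g x := by
  obtain ⟨C, hC⟩ := hf.bounded
  obtain ⟨D, hD⟩ := hg.bounded
  exact ⟨hf.measurable.add hg.measurable, C + D,
    fun x => (abs_add_le _ _).trans (add_le_add (hC x) (hD x))⟩

lemma mul (hf : BoundedMeasurable f) (hg : BoundedMeasurable g) :
    BoundedMeasurable fun x => f x * g x := by
  obtain ⟨C, hC⟩ := hf.bounded
  obtain ⟨D, hD⟩ := hg.bounded
  refine ⟨hf.measurable.mul hg.measurable, C * D, fun x => ?_⟩
  rw [abs_mul]
  exact mul_le_mul (hC x) (hD x) (abs_nonneg _) ((abs_nonneg _).trans (hC x))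

lemma const_mul (c : ℝ) (hf : BoundedMeasurable f) : BoundedMeasurable fun x => c * f x :=
  (const c).mul hf

lemma sub (hf : BoundedMeasurable f) (hg : BoundedMeasurable g) :
    BoundedMeasurable fun x => f x - g x := by
  simpa [sub_eq_add_neg] using hf.add (hg.const_mul (-1))

lemma pow (hf : BoundedMeasurable f) (n : ℕ) : BoundedMeasurable fun x => f x ^ n := by
  obtain ⟨C, hC⟩ := hf.bounded
  refine ⟨hf.measurable.pow_const n, C ^ n, fun x => ?_⟩
  rw [abs_pow]
  exact pow_le_pow_left₀ (abs_nonneg _) (hC x) n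

lemma abs (hf : BoundedMeasurable f) : BoundedMeasurable fun x => |f x| := by
  obtain ⟨C, hC⟩ := hf.bounded
  exact ⟨continuous_abs.measurable.comp hf.measurable, C, fun x => by simpa using hC x⟩

lemma sum {κ : Type*} {s : Finset κ} {F : κ → α → ℝ} (hF : ∀ i ∈ s, BoundedMeasurable (F i)) :
    BoundedMeasurable fun x => ∑ i ∈ s, F i x := by
  classical
  induction s using Finset.induction_on with
  | empty => simpa using const (α := α) 0
  | insert a s ha ih =>
    simp only [Finset.sum_insert ha]
    exact (hF a (by simp)).add (ih fun i hi => hF i (by simp [hi]))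

lemma comp (hf : BoundedMeasurable f) {e : β → α} (he : Measurable e) :
    BoundedMeasurable fun x => f (e x) := by
  obtain ⟨C, hC⟩ := hf.bounded
  exact ⟨hf.measurable.comp he, C, fun x => hC _⟩

lemma integrable {μ : Measure α} [IsFiniteMeasure μ] (hf : BoundedMeasurable f) :
    Integrable f μ := by
  obtain ⟨C, hC⟩ := hf.bounded
  exact Integrable.of_bound hf.measurable.aestronglyMeasurable C (ae_of_all _ hC)

lemma integral_right {f : α × β → ℝ} (hf : BoundedMeasurable f) (P : Measure β)
    [IsProbabilityMeasure P] : BoundedMeasurable fun x => ∫ z, f (x, z) ∂P := by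
  obtain ⟨C, hC⟩ := hf.bounded
  refine ⟨(StronglyMeasurable.integral_prod_right' (ν := P)
    hf.measurable.stronglyMeasurable).measurable, C, fun x => ?_⟩
  simpa using norm_integral_le_of_norm_le_const (μ := P) (f := fun z => f (x, z)) (C := C)
    (ae_of_all _ fun z => hC (x, z))

end BoundedMeasurable

/-! ### Resampling one coordinate of an i.i.d. sample -/

section Resampling

variable {S : Type*} [MeasurableSpace S] {ι : Type*} [Fintype ι]

/-- The law of an i.i.d. sample from `P`, indexed by `ι`. -/
abbrev sampleLaw (P : Measure S) (ι : Type*) [Fintype ι] : Measure (ι → S) :=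
  Measure.pi fun _ => P

variable (P : Measure S) [IsProbabilityMeasure P]

lemma integral_eval {f : S → ℝ} (hf : Measurable f) (i : ι) :
    ∫ x, f (x i) ∂sampleLaw P ι = ∫ y, f y ∂P := by
  have h := measurePreserving_eval (fun _ : ι => P) i
  conv_rhs => rw [← h.map_eq]
  exact (integral_map h.measurable.aemeasurable (by exact hf.aestronglyMeasurable)).symm

variable [DecidableEq ι]

/-- Replacing one coordinate of a sample by an independent copy preserves its law. -/
lemma measurePreserving_update (k : ι) :
    MeasurePreserving (fun q : (ι → S) × S => Function.update q.1 k q.2)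
      ((sampleLaw P ι).prod P) (sampleLaw P ι) := by
  have hm : Measurable fun q : (ι → S) × S => Function.update q.1 k q.2 := by
    refine measurable_pi_lambda _ fun i => ?_
    by_cases h : i = k
    · subst h; simpa using measurable_snd
    · simp only [Function.update_of_ne h]
      fun_prop
  refine ⟨hm, (Measure.pi_eq fun s hs => ?_).symm⟩
  rw [Measure.map_apply hm (.univ_pi hs)]
  have : (fun q : (ι → S) × S => Function.update q.1 k q.2) ⁻¹' Set.univ.pi s =
      (Set.univ.pi (Function.update s k Set.univ)) ×ˢ s k := by
    ext ⟨x, z⟩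
    simp only [Set.mem_preimage, Set.mem_pi, Set.mem_univ, forall_const, Set.mem_prod]
    constructor
    · intro h
      refine ⟨fun i => ?_, by simpa using h k⟩
      by_cases hi : i = k
      · subst hi; simp
      · simpa [Function.update_of_ne hi] using h i
    · rintro ⟨h, hz⟩ i
      by_cases hi : i = k
      · subst hi; simpa using hz
      · simpa [Function.update_of_ne hi] using h i
  rw [this, Measure.prod_prod, Measure.pi_pi, ← Finset.mul_prod_erase _ _ (Finset.mem_univ k),
    ← Finset.mul_prod_erase _ (fun i => P (s i)) (Finset.mem_univ k)]
  simp only [Function.update_self, measure_univ, one_mul]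
  rw [mul_comm]
  congr 1
  refine Finset.prod_congr rfl fun i hi => ?_
  rw [Function.update_of_ne (Finset.ne_of_mem_erase hi)]

lemma integral_eq_integral_update {E : Type*} [NormedAddCommGroup E] [NormedSpace ℝ E]
    {F : (ι → S) → E} (hF : Integrable F (sampleLaw P ι)) (k : ι) :
    ∫ x, F x ∂sampleLaw P ι = ∫ x, ∫ z, F (Function.update x k z) ∂P ∂sampleLaw P ι := by
  have h := measurePreserving_update P k
  have hF' : Integrable F (Measure.map (fun q : (ι → S) × S => Function.update q.1 k q.2)
      ((sampleLaw P ι).prod P)) := by rwa [h.map_eq]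
  rw [← integral_prod (f := fun q : (ι → S) × S => F (Function.update q.1 k q.2))
    ((integrable_map_measure hF'.aestronglyMeasurable h.measurable.aemeasurable).1 hF')]
  conv_lhs => rw [← h.map_eq]
  exact integral_map h.measurable.aemeasurable hF'.aestronglyMeasurable

variable {P}

lemma integral_eval_pair {f : S × S → ℝ} (hf : BoundedMeasurable f) {i j : ι} (hij : i ≠ j) :
    ∫ x, f (x i, x j) ∂sampleLaw P ι = ∫ y, ∫ z, f (y, z) ∂P ∂P := by
  have hb : BoundedMeasurable fun x : ι → S => f (x i, x j) := hf.comp (by fun_prop)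
  rw [integral_eq_integral_update P hb.integrable j]
  simp only [Function.update_self, Function.update_of_ne hij]
  exact integral_eval P (hf.integral_right P).measurable i

lemma integral_eval_triple {f : S × S × S → ℝ} (hf : BoundedMeasurable f) {i j k : ι}
    (hij : i ≠ j) (hik : i ≠ k) (hjk : j ≠ k) :
    ∫ x, f (x i, x j, x k) ∂sampleLaw P ι = ∫ y, ∫ z, ∫ w, f (y, z, w) ∂P ∂P ∂P := by
  have hb : BoundedMeasurable fun x : ι → S => f (x i, x j, x k) := hf.comp (by fun_prop)
  rw [integral_eq_integral_update P hb.integrable k]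
  simp only [Function.update_self, Function.update_of_ne hik, Function.update_of_ne hjk]
  exact integral_eval_pair
    (f := fun q : S × S => ∫ w, f (q.1, q.2, w) ∂P)
    (BoundedMeasurable.integral_right (f := fun q : (S × S) × S => f (q.1.1, q.1.2, q.2))
      (hf.comp (by fun_prop)) P) hij

/-- Orthogonality of completely degenerate terms, in the form of a second moment bound. The term
`F τ` is attached to the coordinates `supp τ`, and averaging over any one of these coordinates
kills it, so that two terms with different supports are uncorrelated. If at most `M` terms share a
support, the second moment of the sum is at most `M` times the sum of the second moments. -/
lemma integral_sq_sum_le_of_degenerate {κ : Type*} (T : Finset κ) (supp : κ → Finset ι)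
    (F : κ → (ι → S) → ℝ) (hF : ∀ τ ∈ T, BoundedMeasurable (F τ))
    (hinv : ∀ τ ∈ T, ∀ σ ∈ T, ∀ k ∈ supp τ, k ∉ supp σ → ∀ x z,
      F σ (Function.update x k z) = F σ x)
    (hdeg : ∀ τ ∈ T, ∀ k ∈ supp τ, ∀ x, ∫ z, F τ (Function.update x k z) ∂P = 0)
    (M : ℕ) (hM : ∀ τ ∈ T, (T.filter fun σ => supp σ = supp τ).card ≤ M)
    (v : ℝ) (hv : ∀ τ ∈ T, ∫ x, F τ x ^ 2 ∂sampleLaw P ι ≤ v) :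
    ∫ x, (∑ τ ∈ T, F τ x) ^ 2 ∂sampleLaw P ι ≤ T.card * M * v := by
  have horth : ∀ τ ∈ T, ∀ σ ∈ T, ∀ k ∈ supp τ, k ∉ supp σ →
      ∫ x, F τ x * F σ x ∂sampleLaw P ι = 0 := by
    intro τ hτ σ hσ k hk hk'
    rw [integral_eq_integral_update P ((hF τ hτ).mul (hF σ hσ)).integrable k]
    simp [hinv τ hτ σ hσ k hk hk', integral_mul_const, hdeg τ hτ k hk]
  have hzero : ∀ τ ∈ T, ∀ σ ∈ T, supp σ ≠ supp τ →
      ∫ x, F τ x * F σ x ∂sampleLaw P ι = 0 := by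
    intro τ hτ σ hσ hne
    by_cases h : supp τ ⊆ supp σ
    · have h' : ¬ supp σ ⊆ supp τ := fun h' => hne (h'.antisymm h)
      obtain ⟨k, hk, hk'⟩ := Finset.not_subset.1 h'
      simpa [mul_comm] using horth σ hσ τ hτ k hk hk'
    · obtain ⟨k, hk, hk'⟩ := Finset.not_subset.1 h
      exact horth τ hτ σ hσ k hk hk'
  have hle : ∀ τ ∈ T, ∀ σ ∈ T, ∫ x, F τ x * F σ x ∂sampleLaw P ι ≤ v := by
    intro τ hτ σ hσ
    have h1 := hv τ hτ
    have h2 := hv σ hσ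
    have : ∫ x, F τ x * F σ x ∂sampleLaw P ι ≤
        ∫ x, (2⁻¹ * F τ x ^ 2 + 2⁻¹ * F σ x ^ 2) ∂sampleLaw P ι := by
      refine integral_mono ((hF τ hτ).mul (hF σ hσ)).integrable
        ((((hF τ hτ).pow 2).const_mul _).add (((hF σ hσ).pow 2).const_mul _)).integrable
        fun x => ?_
      simp only
      nlinarith [sq_nonneg (F τ x - F σ x)]
    rw [integral_add (((hF τ hτ).pow 2).const_mul _).integrable
      (((hF σ hσ).pow 2).const_mul _).integrable, integral_const_mul, integral_const_mul] at this
    linarith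
  have hexp : ∫ x, (∑ τ ∈ T, F τ x) ^ 2 ∂sampleLaw P ι =
      ∑ τ ∈ T, ∑ σ ∈ T, ∫ x, F τ x * F σ x ∂sampleLaw P ι := by
    simp_rw [sq, Finset.sum_mul_sum]
    rw [integral_finsetSum _ fun τ hτ => (BoundedMeasurable.sum fun σ hσ =>
      (hF τ hτ).mul (hF σ hσ)).integrable]
    refine Finset.sum_congr rfl fun τ hτ => ?_
    rw [integral_finsetSum _ fun σ hσ => ((hF τ hτ).mul (hF σ hσ)).integrable]
  rw [hexp]
  calc ∑ τ ∈ T, ∑ σ ∈ T, ∫ x, F τ x * F σ x ∂sampleLaw P ι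
      ≤ ∑ τ ∈ T, (M : ℝ) * v := by
        refine Finset.sum_le_sum fun τ hτ => ?_
        have hv0 : 0 ≤ v := (integral_nonneg fun x => sq_nonneg _).trans (hv τ hτ)
        rw [← Finset.sum_filter_add_sum_filter_not T (fun σ => supp σ = supp τ)]
        have h0 : ∑ σ ∈ T.filter (fun σ => ¬ supp σ = supp τ),
            ∫ x, F τ x * F σ x ∂sampleLaw P ι = 0 :=
          Finset.sum_eq_zero fun σ hσ =>
            hzero τ hτ σ (Finset.mem_filter.1 hσ).1 (Finset.mem_filter.1 hσ).2
        rw [h0, add_zero]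
        calc _ ≤ ∑ σ ∈ T.filter (fun σ => supp σ = supp τ), v :=
              Finset.sum_le_sum fun σ hσ => hle τ hτ σ (Finset.mem_filter.1 hσ).1
          _ = ((T.filter fun σ => supp σ = supp τ).card : ℝ) * v := by simp
          _ ≤ M * v := by
            gcongr
            exact_mod_cast hM τ hτ
    _ = T.card * M * v := by simp [mul_assoc]

end Resampling

/-! ### Moments of the rows of a degenerate kernel -/

section Moments

variable {S : Type*} [MeasurableSpace S] {P : Measure S} [IsProbabilityMeasure P]
  {ι : Type*} [Fintype ι] [DecidableEq ι]

/-- A bounded symmetric kernel on `S`, written as a function on `S × S`, whose average over one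
variable vanishes identically. -/
structure IsDegenerateKernel (h : S × S → ℝ) (P : Measure S) : Prop where
  boundedMeasurable : BoundedMeasurable h
  symm : ∀ x y, h (x, y) = h (y, x)
  integral_eq_zero : ∀ x, ∫ z, h (x, z) ∂P = 0

/-- The kernel of the square of the integral operator on `L²(P)` with kernel `h`. -/
def contraction (h : S × S → ℝ) (P : Measure S) (q : S × S) : ℝ :=
  ∫ x, h (x, q.1) * h (x, q.2) ∂P

/-- The `i`-th row `∑_{j ≠ i} h(x_i, x_j)`. -/
def rowSum (h : S × S → ℝ) (i : ι) (x : ι → S) : ℝ :=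
  ∑ j ∈ Finset.univ.erase i, h (x i, x j)

/-- The sum `∑_{i ≠ j} h(x_i, x_j)` over ordered pairs. -/
def pairSum (h : S × S → ℝ) (x : ι → S) : ℝ := ∑ i, rowSum h i x

lemma BoundedMeasurable.contraction {h : S × S → ℝ} (hh : BoundedMeasurable h) :
    BoundedMeasurable (contraction h P) :=
  BoundedMeasurable.integral_right (f := fun q : (S × S) × S => h (q.2, q.1.1) * h (q.2, q.1.2))
    ((hh.comp (by fun_prop)).mul (hh.comp (by fun_prop))) P

lemma BoundedMeasurable.rowSum {h : S × S → ℝ} (hh : BoundedMeasurable h) (i : ι) :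
    BoundedMeasurable (rowSum h i) :=
  BoundedMeasurable.sum fun j _ => hh.comp (by fun_prop)

lemma BoundedMeasurable.pairSum {h : S × S → ℝ} (hh : BoundedMeasurable h) :
    BoundedMeasurable (pairSum (ι := ι) h) :=
  BoundedMeasurable.sum fun i _ => hh.rowSum i

lemma pairSum_eq_sum_offDiag (h : S × S → ℝ) (x : ι → S) :
    pairSum h x = ∑ τ ∈ (Finset.univ : Finset ι).offDiag, h (x τ.1, x τ.2) := by
  rw [pairSum]
  simp only [rowSum]
  rw [Finset.sum_sigma' Finset.univ (fun i => Finset.univ.erase i)]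
  refine Finset.sum_bij' (fun s _ => (s.1, s.2)) (fun τ _ => ⟨τ.1, τ.2⟩) ?_ ?_ ?_ ?_ ?_ <;>
    simp +contextual [eq_comm]

lemma sq_sum_eq_diag_add_offDiag {κ : Type*} [DecidableEq κ] (s : Finset κ) (a : κ → ℝ) :
    (∑ j ∈ s, a j) ^ 2 = ∑ j ∈ s, a j ^ 2 + ∑ τ ∈ s.offDiag, a τ.1 * a τ.2 := by
  rw [sq, Finset.sum_mul_sum, ← Finset.sum_product', ← Finset.diag_union_offDiag,
    Finset.sum_union (Finset.disjoint_diag_offDiag s), Finset.sum_diag]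
  simp [sq]

lemma card_filter_supp_pair_le (T : Finset (ι × ι)) (τ : ι × ι) :
    (T.filter fun σ => ({σ.1, σ.2} : Finset ι) = {τ.1, τ.2}).card ≤ 4 := by
  have hsub : (T.filter fun σ => ({σ.1, σ.2} : Finset ι) = {τ.1, τ.2}) ⊆
      ({τ.1, τ.2} : Finset ι) ×ˢ ({τ.1, τ.2} : Finset ι) := by
    intro σ hσ
    have := (Finset.mem_filter.1 hσ).2
    rw [Finset.mem_product, ← this]
    simp
  refine (Finset.card_le_card hsub).trans ?_
  rw [Finset.card_product]
  exact Nat.mul_le_mul Finset.card_le_two Finset.card_le_two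

lemma card_filter_supp_triple_le (T : Finset (ι × ι × ι)) (τ : ι × ι × ι) :
    (T.filter fun σ => ({σ.1, σ.2.1, σ.2.2} : Finset ι) = {τ.1, τ.2.1, τ.2.2}).card ≤ 27 := by
  set A : Finset ι := {τ.1, τ.2.1, τ.2.2} with hA
  have hsub : (T.filter fun σ => ({σ.1, σ.2.1, σ.2.2} : Finset ι) = A) ⊆ A ×ˢ A ×ˢ A := by
    intro σ hσ
    have := (Finset.mem_filter.1 hσ).2
    rw [Finset.mem_product, Finset.mem_product, ← this]
    simp
  have hA3 : A.card ≤ 3 := Finset.card_le_three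
  refine (Finset.card_le_card hsub).trans ?_
  rw [Finset.card_product, Finset.card_product]
  exact Nat.mul_le_mul hA3 (Nat.mul_le_mul hA3 hA3)

lemma card_offDiag_le (s : Finset ι) : (s.offDiag.card : ℝ) ≤ (Fintype.card ι : ℝ) ^ 2 := by
  have h2 : s.card ≤ Fintype.card ι := Finset.card_le_univ s
  have h3 : s.offDiag.card ≤ Fintype.card ι ^ 2 := by
    rw [sq, Finset.offDiag_card]
    exact (Nat.sub_le _ _).trans (Nat.mul_le_mul h2 h2)
  exact_mod_cast h3

lemma integral_integral_mul_eq_sq {f : S × S → ℝ} :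
    ∫ y, ∫ z, ∫ w, f (y, z) * f (y, w) ∂P ∂P ∂P = ∫ y, (∫ z, f (y, z) ∂P) ^ 2 ∂P := by
  congr with y
  simp_rw [integral_const_mul, integral_mul_const, sq]

lemma integral_mul_eval_eq_integral_sq {f : S × S → ℝ} (hf : BoundedMeasurable f) {i j k : ι}
    (hij : i ≠ j) (hik : i ≠ k) (hjk : j ≠ k) :
    ∫ x, f (x i, x j) * f (x i, x k) ∂sampleLaw P ι = ∫ y, (∫ z, f (y, z) ∂P) ^ 2 ∂P := by
  rw [integral_eval_triple (f := fun q : S × S × S => f (q.1, q.2.1) * f (q.1, q.2.2))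
    ((hf.comp (by fun_prop)).mul (hf.comp (by fun_prop))) hij hik hjk]
  exact integral_integral_mul_eq_sq

lemma integral_sq_integral_le {f : S × S → ℝ} (hf : BoundedMeasurable f) :
    ∫ y, (∫ z, f (y, z) ∂P) ^ 2 ∂P ≤ ∫ y, ∫ z, f (y, z) ^ 2 ∂P ∂P := by
  refine integral_mono ((hf.integral_right P).pow 2).integrable
    ((hf.pow 2).integral_right P).integrable fun y => ?_
  have hy : BoundedMeasurable fun z => f (y, z) := hf.comp (by fun_prop)
  have h0 : 0 ≤ ∫ z, (f (y, z) - ∫ w, f (y, w) ∂P) ^ 2 ∂P := integral_nonneg fun z => sq_nonneg _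
  have : ∫ z, (f (y, z) - ∫ w, f (y, w) ∂P) ^ 2 ∂P =
      ∫ z, f (y, z) ^ 2 ∂P - (∫ z, f (y, z) ∂P) ^ 2 := by
    set c := ∫ w, f (y, w) ∂P with hc
    have e : ∀ z, (f (y, z) - c) ^ 2 = f (y, z) ^ 2 - (2 * c) * f (y, z) + c ^ 2 := fun z => by ring
    simp_rw [e]
    rw [integral_add ((hy.pow 2).sub (hy.const_mul _)).integrable
      (BoundedMeasurable.const _).integrable, integral_sub (hy.pow 2).integrable
      (hy.const_mul _).integrable, integral_const_mul, ← hc]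
    simp
    ring
  simp only
  linarith

/-- Second moment of a single row of an arbitrary kernel. -/
lemma integral_sq_sum_row_le {f : S × S → ℝ} (hf : BoundedMeasurable f) (i : ι) :
    ∫ x, (∑ j ∈ Finset.univ.erase i, f (x i, x j)) ^ 2 ∂sampleLaw P ι ≤
      Fintype.card ι * ∫ y, ∫ z, f (y, z) ^ 2 ∂P ∂P +
        (Fintype.card ι : ℝ) ^ 2 * ∫ y, (∫ z, f (y, z) ∂P) ^ 2 ∂P := by
  set m := ∫ y, ∫ z, f (y, z) ^ 2 ∂P ∂P with hm
  set t := ∫ y, (∫ z, f (y, z) ∂P) ^ 2 ∂P with ht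
  have hm0 : 0 ≤ m := integral_nonneg fun y => integral_nonneg fun z => sq_nonneg _
  have ht0 : 0 ≤ t := integral_nonneg fun y => sq_nonneg _
  have hb : ∀ j, BoundedMeasurable fun x : ι → S => f (x i, x j) := fun j => hf.comp (by fun_prop)
  have hcard : ((Finset.univ.erase i).card : ℝ) ≤ Fintype.card ι := by
    exact_mod_cast (Finset.card_le_univ _)
  simp_rw [sq_sum_eq_diag_add_offDiag]
  rw [integral_add (BoundedMeasurable.sum fun j _ => (hb j).pow 2).integrable
    (BoundedMeasurable.sum fun τ _ => (hb τ.1).mul (hb τ.2)).integrable,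
    integral_finsetSum _ fun j _ => ((hb j).pow 2).integrable,
    integral_finsetSum _ fun τ _ => ((hb τ.1).mul (hb τ.2)).integrable]
  refine add_le_add ?_ ?_
  · rw [Finset.sum_congr rfl fun j hj => integral_eval_pair (f := fun q => f q ^ 2) (hf.pow 2)
      (Finset.ne_of_mem_erase hj).symm]
    simp only [Finset.sum_const, nsmul_eq_mul]
    gcongr
  · have e : ∀ τ ∈ (Finset.univ.erase i).offDiag,
        ∫ x, f (x i, x τ.1) * f (x i, x τ.2) ∂sampleLaw P ι = t := by
      intro τ hτ
      rw [Finset.mem_offDiag] at hτ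
      exact integral_mul_eval_eq_integral_sq hf (Finset.ne_of_mem_erase hτ.1).symm
        (Finset.ne_of_mem_erase hτ.2.1).symm hτ.2.2
    rw [Finset.sum_congr rfl e]
    simp only [Finset.sum_const, nsmul_eq_mul]
    have h2 := card_offDiag_le (Finset.univ.erase i)
    gcongr

lemma integral_update_pair_eq_zero {h : S × S → ℝ} (hd : ∀ y, ∫ z, h (y, z) ∂P = 0)
    (hs : ∀ x y, h (x, y) = h (y, x)) {i j k : ι} (hij : i ≠ j) (hk : k = i ∨ k = j)
    (x : ι → S) :
    ∫ z, h (Function.update x k z i, Function.update x k z j) ∂P = 0 := by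
  rcases hk with rfl | rfl
  · simp only [Function.update_self, Function.update_of_ne hij.symm]
    simp_rw [fun z => hs z (x j)]
    exact hd _
  · simp only [Function.update_self, Function.update_of_ne hij]
    exact hd _

/-- Second moment of the off-diagonal part of `(rowSum h i) ^ 2`. Conditionally on `x_i`, it is a
degenerate function of the other coordinates; the supports of its terms omit the index `i`. -/
lemma integral_sq_sum_offDiag_row_le {h : S × S → ℝ} (hh : IsDegenerateKernel h P) (i : ι) :
    ∫ x, (∑ τ ∈ (Finset.univ.erase i).offDiag, h (x i, x τ.1) * h (x i, x τ.2)) ^ 2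
        ∂sampleLaw P ι ≤
      4 * (Fintype.card ι : ℝ) ^ 2 * ∫ y, (∫ z, h (y, z) ^ 2 ∂P) ^ 2 ∂P := by
  have hb := hh.boundedMeasurable
  set t := ∫ y, (∫ z, h (y, z) ^ 2 ∂P) ^ 2 ∂P with ht
  have ht0 : 0 ≤ t := integral_nonneg fun y => sq_nonneg _
  have key := integral_sq_sum_le_of_degenerate (P := P) (Finset.univ.erase i).offDiag
    (fun τ : ι × ι => {τ.1, τ.2}) (fun τ x => h (x i, x τ.1) * h (x i, x τ.2))
    (fun τ _ => (hb.comp (by fun_prop)).mul (hb.comp (by fun_prop))) ?_ ?_ 4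
    (fun τ _ => card_filter_supp_pair_le _ τ) t ?_
  · refine key.trans ?_
    have := card_offDiag_le (Finset.univ.erase i)
    push_cast
    nlinarith [mul_le_mul_of_nonneg_right this ht0]
  · intro τ hτ σ hσ k hk hk' x z
    rw [Finset.mem_offDiag] at hτ
    have hki : i ≠ k := by
      rintro rfl
      simp only [Finset.mem_insert, Finset.mem_singleton] at hk
      rcases hk with rfl | rfl
      · exact Finset.ne_of_mem_erase hτ.1 rfl
      · exact Finset.ne_of_mem_erase hτ.2.1 rfl
    simp only [Finset.mem_insert, Finset.mem_singleton, not_or] at hk'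
    rw [Function.update_of_ne hki, Function.update_of_ne (Ne.symm hk'.1),
      Function.update_of_ne (Ne.symm hk'.2)]
  · intro τ hτ k hk x
    rw [Finset.mem_offDiag] at hτ
    simp only [Finset.mem_insert, Finset.mem_singleton] at hk
    rcases hk with rfl | rfl
    · simp only [Function.update_self, Function.update_of_ne hτ.2.2.symm,
        Function.update_of_ne (Finset.ne_of_mem_erase hτ.1).symm]
      rw [integral_mul_const, hh.integral_eq_zero, zero_mul]
    · simp only [Function.update_self, Function.update_of_ne hτ.2.2,
        Function.update_of_ne (Finset.ne_of_mem_erase hτ.2.1).symm]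
      rw [integral_const_mul, hh.integral_eq_zero, mul_zero]
  · intro τ hτ
    rw [Finset.mem_offDiag] at hτ
    simp_rw [mul_pow]
    exact (integral_mul_eval_eq_integral_sq (hb.pow 2) (Finset.ne_of_mem_erase hτ.1).symm
      (Finset.ne_of_mem_erase hτ.2.1).symm hτ.2.2).le

/-- Fourth moment of a row, from the splitting of its square into a diagonal and an off-diagonal
part. -/
lemma integral_rowSum_pow_four_le {h : S × S → ℝ} (hh : IsDegenerateKernel h P) (i : ι) :
    ∫ x, rowSum h i x ^ 4 ∂sampleLaw P ι ≤
      2 * Fintype.card ι * ∫ y, ∫ z, h (y, z) ^ 4 ∂P ∂P +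
        10 * (Fintype.card ι : ℝ) ^ 2 * ∫ y, (∫ z, h (y, z) ^ 2 ∂P) ^ 2 ∂P := by
  have hb := hh.boundedMeasurable
  have h1 := integral_sq_sum_row_le (P := P) (hb.pow 2) i
  have h2 := integral_sq_sum_offDiag_row_le hh i
  have hD : BoundedMeasurable fun x : ι → S => ∑ j ∈ Finset.univ.erase i, h (x i, x j) ^ 2 :=
    BoundedMeasurable.sum fun j _ => (hb.comp (by fun_prop)).pow 2
  have hB : BoundedMeasurable fun x : ι → S =>
      ∑ τ ∈ (Finset.univ.erase i).offDiag, h (x i, x τ.1) * h (x i, x τ.2) :=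
    BoundedMeasurable.sum fun τ _ => (hb.comp (by fun_prop)).mul (hb.comp (by fun_prop))
  have h3 : ∫ x, rowSum h i x ^ 4 ∂sampleLaw P ι ≤
      ∫ x, (2 * (∑ j ∈ Finset.univ.erase i, h (x i, x j) ^ 2) ^ 2 +
        2 * (∑ τ ∈ (Finset.univ.erase i).offDiag, h (x i, x τ.1) * h (x i, x τ.2)) ^ 2)
        ∂sampleLaw P ι := by
    refine integral_mono ((hb.rowSum i).pow 4).integrable
      (((hD.pow 2).const_mul 2).add ((hB.pow 2).const_mul 2)).integrable fun x => ?_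
    have e : rowSum h i x ^ 4 = ((∑ j ∈ Finset.univ.erase i, h (x i, x j)) ^ 2) ^ 2 := by
      rw [rowSum]; ring
    simp only [e]
    rw [sq_sum_eq_diag_add_offDiag]
    set u := ∑ j ∈ Finset.univ.erase i, h (x i, x j) ^ 2
    set v := ∑ τ ∈ (Finset.univ.erase i).offDiag, h (x i, x τ.1) * h (x i, x τ.2)
    nlinarith [sq_nonneg (u - v)]
  rw [integral_add ((hD.pow 2).const_mul 2).integrable ((hB.pow 2).const_mul 2).integrable,
    integral_const_mul, integral_const_mul] at h3
  have e4 : ∀ q, (h q ^ 2) ^ 2 = h q ^ 4 := fun q => by ring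
  simp only [e4] at h1
  linarith

end Moments

/-! ### Hoeffding decomposition and variance of U-statistics -/

section Variance

variable {S : Type*} [MeasurableSpace S] {P : Measure S} [IsProbabilityMeasure P]
  {ι : Type*} [Fintype ι] [DecidableEq ι]

/-- Second moment bound for a sum over ordered pairs of a degenerate kernel. -/
lemma integral_sq_pairSum_le {h : S × S → ℝ} (hh : IsDegenerateKernel h P) :
    ∫ x : ι → S, pairSum h x ^ 2 ∂sampleLaw P ι ≤
      4 * (Fintype.card ι : ℝ) ^ 2 * ∫ y, ∫ z, h (y, z) ^ 2 ∂P ∂P := by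
  have hb := hh.boundedMeasurable
  set m := ∫ y, ∫ z, h (y, z) ^ 2 ∂P ∂P with hm
  have hm0 : 0 ≤ m := integral_nonneg fun y => integral_nonneg fun z => sq_nonneg _
  simp_rw [pairSum_eq_sum_offDiag]
  have key := integral_sq_sum_le_of_degenerate (P := P) (Finset.univ : Finset ι).offDiag
    (fun τ : ι × ι => {τ.1, τ.2}) (fun τ x => h (x τ.1, x τ.2))
    (fun τ _ => hb.comp (by fun_prop)) ?_ ?_ 4
    (fun τ _ => card_filter_supp_pair_le _ τ) m ?_
  · refine key.trans ?_
    have := card_offDiag_le (Finset.univ : Finset ι)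
    push_cast
    nlinarith [mul_le_mul_of_nonneg_right this hm0]
  · intro τ hτ σ hσ k hk hk' x z
    simp only [Finset.mem_insert, Finset.mem_singleton, not_or] at hk'
    rw [Function.update_of_ne (Ne.symm hk'.1), Function.update_of_ne (Ne.symm hk'.2)]
  · intro τ hτ k hk x
    rw [Finset.mem_offDiag] at hτ
    exact integral_update_pair_eq_zero hh.integral_eq_zero hh.symm hτ.2.2 (by simpa using hk) x
  · intro τ hτ
    rw [Finset.mem_offDiag] at hτ
    exact (integral_eval_pair (f := fun q => h q ^ 2) (hb.pow 2) hτ.2.2).le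

/-- Second moment of a sum of centred independent variables. -/
lemma integral_sq_sum_eval_le {f : S → ℝ} (hf : BoundedMeasurable f) (h0 : ∫ z, f z ∂P = 0) :
    ∫ x : ι → S, (∑ i, f (x i)) ^ 2 ∂sampleLaw P ι ≤ Fintype.card ι * ∫ y, f y ^ 2 ∂P := by
  have key := integral_sq_sum_le_of_degenerate (P := P) (Finset.univ : Finset ι)
    (fun i : ι => {i}) (fun i x => f (x i))
    (fun i _ => hf.comp (by fun_prop)) ?_ ?_ 1 ?_ (∫ y, f y ^ 2 ∂P) ?_
  · simpa using key
  · intro τ _ σ _ k _ hk' x z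
    rw [Function.update_of_ne (by simpa [eq_comm] using hk')]
  · intro τ _ k hk x
    obtain rfl : k = τ := by simpa using hk
    simpa using h0
  · intro τ _
    simp [Finset.filter_eq']
  · intro τ _
    exact (integral_eval P (f := fun y => f y ^ 2) (hf.pow 2).measurable τ).le

lemma pairSum_add (f g : S × S → ℝ) (x : ι → S) :
    pairSum (fun q => f q + g q) x = pairSum f x + pairSum g x := by
  simp [pairSum, rowSum, Finset.sum_add_distrib]

lemma cast_card_univ_erase (i : ι) :
    ((Finset.univ.erase i).card : ℝ) = Fintype.card ι - 1 := by
  rw [Finset.card_erase_of_mem (Finset.mem_univ _), Finset.card_univ,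
    Nat.cast_sub (Fintype.card_pos_iff.2 ⟨i⟩), Nat.cast_one]

lemma pairSum_const (c : ℝ) (x : ι → S) :
    pairSum (fun _ => c) x = Fintype.card ι * (Fintype.card ι - 1) * c := by
  simp only [pairSum, rowSum, Finset.sum_const, nsmul_eq_mul, cast_card_univ_erase,
    Finset.card_univ]
  ring

lemma pairSum_fst (f : S → ℝ) (x : ι → S) :
    pairSum (fun q => f q.1) x = (Fintype.card ι - 1) * ∑ i, f (x i) := by
  simp only [pairSum, rowSum, Finset.sum_const, nsmul_eq_mul, cast_card_univ_erase,
    Finset.mul_sum]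

lemma pairSum_swap (f : S × S → ℝ) (x : ι → S) :
    pairSum (fun q => f (q.2, q.1)) x = pairSum f x := by
  simp only [pairSum_eq_sum_offDiag]
  refine Finset.sum_bij' (fun τ _ => (τ.2, τ.1)) (fun τ _ => (τ.2, τ.1)) ?_ ?_ ?_ ?_ ?_ <;>
    simp +contextual [eq_comm]

lemma pairSum_snd (f : S → ℝ) (x : ι → S) :
    pairSum (fun q => f q.2) x = (Fintype.card ι - 1) * ∑ i, f (x i) := by
  rw [← pairSum_fst, ← pairSum_swap]

/-- The kernel `f` with its averages over each variable removed. -/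
def doublyCentred (f : S × S → ℝ) (P : Measure S) (q : S × S) : ℝ :=
  f q - ∫ z, f (q.1, z) ∂P - ∫ z, f (q.2, z) ∂P + ∫ y, ∫ z, f (y, z) ∂P ∂P

lemma BoundedMeasurable.doublyCentred {f : S × S → ℝ} (hf : BoundedMeasurable f) :
    BoundedMeasurable (doublyCentred f P) :=
  ((hf.sub ((hf.integral_right P).comp measurable_fst)).sub
    ((hf.integral_right P).comp measurable_snd)).add (BoundedMeasurable.const _)

lemma isDegenerateKernel_doublyCentred {f : S × S → ℝ} (hf : BoundedMeasurable f)
    (hs : ∀ x y, f (x, y) = f (y, x)) : IsDegenerateKernel (doublyCentred f P) P := by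
  refine ⟨hf.doublyCentred, fun x y => ?_, fun x => ?_⟩
  · simp only [doublyCentred, hs x y]; ring
  · have hx : BoundedMeasurable fun z => f (x, z) := hf.comp (by fun_prop)
    simp only [doublyCentred]
    rw [integral_add ((hx.sub (BoundedMeasurable.const _)).sub (hf.integral_right P)).integrable
      (BoundedMeasurable.const _).integrable, integral_sub
      (hx.sub (BoundedMeasurable.const _)).integrable (hf.integral_right P).integrable,
      integral_sub hx.integrable (BoundedMeasurable.const _).integrable]
    simp

/-- The second moment of the doubly centred kernel: a Pythagorean identity. -/
lemma integral_sq_doublyCentred {f : S × S → ℝ} (hf : BoundedMeasurable f)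
    (hs : ∀ x y, f (x, y) = f (y, x)) :
    ∫ y, ∫ z, doublyCentred f P (y, z) ^ 2 ∂P ∂P =
      ∫ y, ∫ z, f (y, z) ^ 2 ∂P ∂P - 2 * ∫ y, (∫ z, f (y, z) ∂P) ^ 2 ∂P +
        (∫ y, ∫ z, f (y, z) ∂P ∂P) ^ 2 := by
  have hd := isDegenerateKernel_doublyCentred (P := P) hf hs
  set q : S → ℝ := fun y => ∫ z, f (y, z) ∂P with hq
  have hqb : BoundedMeasurable q := hf.integral_right P
  set θ : ℝ := ∫ y, q y ∂P with hθ
  have hy : ∀ y, BoundedMeasurable fun z => f (y, z) := fun y => hf.comp (by fun_prop)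
  have hdy : ∀ y, BoundedMeasurable fun z => doublyCentred f P (y, z) :=
    fun y => hd.boundedMeasurable.comp (by fun_prop)
  -- by degeneracy, only the terms `f` and `-q(z)` contribute to the inner integral
  have inner : ∀ y, ∫ z, doublyCentred f P (y, z) ^ 2 ∂P =
      ∫ z, f (y, z) ^ 2 ∂P - q y * q y - 2 * ∫ z, f (y, z) * q z ∂P + θ * q y +
        q y * θ + ∫ z, q z ^ 2 ∂P - θ * θ := by
    intro y
    have e : ∀ z, doublyCentred f P (y, z) ^ 2 = doublyCentred f P (y, z) * f (y, z) -
        doublyCentred f P (y, z) * q z + (θ - q y) * doublyCentred f P (y, z) := by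
      intro z; simp only [doublyCentred, hq, hθ]; ring
    have e1 : ∀ z, doublyCentred f P (y, z) * f (y, z) =
        f (y, z) ^ 2 - q y * f (y, z) - f (y, z) * q z + θ * f (y, z) := by
      intro z; simp only [doublyCentred, hq, hθ]; ring
    have e2 : ∀ z, doublyCentred f P (y, z) * q z =
        f (y, z) * q z - q y * q z - q z ^ 2 + θ * q z := by
      intro z; simp only [doublyCentred, hq, hθ]; ring
    simp_rw [e]
    rw [integral_add (((hdy y).mul (hy y)).sub ((hdy y).mul hqb)).integrable
      ((hdy y).const_mul _).integrable, integral_sub ((hdy y).mul (hy y)).integrable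
      ((hdy y).mul hqb).integrable, integral_const_mul, hd.integral_eq_zero]
    simp_rw [e1, e2]
    have a1 := (hy y).pow 2
    have a2 := (hy y).const_mul (q y)
    have a3 := (hy y).mul hqb
    have a4 := (hy y).const_mul θ
    have b1 := hqb.const_mul (q y)
    have b2 := hqb.pow 2
    have b3 := hqb.const_mul θ
    rw [integral_add ((a1.sub a2).sub a3).integrable a4.integrable,
      integral_sub (a1.sub a2).integrable a3.integrable, integral_sub a1.integrable a2.integrable,
      integral_add ((a3.sub b1).sub b2).integrable b3.integrable,
      integral_sub (a3.sub b1).integrable b2.integrable, integral_sub a3.integrable b1.integrable]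
    simp_rw [integral_const_mul]
    have : ∫ z, f (y, z) ∂P = q y := rfl
    rw [this, ← hθ]
    ring
  simp_rw [inner]
  have cross : ∫ y, ∫ z, f (y, z) * q z ∂P ∂P = ∫ y, q y ^ 2 ∂P := by
    have hm : BoundedMeasurable fun p : S × S => f p * q p.2 := hf.mul (hqb.comp measurable_snd)
    rw [integral_integral_swap (f := fun y z => f (y, z) * q z) hm.integrable]
    congr with z
    rw [integral_mul_const]
    simp_rw [fun y => hs y z]
    simp only [hq]
    ring
  have a1 : BoundedMeasurable fun y => ∫ z, f (y, z) ^ 2 ∂P := (hf.pow 2).integral_right P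
  have a2 := hqb.mul hqb
  have a3 : BoundedMeasurable fun y => 2 * ∫ z, f (y, z) * q z ∂P :=
    ((BoundedMeasurable.integral_right (f := fun p : S × S => f p * q p.2)
      (hf.mul (hqb.comp measurable_snd)) P)).const_mul 2
  have a4 := hqb.const_mul θ
  have a5 := hqb.mul (BoundedMeasurable.const θ)
  have a6 : BoundedMeasurable fun _ : S => ∫ z, q z ^ 2 ∂P := BoundedMeasurable.const _
  have a7 : BoundedMeasurable fun _ : S => θ * θ := BoundedMeasurable.const _
  rw [integral_sub (((((a1.sub a2).sub a3).add a4).add a5).add a6).integrable a7.integrable,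
    integral_add ((((a1.sub a2).sub a3).add a4).add a5).integrable a6.integrable,
    integral_add (((a1.sub a2).sub a3).add a4).integrable a5.integrable,
    integral_add ((a1.sub a2).sub a3).integrable a4.integrable,
    integral_sub (a1.sub a2).integrable a3.integrable, integral_sub a1.integrable a2.integrable,
    integral_const_mul, integral_const_mul, integral_mul_const, cross, ← hθ]
  simp only [integral_const, probReal_univ, smul_eq_mul, one_mul]
  simp_rw [← sq]
  ring

lemma integral_le_sqrt_integral_sq {α : Type*} [MeasurableSpace α] {μ : Measure α}
    [IsProbabilityMeasure μ] {f : α → ℝ} (hf : BoundedMeasurable f) :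
    ∫ x, |f x| ∂μ ≤ √(∫ x, f x ^ 2 ∂μ) := by
  refine Real.le_sqrt_of_sq_le ?_
  have h0 := variance_nonneg (fun x => |f x|) μ
  rw [variance_eq_sub (MemLp.of_bound hf.abs.measurable.aestronglyMeasurable
    hf.bounded.choose (ae_of_all _ fun x => by simpa using hf.bounded.choose_spec x))] at h0
  simp only [Pi.pow_apply, sq_abs] at h0
  linarith

/-- Variance bound for a U-statistic of order two, from its Hoeffding decomposition. -/
lemma integral_sq_pairSum_sub_le {f : S × S → ℝ} (hf : BoundedMeasurable f)
    (hs : ∀ x y, f (x, y) = f (y, x)) :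
    ∫ x : ι → S, (pairSum f x - Fintype.card ι * (Fintype.card ι - 1) *
        ∫ y, ∫ z, f (y, z) ∂P ∂P) ^ 2 ∂sampleLaw P ι ≤
      16 * (Fintype.card ι : ℝ) ^ 2 * ∫ y, ∫ z, f (y, z) ^ 2 ∂P ∂P +
        8 * (Fintype.card ι : ℝ) ^ 3 * ∫ y, (∫ z, f (y, z) ∂P) ^ 2 ∂P := by
  set q : S → ℝ := fun y => ∫ z, f (y, z) ∂P with hq
  have hqb : BoundedMeasurable q := hf.integral_right P
  set θ : ℝ := ∫ y, q y ∂P with hθ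
  set N : ℝ := (Fintype.card ι : ℝ) with hN
  have hN0 : 0 ≤ N := Nat.cast_nonneg _
  have hd := isDegenerateKernel_doublyCentred (P := P) hf hs
  have hcb : BoundedMeasurable fun y => q y - θ := hqb.sub (BoundedMeasurable.const _)
  have hc0 : ∫ y, (q y - θ) ∂P = 0 := by
    rw [integral_sub hqb.integrable (BoundedMeasurable.const _).integrable]; simp [hθ]
  have hq2 : ∫ y, (q y - θ) ^ 2 ∂P = ∫ y, q y ^ 2 ∂P - θ ^ 2 := by
    have e : ∀ y, (q y - θ) ^ 2 = q y ^ 2 - (2 * θ) * q y + θ ^ 2 := fun y => by ring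
    simp_rw [e]
    rw [integral_add ((hqb.pow 2).sub (hqb.const_mul _)).integrable
      (BoundedMeasurable.const _).integrable, integral_sub (hqb.pow 2).integrable
      (hqb.const_mul _).integrable, integral_const_mul, ← hθ]
    simp
    ring
  -- the Hoeffding decomposition: a degenerate part and a sum of centred independent variables
  have decomp : ∀ x : ι → S, pairSum f x - N * (N - 1) * θ =
      pairSum (doublyCentred f P) x + 2 * (N - 1) * ∑ i, (q (x i) - θ) := by
    intro x
    have e : f = fun p => (doublyCentred f P p + θ) + ((q p.1 - θ) + (q p.2 - θ)) := by
      funext p; simp only [doublyCentred, hq, hθ]; ring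
    conv_lhs => rw [e]
    rw [pairSum_add, pairSum_add, pairSum_add, pairSum_const,
      pairSum_fst (fun y => q y - θ), pairSum_snd (fun y => q y - θ)]
    ring
  have h1 := integral_sq_pairSum_le (ι := ι) hd
  have h2 := integral_sq_sum_eval_le (ι := ι) hcb hc0
  have hA : BoundedMeasurable (pairSum (ι := ι) (doublyCentred f P)) := hf.doublyCentred.pairSum
  have hB : BoundedMeasurable fun x : ι → S => ∑ i, (q (x i) - θ) :=
    BoundedMeasurable.sum fun i _ => hcb.comp (f := fun y => q y - θ) (by fun_prop)
  have h3 : ∫ x : ι → S, (pairSum f x - N * (N - 1) * θ) ^ 2 ∂sampleLaw P ι ≤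
      ∫ x : ι → S, (2 * pairSum (doublyCentred f P) x ^ 2 +
        8 * N ^ 2 * (∑ i, (q (x i) - θ)) ^ 2) ∂sampleLaw P ι := by
    refine integral_mono ((hf.pairSum.sub (BoundedMeasurable.const _)).pow 2).integrable
      (((hA.pow 2).const_mul 2).add ((hB.pow 2).const_mul _)).integrable fun x => ?_
    simp only
    rw [decomp]
    set a := pairSum (doublyCentred f P) x
    set b := ∑ i, (q (x i) - θ)
    have hNN : (N - 1) ^ 2 * b ^ 2 ≤ N ^ 2 * b ^ 2 := by
      rcases isEmpty_or_nonempty ι with hι | hι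
      · simp [b]
      · have : (1 : ℝ) ≤ N := by rw [hN]; exact_mod_cast Fintype.card_pos
        exact mul_le_mul_of_nonneg_right (by nlinarith) (sq_nonneg b)
    nlinarith [sq_nonneg (a - 2 * (N - 1) * b)]
  rw [integral_add ((hA.pow 2).const_mul 2).integrable ((hB.pow 2).const_mul _).integrable,
    integral_const_mul, integral_const_mul] at h3
  rw [integral_sq_doublyCentred hf hs] at h1
  rw [hq2] at h2
  have hle : θ ^ 2 ≤ ∫ y, q y ^ 2 ∂P := by
    have : 0 ≤ ∫ y, (q y - θ) ^ 2 ∂P := integral_nonneg fun _ => sq_nonneg _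
    linarith
  have hq0 : 0 ≤ ∫ y, q y ^ 2 ∂P := integral_nonneg fun _ => sq_nonneg _
  have h1' : 2 * ∫ x : ι → S, pairSum (doublyCentred f P) x ^ 2 ∂sampleLaw P ι ≤
      16 * N ^ 2 * ∫ y, ∫ z, f (y, z) ^ 2 ∂P ∂P := by
    have hm0 : 0 ≤ ∫ y, ∫ z, f (y, z) ^ 2 ∂P ∂P :=
      integral_nonneg fun y => integral_nonneg fun z => sq_nonneg _
    have : 4 * N ^ 2 * (∫ y, ∫ z, f (y, z) ^ 2 ∂P ∂P - 2 * ∫ y, q y ^ 2 ∂P + θ ^ 2) ≤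
        4 * N ^ 2 * ∫ y, ∫ z, f (y, z) ^ 2 ∂P ∂P :=
      mul_le_mul_of_nonneg_left (by linarith) (by positivity)
    have h4 := h1.trans this
    nlinarith [mul_nonneg (sq_nonneg N) hm0]
  have h2' : 8 * N ^ 2 * ∫ x : ι → S, (∑ i, (q (x i) - θ)) ^ 2 ∂sampleLaw P ι ≤
      8 * N ^ 3 * ∫ y, q y ^ 2 ∂P := by
    have : N * (∫ y, q y ^ 2 ∂P - θ ^ 2) ≤ N * ∫ y, q y ^ 2 ∂P :=
      mul_le_mul_of_nonneg_left (by nlinarith [sq_nonneg θ]) hN0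
    calc _ ≤ 8 * N ^ 2 * (N * ∫ y, q y ^ 2 ∂P) :=
          mul_le_mul_of_nonneg_left (h2.trans this) (by positivity)
      _ = _ := by ring
  linarith

end Variance

/-! ### Concentration of the sum of squared rows -/

section QuadraticVariation

variable {S : Type*} [MeasurableSpace S] {P : Measure S} [IsProbabilityMeasure P]
  {ι : Type*} [Fintype ι] [DecidableEq ι]

/-- The contraction of a degenerate kernel is degenerate. -/
lemma IsDegenerateKernel.contraction {h : S × S → ℝ} (hh : IsDegenerateKernel h P) :
    IsDegenerateKernel (contraction h P) P := by
  have hb := hh.boundedMeasurable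
  refine ⟨hb.contraction, fun x y => ?_, fun y => ?_⟩
  · simp only [GaussMMD.contraction, mul_comm]
  · have hm : BoundedMeasurable fun p : S × S => h (p.2, y) * h (p.2, p.1) :=
      (hb.comp (by fun_prop)).mul (hb.comp (by fun_prop))
    simp only [GaussMMD.contraction]
    rw [integral_integral_swap (f := fun z x => h (x, y) * h (x, z)) hm.integrable]
    simp [integral_const_mul, hh.integral_eq_zero]

lemma sum_sum_offDiag_erase {f : ι → ι → ι → ℝ} :
    ∑ i, ∑ τ ∈ (Finset.univ.erase i).offDiag, f i τ.1 τ.2 =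
      ∑ τ ∈ Finset.univ.filter (fun τ : ι × ι × ι => τ.1 ≠ τ.2.1 ∧ τ.1 ≠ τ.2.2 ∧ τ.2.1 ≠ τ.2.2),
        f τ.1 τ.2.1 τ.2.2 := by
  rw [Finset.sum_sigma' Finset.univ (fun i => (Finset.univ.erase i).offDiag)]
  refine Finset.sum_bij' (fun s _ => (s.1, s.2.1, s.2.2)) (fun τ _ => ⟨τ.1, τ.2.1, τ.2.2⟩)
    ?_ ?_ ?_ ?_ ?_ <;>
    simp +contextual [eq_comm]

lemma sum_sum_offDiag_erase_const (f : S × S → ℝ) (x : ι → S) :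
    ∑ i : ι, ∑ τ ∈ (Finset.univ.erase i).offDiag, f (x τ.1, x τ.2) =
      (Fintype.card ι - 2) * pairSum f x := by
  rw [pairSum_eq_sum_offDiag, Finset.sum_comm' (t' := Finset.univ.offDiag)
    (s' := fun τ : ι × ι => (Finset.univ.erase τ.1).erase τ.2), Finset.mul_sum]
  · refine Finset.sum_congr rfl fun τ hτ => ?_
    rw [Finset.mem_offDiag] at hτ
    rw [Finset.sum_const, nsmul_eq_mul]
    congr 1
    have hmem : τ.2 ∈ Finset.univ.erase τ.1 := by simpa [eq_comm] using hτ.2.2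
    have h1 := Finset.card_erase_add_one hmem
    have h2 := cast_card_univ_erase τ.1
    rw [← h1] at h2
    push_cast at h2
    linarith
  · intro i τ
    simp only [Finset.mem_univ, Finset.mem_offDiag, Finset.mem_erase, true_and, and_true]
    tauto

/-- Second moment bound for the off-diagonal part of `∑ i, (rowSum h i) ^ 2`. Each product
`h(x_i, x_j) h(x_i, x_k)` splits into its average over `x_i`, a degenerate kernel of two
variables, and a completely degenerate function of three variables. -/
lemma integral_sq_sum_triple_le {h : S × S → ℝ} (hh : IsDegenerateKernel h P) :
    ∫ x : ι → S, (∑ i, ∑ τ ∈ (Finset.univ.erase i).offDiag,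
        h (x i, x τ.1) * h (x i, x τ.2)) ^ 2 ∂sampleLaw P ι ≤
      108 * (Fintype.card ι : ℝ) ^ 3 * (∫ y, (∫ z, h (y, z) ^ 2 ∂P) ^ 2 ∂P +
        ∫ y, ∫ z, contraction h P (y, z) ^ 2 ∂P ∂P) +
      8 * (Fintype.card ι : ℝ) ^ 4 * ∫ y, ∫ z, contraction h P (y, z) ^ 2 ∂P ∂P := by
  have hb := hh.boundedMeasurable
  have hg := hh.contraction
  have hgb := hg.boundedMeasurable
  set t := ∫ y, (∫ z, h (y, z) ^ 2 ∂P) ^ 2 ∂P with ht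
  set κ := ∫ y, ∫ z, contraction h P (y, z) ^ 2 ∂P ∂P with hκ
  set N : ℝ := (Fintype.card ι : ℝ) with hN
  have ht0 : 0 ≤ t := integral_nonneg fun y => sq_nonneg _
  have hκ0 : 0 ≤ κ := integral_nonneg fun y => integral_nonneg fun z => sq_nonneg _
  set T := Finset.univ.filter
    (fun τ : ι × ι × ι => τ.1 ≠ τ.2.1 ∧ τ.1 ≠ τ.2.2 ∧ τ.2.1 ≠ τ.2.2) with hT
  set r : ι × ι × ι → (ι → S) → ℝ := fun τ x =>
    h (x τ.1, x τ.2.1) * h (x τ.1, x τ.2.2) - contraction h P (x τ.2.1, x τ.2.2) with hr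
  have hhb : ∀ i j : ι, BoundedMeasurable fun x : ι → S => h (x i, x j) :=
    fun i j => hb.comp (by fun_prop)
  have hgb' : ∀ i j : ι, BoundedMeasurable fun x : ι → S => contraction h P (x i, x j) :=
    fun i j => hgb.comp (by fun_prop)
  have hrb : ∀ τ, BoundedMeasurable (r τ) := fun τ => ((hhb _ _).mul (hhb _ _)).sub (hgb' _ _)
  have hTcard : (T.card : ℝ) ≤ N ^ 3 := by
    have h1 : T.card ≤ Fintype.card (ι × ι × ι) := Finset.card_le_univ _
    rw [Fintype.card_prod, Fintype.card_prod] at h1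
    rw [hN]
    calc (T.card : ℝ) ≤ ((Fintype.card ι * (Fintype.card ι * Fintype.card ι) : ℕ) : ℝ) := by
          exact_mod_cast h1
      _ = _ := by push_cast; ring
  have key := integral_sq_sum_le_of_degenerate (P := P) T
    (fun τ : ι × ι × ι => {τ.1, τ.2.1, τ.2.2}) r (fun τ _ => hrb τ) ?_ ?_ 27
    (fun τ _ => card_filter_supp_triple_le _ τ) (2 * t + 2 * κ) ?_
  · have h2 := integral_sq_pairSum_le (ι := ι) hg
    have hR : BoundedMeasurable fun x => ∑ τ ∈ T, r τ x := BoundedMeasurable.sum fun τ _ => hrb τ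
    have hG : BoundedMeasurable (pairSum (ι := ι) (contraction h P)) := hgb.pairSum
    have hL : BoundedMeasurable fun x : ι → S => ∑ i, ∑ τ ∈ (Finset.univ.erase i).offDiag,
        h (x i, x τ.1) * h (x i, x τ.2) :=
      BoundedMeasurable.sum fun i _ => BoundedMeasurable.sum fun τ _ => (hhb _ _).mul (hhb _ _)
    have h3 : ∫ x : ι → S, (∑ i, ∑ τ ∈ (Finset.univ.erase i).offDiag,
        h (x i, x τ.1) * h (x i, x τ.2)) ^ 2 ∂sampleLaw P ι ≤
        ∫ x : ι → S, (2 * (∑ τ ∈ T, r τ x) ^ 2 +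
          2 * N ^ 2 * pairSum (contraction h P) x ^ 2) ∂sampleLaw P ι := by
      refine integral_mono (hL.pow 2).integrable
        (((hR.pow 2).const_mul 2).add ((hG.pow 2).const_mul _)).integrable fun x => ?_
      have e : ∑ i, ∑ τ ∈ (Finset.univ.erase i).offDiag, h (x i, x τ.1) * h (x i, x τ.2) =
          ∑ τ ∈ T, r τ x + (N - 2) * pairSum (contraction h P) x := by
        rw [← sum_sum_offDiag_erase_const, sum_sum_offDiag_erase
          (f := fun i j k => h (x i, x j) * h (x i, x k)), sum_sum_offDiag_erase
          (f := fun i j k => contraction h P (x j, x k)), ← Finset.sum_add_distrib]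
        exact Finset.sum_congr rfl fun τ _ => by simp [hr]
      simp only
      rw [e]
      set a := ∑ τ ∈ T, r τ x
      set b := pairSum (contraction h P) x with hbdef
      have hNN : (N - 2) ^ 2 * b ^ 2 ≤ N ^ 2 * b ^ 2 := by
        rcases isEmpty_or_nonempty ι with hι | hι
        · simp [hbdef, pairSum]
        · have : (1 : ℝ) ≤ N := by rw [hN]; exact_mod_cast Fintype.card_pos
          exact mul_le_mul_of_nonneg_right (by nlinarith) (sq_nonneg b)
      nlinarith [sq_nonneg (a - (N - 2) * b)]
    rw [integral_add ((hR.pow 2).const_mul 2).integrable ((hG.pow 2).const_mul _).integrable,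
      integral_const_mul, integral_const_mul] at h3
    push_cast at key
    have h4 : (T.card : ℝ) * 27 * (2 * t + 2 * κ) ≤ N ^ 3 * 27 * (2 * t + 2 * κ) := by gcongr
    have h5 : 2 * N ^ 2 * ∫ x : ι → S, pairSum (contraction h P) x ^ 2 ∂sampleLaw P ι ≤
        2 * N ^ 2 * (4 * N ^ 2 * κ) := mul_le_mul_of_nonneg_left h2 (by positivity)
    nlinarith
  · intro τ _ σ _ k _ hk' x z
    simp only [Finset.mem_insert, Finset.mem_singleton, not_or] at hk'
    simp only [hr]
    rw [Function.update_of_ne (Ne.symm hk'.1), Function.update_of_ne (Ne.symm hk'.2.1),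
      Function.update_of_ne (Ne.symm hk'.2.2)]
  · intro τ hτ k hk x
    have hτ' := (Finset.mem_filter.1 hτ).2
    simp only [Finset.mem_insert, Finset.mem_singleton] at hk
    have hint : ∀ a b : S, Integrable (fun z => h (z, a) * h (z, b)) P := fun a b =>
      ((hb.comp (e := fun z : S => (z, a)) (by fun_prop)).mul
        (hb.comp (e := fun z : S => (z, b)) (by fun_prop))).integrable
    simp only [hr]
    rcases hk with rfl | rfl | rfl
    · simp only [Function.update_self, Function.update_of_ne hτ'.1.symm,
        Function.update_of_ne hτ'.2.1.symm]
      rw [integral_sub (hint _ _) (integrable_const _)]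
      simp [contraction]
    · simp only [Function.update_self, Function.update_of_ne hτ'.1,
        Function.update_of_ne hτ'.2.2.symm]
      rw [integral_sub ((hb.comp (e := fun z : S => (x τ.1, z)) (by fun_prop)).mul
        (BoundedMeasurable.const _)).integrable
        (hgb.comp (e := fun z : S => (z, x τ.2.2)) (by fun_prop)).integrable,
        integral_mul_const, hh.integral_eq_zero]
      simp_rw [fun z => hg.symm z (x τ.2.2)]
      rw [hg.integral_eq_zero]
      simp
    · simp only [Function.update_self, Function.update_of_ne hτ'.2.1,
        Function.update_of_ne hτ'.2.2]
      rw [integral_sub ((hb.comp (e := fun z : S => (x τ.1, z)) (by fun_prop)).const_mul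
        _).integrable
        (hgb.comp (e := fun z : S => (x τ.2.1, z)) (by fun_prop)).integrable,
        integral_const_mul, hh.integral_eq_zero, hg.integral_eq_zero]
      simp
  · intro τ hτ
    have hτ' := (Finset.mem_filter.1 hτ).2
    have h1 : ∫ x, r τ x ^ 2 ∂sampleLaw P ι ≤ ∫ x : ι → S,
        (2 * (h (x τ.1, x τ.2.1) ^ 2 * h (x τ.1, x τ.2.2) ^ 2) +
          2 * contraction h P (x τ.2.1, x τ.2.2) ^ 2) ∂sampleLaw P ι := by
      refine integral_mono ((hrb τ).pow 2).integrable
        ((((((hhb _ _).pow 2).mul ((hhb _ _).pow 2)).const_mul 2)).add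
          (((hgb' _ _).pow 2).const_mul 2)).integrable fun x => ?_
      simp only [hr]
      nlinarith [sq_nonneg (h (x τ.1, x τ.2.1) * h (x τ.1, x τ.2.2) +
        contraction h P (x τ.2.1, x τ.2.2))]
    rw [integral_add (((((hhb _ _).pow 2).mul ((hhb _ _).pow 2)).const_mul 2)).integrable
      (((hgb' _ _).pow 2).const_mul 2).integrable, integral_const_mul, integral_const_mul,
      integral_mul_eval_eq_integral_sq (f := fun q => h q ^ 2) (hb.pow 2) hτ'.1 hτ'.2.1 hτ'.2.2,
      integral_eval_pair (f := fun q => contraction h P q ^ 2) (hgb.pow 2) hτ'.2.2] at h1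
    exact h1

/-- The sum of the squared rows concentrates around its mean. -/
lemma integral_sq_sum_rowSum_sq_sub_le {h : S × S → ℝ} (hh : IsDegenerateKernel h P) :
    ∫ x : ι → S, (∑ i, rowSum h i x ^ 2 - Fintype.card ι * (Fintype.card ι - 1) *
        ∫ y, ∫ z, h (y, z) ^ 2 ∂P ∂P) ^ 2 ∂sampleLaw P ι ≤
      32 * (Fintype.card ι : ℝ) ^ 2 * ∫ y, ∫ z, h (y, z) ^ 4 ∂P ∂P +
      232 * (Fintype.card ι : ℝ) ^ 3 * ∫ y, (∫ z, h (y, z) ^ 2 ∂P) ^ 2 ∂P +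
      (216 * (Fintype.card ι : ℝ) ^ 3 + 16 * (Fintype.card ι : ℝ) ^ 4) *
        ∫ y, ∫ z, contraction h P (y, z) ^ 2 ∂P ∂P := by
  have hb := hh.boundedMeasurable
  have h1 := integral_sq_pairSum_sub_le (ι := ι) (P := P) (f := fun q => h q ^ 2) (hb.pow 2)
    fun x y => by simp only [hh.symm x y]
  have h2 := integral_sq_sum_triple_le (ι := ι) hh
  have e4 : ∀ q, (h q ^ 2) ^ 2 = h q ^ 4 := fun q => by ring
  simp only [e4] at h1
  have hA : BoundedMeasurable fun x : ι → S => pairSum (fun q => h q ^ 2) x -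
      Fintype.card ι * (Fintype.card ι - 1) * ∫ y, ∫ z, h (y, z) ^ 2 ∂P ∂P :=
    BoundedMeasurable.pairSum (h := fun q => h q ^ 2) (hb.pow 2) |>.sub (BoundedMeasurable.const _)
  have hB : BoundedMeasurable fun x : ι → S => ∑ i, ∑ τ ∈ (Finset.univ.erase i).offDiag,
      h (x i, x τ.1) * h (x i, x τ.2) :=
    BoundedMeasurable.sum fun i _ => BoundedMeasurable.sum fun τ _ =>
      (hb.comp (by fun_prop)).mul (hb.comp (by fun_prop))
  have hL : BoundedMeasurable fun x : ι → S => ∑ i, rowSum h i x ^ 2 -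
      Fintype.card ι * (Fintype.card ι - 1) * ∫ y, ∫ z, h (y, z) ^ 2 ∂P ∂P :=
    (BoundedMeasurable.sum fun i _ => (hb.rowSum i).pow 2).sub (BoundedMeasurable.const _)
  have h3 : ∫ x : ι → S, (∑ i, rowSum h i x ^ 2 - Fintype.card ι * (Fintype.card ι - 1) *
        ∫ y, ∫ z, h (y, z) ^ 2 ∂P ∂P) ^ 2 ∂sampleLaw P ι ≤
      ∫ x : ι → S, (2 * (pairSum (fun q => h q ^ 2) x -
          Fintype.card ι * (Fintype.card ι - 1) * ∫ y, ∫ z, h (y, z) ^ 2 ∂P ∂P) ^ 2 +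
        2 * (∑ i, ∑ τ ∈ (Finset.univ.erase i).offDiag,
          h (x i, x τ.1) * h (x i, x τ.2)) ^ 2) ∂sampleLaw P ι := by
    refine integral_mono (hL.pow 2).integrable
      (((hA.pow 2).const_mul 2).add ((hB.pow 2).const_mul 2)).integrable fun x => ?_
    have e : ∑ i, rowSum h i x ^ 2 = pairSum (fun q => h q ^ 2) x +
        ∑ i, ∑ τ ∈ (Finset.univ.erase i).offDiag, h (x i, x τ.1) * h (x i, x τ.2) := by
      rw [pairSum, ← Finset.sum_add_distrib]
      exact Finset.sum_congr rfl fun i _ => sq_sum_eq_diag_add_offDiag _ _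
    simp only
    rw [e]
    set a := pairSum (fun q => h q ^ 2) x
    set b := ∑ i, ∑ τ ∈ (Finset.univ.erase i).offDiag, h (x i, x τ.1) * h (x i, x τ.2)
    set c := (Fintype.card ι : ℝ) * (Fintype.card ι - 1) * ∫ y, ∫ z, h (y, z) ^ 2 ∂P ∂P
    nlinarith [sq_nonneg (a - c - b)]
  rw [integral_add ((hA.pow 2).const_mul 2).integrable ((hB.pow 2).const_mul 2).integrable,
    integral_const_mul, integral_const_mul] at h3
  linarith

/-- The sum of the expected squared rows. -/
lemma sum_integral_rowSum_sq {h : S × S → ℝ} (hh : IsDegenerateKernel h P) :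
    ∑ i : ι, ∫ x : ι → S, rowSum h i x ^ 2 ∂sampleLaw P ι =
      Fintype.card ι * (Fintype.card ι - 1) * ∫ y, ∫ z, h (y, z) ^ 2 ∂P ∂P := by
  have hb := hh.boundedMeasurable
  have key : ∀ i : ι, ∫ x : ι → S, rowSum h i x ^ 2 ∂sampleLaw P ι =
      (Fintype.card ι - 1) * ∫ y, ∫ z, h (y, z) ^ 2 ∂P ∂P := by
    intro i
    simp only [rowSum]
    simp_rw [sq_sum_eq_diag_add_offDiag]
    have hhb : ∀ i j : ι, BoundedMeasurable fun x : ι → S => h (x i, x j) :=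
      fun i j => hb.comp (by fun_prop)
    rw [integral_add (BoundedMeasurable.sum fun j _ => (hhb i j).pow 2).integrable
      (BoundedMeasurable.sum fun τ _ => (hhb i τ.1).mul (hhb i τ.2)).integrable,
      integral_finsetSum _ fun j _ => ((hhb i j).pow 2).integrable,
      integral_finsetSum _ fun τ _ => ((hhb i τ.1).mul (hhb i τ.2)).integrable]
    rw [Finset.sum_congr rfl fun j hj => integral_eval_pair (f := fun q => h q ^ 2) (hb.pow 2)
      (Finset.ne_of_mem_erase hj).symm, Finset.sum_const, nsmul_eq_mul, cast_card_univ_erase]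
    rw [Finset.sum_eq_zero, add_zero]
    intro τ hτ
    rw [Finset.mem_offDiag] at hτ
    rw [integral_mul_eval_eq_integral_sq hb (Finset.ne_of_mem_erase hτ.1).symm
      (Finset.ne_of_mem_erase hτ.2.1).symm hτ.2.2]
    simp [hh.integral_eq_zero]
  rw [Finset.sum_congr rfl fun i _ => key i]
  simp
  ring

end QuadraticVariation

/-! ### Stein's identity for the characteristic function -/

section CharFun

/-- A first order Taylor bound for `exp`, expanded around the right end point: the left-hand side is
the norm of `∫ u exp(iu)` over `[0, y]`. -/
lemma norm_cexp_I_mul_sub_le (y : ℝ) :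
    ‖Complex.exp (Complex.I * y) - 1 - Complex.I * y * Complex.exp (Complex.I * y)‖ ≤ y ^ 2 := by
  set f : ℝ → ℂ := fun u => Complex.exp (Complex.I * u) - 1 -
    Complex.I * u * Complex.exp (Complex.I * u) with hf
  have hd : ∀ u : ℝ, HasDerivAt f ((u : ℂ) * Complex.exp (Complex.I * u)) u := by
    intro u
    have h0 : HasDerivAt (fun u : ℝ => Complex.I * (u : ℂ)) Complex.I u := by
      simpa using (Complex.ofRealCLM.hasDerivAt (x := u)).const_mul Complex.I
    have h1 := h0.cexp
    have h2 := (h1.sub_const (1 : ℂ)).sub (h0.mul h1)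
    refine h2.congr_deriv ?_
    linear_combination (-(u : ℂ) * Complex.exp (Complex.I * u)) * Complex.I_sq
  have := (convex_Icc (-|y|) |y|).norm_image_sub_le_of_norm_hasDerivWithin_le
    (f := f) (C := |y|) (fun u _ => (hd u).hasDerivWithinAt) (x := 0) (y := y)
    (fun u hu => by
      rw [norm_mul, Complex.norm_exp_I_mul_ofReal, mul_one, Complex.norm_real]
      exact abs_le.2 hu) (by simp) ⟨neg_abs_le y, le_abs_self y⟩
  simpa [hf, ← sq] using this

variable {S : Type*} [MeasurableSpace S] {P : Measure S} [IsProbabilityMeasure P]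
  {ι : Type*} [Fintype ι] [DecidableEq ι]

lemma BoundedMeasurable.integrable_mul_cexp {α : Type*} [MeasurableSpace α] {μ : Measure α}
    [IsFiniteMeasure μ] {f u : α → ℝ} (hf : BoundedMeasurable f) (hu : Measurable u) :
    Integrable (fun x => (f x : ℂ) * Complex.exp (Complex.I * u x)) μ := by
  obtain ⟨C, hC⟩ := hf.bounded
  have := hf.measurable
  refine Integrable.of_bound (C := C) (by fun_prop) (ae_of_all _ fun x => ?_)
  rw [norm_mul, Complex.norm_exp_I_mul_ofReal, mul_one, Complex.norm_real]
  exact hC x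

/-- Removing the contribution of the coordinate `i` from `pairSum h`. -/
lemma pairSum_sub_rowSum_update {h : S × S → ℝ} (hs : ∀ x y, h (x, y) = h (y, x)) (i : ι)
    (x : ι → S) (z : S) :
    pairSum h (Function.update x i z) - 2 * rowSum h i (Function.update x i z) =
      pairSum h x - 2 * rowSum h i x := by
  have e : ∀ x : ι → S, pairSum h x - 2 * rowSum h i x =
      ∑ j ∈ Finset.univ.erase i, ∑ k ∈ (Finset.univ.erase j).erase i, h (x j, x k) := by
    intro x
    have h1 : ∀ j ∈ Finset.univ.erase i, rowSum h j x =
        h (x i, x j) + ∑ k ∈ (Finset.univ.erase j).erase i, h (x j, x k) := by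
      intro j hj
      rw [rowSum, ← Finset.add_sum_erase (Finset.univ.erase j) _
        (by simpa [eq_comm] using hj : i ∈ Finset.univ.erase j), hs]
    rw [pairSum, ← Finset.add_sum_erase _ _ (Finset.mem_univ i), Finset.sum_congr rfl h1,
      Finset.sum_add_distrib]
    simp only [rowSum]
    ring
  rw [e, e]
  refine Finset.sum_congr rfl fun j hj => Finset.sum_congr rfl fun k hk => ?_
  rw [Function.update_of_ne (Finset.ne_of_mem_erase hj),
    Function.update_of_ne (Finset.ne_of_mem_erase hk)]

/-- Given the other coordinates, the `i`-th row is centred. -/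
lemma integral_rowSum_update {h : S × S → ℝ} (hh : IsDegenerateKernel h P) (i : ι) (x : ι → S) :
    ∫ z, rowSum h i (Function.update x i z) ∂P = 0 := by
  have hb := hh.boundedMeasurable
  have e : ∀ z, rowSum h i (Function.update x i z) = ∑ j ∈ Finset.univ.erase i, h (x j, z) := by
    intro z
    refine Finset.sum_congr rfl fun j hj => ?_
    rw [Function.update_self, Function.update_of_ne (Finset.ne_of_mem_erase hj), hh.symm]
  simp_rw [e]
  rw [integral_finsetSum _ fun j _ => (hb.comp (e := fun z => (x j, z)) (by fun_prop)).integrable]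
  simp [hh.integral_eq_zero]

/-- Stein's identity for one coordinate. The variable `pairSum h - 2 * rowSum h i` does not depend
on the `i`-th coordinate, and `rowSum h i` averages to zero over it. -/
lemma norm_integral_rowSum_mul_cexp_sub_le {h : S × S → ℝ} (hh : IsDegenerateKernel h P) (i : ι)
    (s : ℝ) :
    ‖∫ x, (rowSum h i x : ℂ) * Complex.exp (Complex.I * (s * pairSum h x : ℝ)) ∂sampleLaw P ι -
      2 * s * Complex.I * ∫ x, ((rowSum h i x ^ 2 : ℝ) : ℂ) *
        Complex.exp (Complex.I * (s * pairSum h x : ℝ)) ∂sampleLaw P ι‖ ≤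
      4 * s ^ 2 * ∫ x, |rowSum h i x| ^ 3 ∂sampleLaw P ι := by
  have hb := hh.boundedMeasurable
  have hS : BoundedMeasurable (rowSum (ι := ι) h i) := hb.rowSum i
  have hU : BoundedMeasurable (pairSum (ι := ι) h) := hb.pairSum
  set V : (ι → S) → ℝ := fun x => pairSum h x - 2 * rowSum h i x with hV
  have hVb : BoundedMeasurable V := hU.sub (hS.const_mul 2)
  have mU : Measurable fun x : ι → S => s * pairSum h x := (hU.const_mul s).measurable
  have mV : Measurable fun x : ι → S => s * V x := (hVb.const_mul s).measurable
  -- resampling the `i`-th coordinate fixes `V` and averages the row to zero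
  have h0 : ∫ x, (rowSum h i x : ℂ) * Complex.exp (Complex.I * (s * V x : ℝ)) ∂sampleLaw P ι
      = 0 := by
    rw [integral_eq_integral_update P (hS.integrable_mul_cexp mV) i]
    have : ∀ x z, V (Function.update x i z) = V x := pairSum_sub_rowSum_update hh.symm i
    simp_rw [this, integral_mul_const, integral_complex_ofReal, integral_rowSum_update hh i]
    simp
  have i1 := hS.integrable_mul_cexp (μ := sampleLaw P ι) mU
  have i2 := (hS.pow 2).integrable_mul_cexp (μ := sampleLaw P ι) mU
  have i3 := hS.integrable_mul_cexp (μ := sampleLaw P ι) mV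
  rw [← integral_const_mul, ← sub_zero (∫ x, _ ∂_ : ℂ), ← h0, ← integral_sub i1 i3,
    ← integral_sub (by exact i1.sub i3) (i2.const_mul _), ← integral_const_mul]
  refine norm_integral_le_of_norm_le ((hS.abs.pow 3).const_mul _).integrable
    (ae_of_all _ fun x => ?_)
  set a := rowSum h i x with ha
  have hUV : pairSum h x = V x + 2 * a := by simp only [hV, ha]; ring
  have hy := norm_cexp_I_mul_sub_le (2 * s * a)
  have e : (a : ℂ) * Complex.exp (Complex.I * (s * pairSum h x : ℝ)) -
      a * Complex.exp (Complex.I * (s * V x : ℝ)) -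
      2 * s * Complex.I * (((a ^ 2 : ℝ) : ℂ) * Complex.exp (Complex.I * (s * pairSum h x : ℝ))) =
      a * Complex.exp (Complex.I * (s * V x : ℝ)) *
        (Complex.exp (Complex.I * (2 * s * a : ℝ)) - 1 -
          Complex.I * (2 * s * a : ℝ) * Complex.exp (Complex.I * (2 * s * a : ℝ))) := by
    rw [hUV]
    have : Complex.exp (Complex.I * (s * (V x + 2 * a) : ℝ)) =
        Complex.exp (Complex.I * (s * V x : ℝ)) * Complex.exp (Complex.I * (2 * s * a : ℝ)) := by
      rw [← Complex.exp_add]; push_cast; ring_nf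
    rw [this]
    push_cast
    ring
  rw [e, norm_mul, norm_mul, Complex.norm_exp_I_mul_ofReal, mul_one, Complex.norm_real,
    Real.norm_eq_abs]
  calc |a| * _ ≤ |a| * (2 * s * a) ^ 2 := by gcongr
    _ = 4 * s ^ 2 * |a| ^ 3 := by
      rw [mul_pow, mul_pow, ← sq_abs a]; ring

/-- The characteristic function of `pairSum h` almost solves the differential equation
`φ' = -L s φ` of the Gaussian characteristic function. -/
lemma norm_deriv_charFun_pairSum_add_le {h : S × S → ℝ} (hh : IsDegenerateKernel h P) (L s : ℝ) :
    ‖∫ x, Complex.I * (pairSum h x : ℂ) *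
        Complex.exp (Complex.I * (s * pairSum h x : ℝ)) ∂sampleLaw P ι +
      s * L * ∫ x, Complex.exp (Complex.I * (s * pairSum h x : ℝ)) ∂sampleLaw P ι‖ ≤
      |s| * ∫ x : ι → S, |2 * ∑ i, rowSum h i x ^ 2 - L| ∂sampleLaw P ι +
      4 * s ^ 2 * ∑ i, ∫ x : ι → S, |rowSum h i x| ^ 3 ∂sampleLaw P ι := by
  have hb := hh.boundedMeasurable
  have hS : ∀ i, BoundedMeasurable (rowSum (ι := ι) h i) := fun i => hb.rowSum i
  have hU : BoundedMeasurable (pairSum (ι := ι) h) := hb.pairSum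
  have mU : Measurable fun x : ι → S => s * pairSum h x := (hU.const_mul s).measurable
  have hQ : BoundedMeasurable fun x : ι → S => 2 * ∑ i, rowSum h i x ^ 2 - L :=
    ((BoundedMeasurable.sum fun i _ => (hS i).pow 2).const_mul 2).sub (BoundedMeasurable.const _)
  set E : (ι → S) → ℂ := fun x => Complex.exp (Complex.I * (s * pairSum h x : ℝ)) with hE
  have i1 : ∀ i, Integrable (fun x => (rowSum h i x : ℂ) * E x) (sampleLaw P ι) :=
    fun i => (hS i).integrable_mul_cexp mU
  have i2 : ∀ i, Integrable (fun x => ((rowSum h i x ^ 2 : ℝ) : ℂ) * E x) (sampleLaw P ι) :=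
    fun i => ((hS i).pow 2).integrable_mul_cexp mU
  have i3 : Integrable E (sampleLaw P ι) := by
    simpa [hE] using (BoundedMeasurable.const (1 : ℝ)).integrable_mul_cexp (μ := sampleLaw P ι) mU
  have i4 : Integrable (fun x => ((2 * ∑ i, rowSum h i x ^ 2 - L : ℝ) : ℂ) * E x)
      (sampleLaw P ι) := hQ.integrable_mul_cexp mU
  have e1 : ∫ x, Complex.I * (pairSum h x : ℂ) * E x ∂sampleLaw P ι =
      Complex.I * ∑ i, ∫ x, (rowSum h i x : ℂ) * E x ∂sampleLaw P ι := by
    rw [← integral_finsetSum _ fun i _ => i1 i, ← integral_const_mul]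
    congr with x
    simp only [pairSum, Complex.ofReal_sum, Finset.sum_mul, Finset.mul_sum, mul_assoc]
  have e2 : ∫ x, ((2 * ∑ i, rowSum h i x ^ 2 - L : ℝ) : ℂ) * E x ∂sampleLaw P ι =
      2 * ∑ i, ∫ x, ((rowSum h i x ^ 2 : ℝ) : ℂ) * E x ∂sampleLaw P ι -
        L * ∫ x, E x ∂sampleLaw P ι := by
    rw [← integral_finsetSum _ fun i _ => i2 i, ← integral_const_mul, ← integral_const_mul,
      ← integral_sub ((integrable_finsetSum _ fun i _ => i2 i).const_mul _) (i3.const_mul _)]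
    congr with x
    push_cast
    rw [sub_mul, mul_assoc, Finset.sum_mul]
  have e3 : ∫ x, Complex.I * (pairSum h x : ℂ) * E x ∂sampleLaw P ι +
      s * L * ∫ x, E x ∂sampleLaw P ι =
      Complex.I * ∑ i, (∫ x, (rowSum h i x : ℂ) * E x ∂sampleLaw P ι -
        2 * s * Complex.I * ∫ x, ((rowSum h i x ^ 2 : ℝ) : ℂ) * E x ∂sampleLaw P ι) -
      s * ∫ x, ((2 * ∑ i, rowSum h i x ^ 2 - L : ℝ) : ℂ) * E x ∂sampleLaw P ι := by
    rw [e1, e2, Finset.sum_sub_distrib, ← Finset.mul_sum]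
    linear_combination (2 * s * ∑ i, ∫ x, ((rowSum h i x ^ 2 : ℝ) : ℂ) * E x ∂sampleLaw P ι) *
      Complex.I_sq
  rw [e3, add_comm (|s| * _)]
  refine (norm_sub_le _ _).trans (add_le_add ?_ ?_)
  · rw [norm_mul, Complex.norm_I, one_mul, Finset.mul_sum]
    exact (norm_sum_le _ _).trans
      (Finset.sum_le_sum fun i _ => norm_integral_rowSum_mul_cexp_sub_le hh i s)
  · rw [norm_mul, Complex.norm_real, Real.norm_eq_abs]
    gcongr
    refine norm_integral_le_of_norm_le hQ.abs.integrable (ae_of_all _ fun x => ?_)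
    rw [norm_mul, hE, Complex.norm_exp_I_mul_ofReal, mul_one, Complex.norm_real, Real.norm_eq_abs]

lemma hasDerivAt_integral_cexp {α : Type*} [MeasurableSpace α] {μ : Measure α}
    [IsFiniteMeasure μ] {u : α → ℝ} (hu : BoundedMeasurable u) (s : ℝ) :
    HasDerivAt (fun s : ℝ => ∫ x, Complex.exp (Complex.I * (s * u x : ℝ)) ∂μ)
      (∫ x, Complex.I * (u x : ℂ) * Complex.exp (Complex.I * (s * u x : ℝ)) ∂μ) s := by
  obtain ⟨C, hC⟩ := hu.bounded
  have hm := hu.measurable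
  refine (hasDerivAt_integral_of_dominated_loc_of_deriv_le (s := Set.univ) (bound := fun _ => C)
    (F := fun (s : ℝ) x => Complex.exp (Complex.I * (s * u x : ℝ)))
    (F' := fun (s : ℝ) x => Complex.I * (u x : ℂ) * Complex.exp (Complex.I * (s * u x : ℝ)))
    Filter.univ_mem (Eventually.of_forall fun s => by fun_prop) ?_ (by fun_prop)
    (ae_of_all _ fun x t _ => ?_) (integrable_const C) (ae_of_all _ fun x t _ => ?_)).2
  · refine Integrable.of_bound (C := 1) (by fun_prop) (ae_of_all _ fun x => ?_)
    rw [Complex.norm_exp_I_mul_ofReal]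
  · rw [norm_mul, norm_mul, Complex.norm_I, one_mul, Complex.norm_exp_I_mul_ofReal, mul_one,
      Complex.norm_real]
    exact hC x
  · have h0 : HasDerivAt (fun t : ℝ => Complex.I * ((t * u x : ℝ) : ℂ)) (Complex.I * u x) t := by
      have := ((Complex.ofRealCLM.hasDerivAt (x := t)).mul_const (u x : ℂ)).const_mul Complex.I
      simpa using this
    exact h0.cexp.congr_deriv (mul_comm _ _)

/-- Comparison of a function satisfying `f' ≈ -L s f` with the solution `exp (-L t² / 2)`. -/
lemma norm_mul_exp_sub_one_le {f f' : ℝ → ℂ} (hf : ∀ s, HasDerivAt f (f' s) s) (h0 : f 0 = 1)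
    {L a b : ℝ} (hL : 0 ≤ L) (hab : ∀ s, ‖f' s + s * L * f s‖ ≤ |s| * a + s ^ 2 * b) (ha : 0 ≤ a)
    (hb : 0 ≤ b) (t : ℝ) :
    ‖f t * Complex.exp (L * t ^ 2 / 2 : ℝ) - 1‖ ≤
      Real.exp (L * t ^ 2 / 2) * (|t| * a + t ^ 2 * b) * |t| := by
  set ψ : ℝ → ℂ := fun s => f s * Complex.exp (L * s ^ 2 / 2 : ℝ) with hψ
  have hd : ∀ s, HasDerivAt ψ ((f' s + s * L * f s) * Complex.exp (L * s ^ 2 / 2 : ℝ)) s := by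
    intro s
    have h1 : HasDerivAt (fun s : ℝ => ((L * s ^ 2 / 2 : ℝ) : ℂ)) ((L * s : ℝ) : ℂ) s := by
      have : HasDerivAt (fun s : ℝ => L * s ^ 2 / 2) (L * s) s := by
        have := ((hasDerivAt_pow 2 s).const_mul L).div_const 2
        refine this.congr_deriv ?_
        norm_num; ring
      exact this.ofReal_comp
    refine ((hf s).mul h1.cexp).congr_deriv ?_
    push_cast
    ring
  have := (convex_Icc (-|t|) |t|).norm_image_sub_le_of_norm_hasDerivWithin_le
    (f := ψ) (C := Real.exp (L * t ^ 2 / 2) * (|t| * a + t ^ 2 * b))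
    (fun u _ => (hd u).hasDerivWithinAt) (x := 0) (y := t) (fun u hu => by
      have hut : |u| ≤ |t| := abs_le.2 hu
      have hut2 : u ^ 2 ≤ t ^ 2 := sq_le_sq.2 hut
      rw [norm_mul, mul_comm, ← Complex.ofReal_exp, Complex.norm_real, Real.norm_eq_abs,
        abs_of_pos (Real.exp_pos _)]
      refine mul_le_mul (Real.exp_le_exp.2 (by gcongr)) ((hab u).trans (by gcongr))
        (norm_nonneg _) (Real.exp_pos _).le) (by simp) ⟨neg_abs_le t, le_abs_self t⟩
  simpa [hψ, h0] using this

end CharFun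

/-! ### The central limit theorem for degenerate U-statistics -/

section CentralLimit

variable {S : Type*} [MeasurableSpace S] {P : Measure S} [IsProbabilityMeasure P]

/-- The third absolute moments of the rows are bounded by interpolation between their second and
fourth moments, `|a|³ ≤ ε a² + a⁴ / ε`. -/
lemma sum_integral_abs_rowSum_cube_le {ι : Type*} [Fintype ι] [DecidableEq ι] {h : S × S → ℝ}
    (hh : IsDegenerateKernel h P) {ε : ℝ} (hε : 0 < ε) :
    ∑ i, ∫ x : ι → S, |rowSum h i x| ^ 3 ∂sampleLaw P ι ≤
      ε * (Fintype.card ι * (Fintype.card ι - 1) * ∫ y, ∫ z, h (y, z) ^ 2 ∂P ∂P) +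
      ε⁻¹ * (2 * (Fintype.card ι : ℝ) ^ 2 * ∫ y, ∫ z, h (y, z) ^ 4 ∂P ∂P +
        10 * (Fintype.card ι : ℝ) ^ 3 * ∫ y, (∫ z, h (y, z) ^ 2 ∂P) ^ 2 ∂P) := by
  have hS : ∀ i : ι, BoundedMeasurable (rowSum h i) := fun i => hh.boundedMeasurable.rowSum i
  have key : ∀ i : ι, ∫ x : ι → S, |rowSum h i x| ^ 3 ∂sampleLaw P ι ≤
      ε * ∫ x : ι → S, rowSum h i x ^ 2 ∂sampleLaw P ι +
        ε⁻¹ * (2 * Fintype.card ι * ∫ y, ∫ z, h (y, z) ^ 4 ∂P ∂P +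
        10 * (Fintype.card ι : ℝ) ^ 2 * ∫ y, (∫ z, h (y, z) ^ 2 ∂P) ^ 2 ∂P) := by
    intro i
    have h1 : ∫ x : ι → S, |rowSum h i x| ^ 3 ∂sampleLaw P ι ≤
        ∫ x : ι → S, (ε * rowSum h i x ^ 2 + ε⁻¹ * rowSum h i x ^ 4) ∂sampleLaw P ι := by
      refine integral_mono ((hS i).abs.pow 3).integrable
        ((((hS i).pow 2).const_mul _).add (((hS i).pow 4).const_mul _)).integrable fun x => ?_
      simp only
      set a := rowSum h i x
      have e2 : a ^ 2 = |a| ^ 2 := (sq_abs a).symm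
      have e4 : a ^ 4 = |a| ^ 4 := ((even_two_mul 2).pow_abs a).symm
      rw [e2, e4]
      have hb : |a| ≤ ε + ε⁻¹ * |a| ^ 2 := by
        have : 0 ≤ ε⁻¹ * (|a| - ε) ^ 2 := by positivity
        have e : ε⁻¹ * (|a| - ε) ^ 2 = ε⁻¹ * |a| ^ 2 - 2 * |a| + ε := by field_simp; ring
        nlinarith [abs_nonneg a]
      calc |a| ^ 3 = |a| ^ 2 * |a| := by ring
        _ ≤ |a| ^ 2 * (ε + ε⁻¹ * |a| ^ 2) := by gcongr
        _ = _ := by ring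
    rw [integral_add (((hS i).pow 2).const_mul _).integrable (((hS i).pow 4).const_mul _).integrable,
      integral_const_mul, integral_const_mul] at h1
    have h2 := mul_le_mul_of_nonneg_left (integral_rowSum_pow_four_le hh i) (inv_pos.2 hε).le
    linarith
  refine (Finset.sum_le_sum fun i _ => key i).trans (le_of_eq ?_)
  rw [Finset.sum_add_distrib, ← Finset.mul_sum, sum_integral_rowSum_sq hh, Finset.sum_const,
    Finset.card_univ, nsmul_eq_mul]
  ring

lemma tendsto_zero_of_le_eps {a A D : ℕ → ℝ} {c : ℝ} (ha : ∀ n, 0 ≤ a n)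
    (hle : ∀ ε > 0, ∀ᶠ n in atTop, a n ≤ ε * A n + ε⁻¹ * D n) (hA : Tendsto A atTop (𝓝 c))
    (hD : Tendsto D atTop (𝓝 0)) : Tendsto a atTop (𝓝 0) := by
  refine tendsto_order.2 ⟨fun b hb => Eventually.of_forall fun n => hb.trans_le (ha n),
    fun b hb => ?_⟩
  -- with this `ε`, the limit `ε * c` of the bound is at most `b / 2`
  set ε := b / (2 * (|c| + 1)) with hε
  have hε0 : 0 < ε := by positivity
  have hlim : Tendsto (fun n => ε * A n + ε⁻¹ * D n) atTop (𝓝 (ε * c + ε⁻¹ * 0)) :=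
    (hA.const_mul ε).add (hD.const_mul _)
  have hlt : ε * c + ε⁻¹ * 0 < b := by
    have h1 : ε * c ≤ ε * |c| := mul_le_mul_of_nonneg_left (le_abs_self c) hε0.le
    have h2 : ε * (|c| + 1) = b / 2 := by rw [hε]; field_simp
    nlinarith
  filter_upwards [hle ε hε0, hlim.eventually_lt_const hlt] with n h1 h2 using h1.trans_lt h2

/-- Central limit theorem for degenerate U-statistics whose kernel varies with the sample size, in
terms of characteristic functions. -/
theorem tendsto_integral_cexp_pairSum {h : ℕ → S × S → ℝ}
    (hh : ∀ᶠ n in atTop, IsDegenerateKernel (h n) P) {L : ℝ} (hL : 0 ≤ L)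
    (h2 : Tendsto (fun n : ℕ => 2 * ((n : ℝ) * (n - 1) * ∫ y, ∫ z, h n (y, z) ^ 2 ∂P ∂P))
      atTop (𝓝 L))
    (h4 : Tendsto (fun n : ℕ => (n : ℝ) ^ 2 * ∫ y, ∫ z, h n (y, z) ^ 4 ∂P ∂P) atTop (𝓝 0))
    (h3 : Tendsto (fun n : ℕ => (n : ℝ) ^ 3 * ∫ y, (∫ z, h n (y, z) ^ 2 ∂P) ^ 2 ∂P)
      atTop (𝓝 0))
    (hκ : Tendsto (fun n : ℕ => (n : ℝ) ^ 4 * ∫ y, ∫ z, contraction (h n) P (y, z) ^ 2 ∂P ∂P)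
      atTop (𝓝 0)) (t : ℝ) :
    Tendsto (fun n : ℕ => ∫ x : Fin n → S, Complex.exp (Complex.I * (t * pairSum (h n) x : ℝ))
      ∂sampleLaw P (Fin n)) atTop (𝓝 (Complex.exp (-(L * t ^ 2 / 2) : ℝ))) := by
  set m2 : ℕ → ℝ := fun n => ∫ y, ∫ z, h n (y, z) ^ 2 ∂P ∂P with hm2
  set m4 : ℕ → ℝ := fun n => ∫ y, ∫ z, h n (y, z) ^ 4 ∂P ∂P with hm4
  set m3 : ℕ → ℝ := fun n => ∫ y, (∫ z, h n (y, z) ^ 2 ∂P) ^ 2 ∂P with hm3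
  set κ : ℕ → ℝ := fun n => ∫ y, ∫ z, contraction (h n) P (y, z) ^ 2 ∂P ∂P with hκdef
  have hκ0 : ∀ n, 0 ≤ κ n := fun n => integral_nonneg fun _ => integral_nonneg fun _ => sq_nonneg _
  set a : ℕ → ℝ := fun n =>
    ∫ x : Fin n → S, |2 * ∑ i, rowSum (h n) i x ^ 2 - L| ∂sampleLaw P (Fin n) with ha
  set b : ℕ → ℝ := fun n =>
    ∑ i, ∫ x : Fin n → S, |rowSum (h n) i x| ^ 3 ∂sampleLaw P (Fin n) with hb
  have ha0 : ∀ n, 0 ≤ a n := fun n => integral_nonneg fun _ => abs_nonneg _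
  have hb0 : ∀ n, 0 ≤ b n := fun n =>
    Finset.sum_nonneg fun _ _ => integral_nonneg fun _ => by positivity
  have hb_lim : Tendsto b atTop (𝓝 0) := by
    refine tendsto_zero_of_le_eps (A := fun n => (n : ℝ) * (n - 1) * m2 n)
      (D := fun n => 2 * ((n : ℝ) ^ 2 * m4 n) + 10 * ((n : ℝ) ^ 3 * m3 n)) (c := L / 2) hb0 ?_ ?_ ?_
    · intro ε hε
      filter_upwards [hh] with n hn
      refine (sum_integral_abs_rowSum_cube_le hn hε).trans (le_of_eq ?_)
      simp only [Fintype.card_fin]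
      ring
    · refine (h2.div_const 2).congr fun n => ?_
      ring
    · simpa using (h4.const_mul 2).add (h3.const_mul 10)
  have ha_lim : Tendsto a atTop (𝓝 0) := by
    have hbound : ∀ᶠ n : ℕ in atTop, a n ≤ 2 * √(32 * ((n : ℝ) ^ 2 * m4 n) +
        232 * ((n : ℝ) ^ 3 * m3 n) + 232 * ((n : ℝ) ^ 4 * κ n)) +
        |2 * ((n : ℝ) * (n - 1) * m2 n) - L| := by
      filter_upwards [hh, eventually_ge_atTop 1] with n hn hn1
      have hn1' : (1 : ℝ) ≤ n := by exact_mod_cast hn1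
      have hQ : BoundedMeasurable fun x : Fin n → S =>
          ∑ i, rowSum (h n) i x ^ 2 - (n : ℝ) * (n - 1) * m2 n :=
        (BoundedMeasurable.sum fun i _ => (hn.boundedMeasurable.rowSum i).pow 2).sub
          (BoundedMeasurable.const _)
      have hQ' : BoundedMeasurable fun x : Fin n → S => 2 * ∑ i, rowSum (h n) i x ^ 2 - L :=
        ((BoundedMeasurable.sum fun i _ => (hn.boundedMeasurable.rowSum i).pow 2).const_mul 2).sub
          (BoundedMeasurable.const _)
      have h5 : a n ≤ ∫ x : Fin n → S, (2 * |∑ i, rowSum (h n) i x ^ 2 - (n : ℝ) * (n - 1) * m2 n| +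
          |2 * ((n : ℝ) * (n - 1) * m2 n) - L|) ∂sampleLaw P (Fin n) := by
        refine integral_mono hQ'.abs.integrable
          ((hQ.abs.const_mul 2).add (BoundedMeasurable.const _)).integrable fun x => ?_
        simp only
        set q := ∑ i, rowSum (h n) i x ^ 2
        set c := (n : ℝ) * (n - 1) * m2 n
        calc |2 * q - L| = |2 * (q - c) + (2 * c - L)| := by ring_nf
          _ ≤ |2 * (q - c)| + |2 * c - L| := abs_add_le _ _
          _ = _ := by rw [abs_mul, abs_two]
      rw [integral_add (hQ.abs.const_mul 2).integrable (BoundedMeasurable.const _).integrable,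
        integral_const_mul] at h5
      have h6 := integral_le_sqrt_integral_sq (μ := sampleLaw P (Fin n)) hQ
      have h7 := integral_sq_sum_rowSum_sq_sub_le (ι := Fin n) hn
      rw [Fintype.card_fin] at h7
      have h8 := Real.sqrt_le_sqrt (h7.trans (show _ ≤ 32 * ((n : ℝ) ^ 2 * m4 n) +
        232 * ((n : ℝ) ^ 3 * m3 n) + 232 * ((n : ℝ) ^ 4 * κ n) by
          have : (n : ℝ) ^ 3 ≤ (n : ℝ) ^ 4 := pow_le_pow_right₀ hn1' (by norm_num)
          have := mul_le_mul_of_nonneg_right this (hκ0 n)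
          simp only [hm4, hm3, hκdef] at this ⊢
          linarith))
      simp only [integral_const, probReal_univ, smul_eq_mul, one_mul] at h5
      have h9 := h6.trans h8
      linarith
    refine squeeze_zero' (Eventually.of_forall ha0) hbound ?_
    have l1 : Tendsto (fun n : ℕ => 32 * ((n : ℝ) ^ 2 * m4 n) +
        232 * ((n : ℝ) ^ 3 * m3 n) + 232 * ((n : ℝ) ^ 4 * κ n)) atTop (𝓝 0) := by
      simpa using ((h4.const_mul 32).add (h3.const_mul 232)).add (hκ.const_mul 232)
    have l2 := (Real.continuous_sqrt.tendsto 0).comp l1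
    have l3 := (h2.sub_const L).abs
    simpa using (l2.const_mul 2).add l3
  have hE := fun (n : ℕ) (hn : IsDegenerateKernel (h n) P) => norm_mul_exp_sub_one_le
    (f := fun s => ∫ x : Fin n → S, Complex.exp (Complex.I * (s * pairSum (h n) x : ℝ))
      ∂sampleLaw P (Fin n))
    (fun s => hasDerivAt_integral_cexp hn.boundedMeasurable.pairSum s) (by simp) hL
    (a := a n) (b := 4 * b n)
    (fun s => (norm_deriv_charFun_pairSum_add_le hn L s).trans (le_of_eq (by simp only [ha, hb]; ring)))
    (ha0 n) (by have := hb0 n; positivity) t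
  have hlim : Tendsto (fun n : ℕ => (∫ x : Fin n → S,
      Complex.exp (Complex.I * (t * pairSum (h n) x : ℝ)) ∂sampleLaw P (Fin n)) *
      Complex.exp (L * t ^ 2 / 2 : ℝ) - 1) atTop (𝓝 0) := by
    refine squeeze_zero_norm' (hh.mono hE) ?_
    have := ((((ha_lim.const_mul |t|).add ((hb_lim.const_mul 4).const_mul (t ^ 2))).const_mul
      (Real.exp (L * t ^ 2 / 2))).mul_const |t|)
    simpa using this
  have hfin := (hlim.add_const 1).mul_const (Complex.exp (-(L * t ^ 2 / 2) : ℝ))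
  simp only [sub_add_cancel, zero_add, one_mul] at hfin
  refine hfin.congr fun n => ?_
  rw [mul_assoc, ← Complex.exp_add, ← Complex.ofReal_add]
  simp

end CentralLimit

/-! ### Schur's test and kernels with small rows -/

section SmallKernel

variable {S : Type*} [MeasurableSpace S] {P : Measure S} [IsProbabilityMeasure P]

/-- A weighted Cauchy–Schwarz inequality. -/
lemma sq_integral_mul_le {u v : S → ℝ} (hu : BoundedMeasurable u) (hv : BoundedMeasurable v)
    {K : ℝ} (hK : 0 < K) (huK : ∫ x, |u x| ∂P ≤ K) :
    (∫ x, u x * v x ∂P) ^ 2 ≤ K * ∫ x, |u x| * v x ^ 2 ∂P := by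
  set A := ∫ x, |u x| * |v x| ∂P with hA
  have h1 : |∫ x, u x * v x ∂P| ≤ A := by
    refine (abs_integral_le_integral_abs).trans (le_of_eq ?_)
    simp_rw [abs_mul, hA]
  have h2 : (∫ x, u x * v x ∂P) ^ 2 ≤ A ^ 2 := by
    rw [← sq_abs]
    gcongr
  have b1 := hu.abs.mul hv.abs
  have b2 : BoundedMeasurable fun x => |u x| * v x ^ 2 := hu.abs.mul (hv.pow 2)
  -- `A / K` replaces the weighted mean `A / ∫ |u|`, which avoids the case `∫ |u| = 0`
  have h3 : 0 ≤ ∫ x, |u x| * (|v x| - A / K) ^ 2 ∂P :=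
    integral_nonneg fun x => mul_nonneg (abs_nonneg _) (sq_nonneg _)
  have e : ∀ x, |u x| * (|v x| - A / K) ^ 2 =
      |u x| * v x ^ 2 - (2 * (A / K)) * (|u x| * |v x|) + (A / K) ^ 2 * |u x| := by
    intro x; rw [← sq_abs (v x)]; ring
  simp_rw [e] at h3
  rw [integral_add (b2.sub (b1.const_mul _)).integrable (hu.abs.const_mul _).integrable,
    integral_sub b2.integrable (b1.const_mul _).integrable, integral_const_mul,
    integral_const_mul, ← hA] at h3
  have h4 : (A / K) ^ 2 * ∫ x, |u x| ∂P ≤ (A / K) ^ 2 * K := by gcongr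
  have h5 : 0 ≤ ∫ x, |u x| * v x ^ 2 ∂P - A ^ 2 / K := by
    have : (A / K) ^ 2 * K = A ^ 2 / K := by field_simp
    have : 2 * (A / K) * A = 2 * (A ^ 2 / K) := by ring
    linarith
  have h6 : A ^ 2 / K * K = A ^ 2 := by field_simp
  nlinarith

/-- Schur's test: the operator with kernel `h` has norm at most `K` on `L²(P)`, so that the square
of the operator has Hilbert–Schmidt norm at most `K` times that of the operator. -/
lemma integral_sq_contraction_le {h : S × S → ℝ} (hb : BoundedMeasurable h)
    (hs : ∀ x y, h (x, y) = h (y, x)) {K : ℝ} (hK : 0 < K)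
    (hrow : ∀ x, ∫ z, |h (x, z)| ∂P ≤ K) :
    ∫ y, ∫ z, contraction h P (y, z) ^ 2 ∂P ∂P ≤ K ^ 2 * ∫ y, ∫ z, h (y, z) ^ 2 ∂P ∂P := by
  have h1 : ∀ y z, contraction h P (y, z) ^ 2 ≤ K * ∫ x, |h (x, y)| * h (x, z) ^ 2 ∂P := by
    intro y z
    refine sq_integral_mul_le (hb.comp (e := fun x : S => (x, y)) (by fun_prop))
      (hb.comp (e := fun x : S => (x, z)) (by fun_prop)) hK ?_
    simp_rw [fun x => hs x y]
    exact hrow y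
  have b3 : BoundedMeasurable fun p : (S × S) × S => |h (p.2, p.1.1)| * h (p.2, p.1.2) ^ 2 :=
    (hb.comp (e := fun p : (S × S) × S => (p.2, p.1.1)) (by fun_prop)).abs.mul
      ((hb.comp (e := fun p : (S × S) × S => (p.2, p.1.2)) (by fun_prop)).pow 2)
  have b2 : BoundedMeasurable fun p : S × S => ∫ x, |h (x, p.1)| * h (x, p.2) ^ 2 ∂P :=
    b3.integral_right P
  have h2 : ∫ y, ∫ z, contraction h P (y, z) ^ 2 ∂P ∂P ≤
      ∫ y, ∫ z, K * ∫ x, |h (x, y)| * h (x, z) ^ 2 ∂P ∂P ∂P := by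
    refine integral_mono ((hb.contraction.pow 2).integral_right P).integrable
      ((b2.const_mul K).integral_right P).integrable fun y => ?_
    exact integral_mono
      ((hb.contraction.pow 2).comp (e := fun z : S => (y, z)) (by fun_prop)).integrable
      ((b2.const_mul K).comp (e := fun z : S => (y, z)) (by fun_prop)).integrable fun z => h1 y z
  have h3 : ∀ y, ∫ z, ∫ x, |h (x, y)| * h (x, z) ^ 2 ∂P ∂P =
      ∫ x, |h (x, y)| * ∫ z, h (x, z) ^ 2 ∂P ∂P := by
    intro y
    rw [integral_integral_swap (f := fun z x => |h (x, y)| * h (x, z) ^ 2)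
      (b3.comp (e := fun p : S × S => ((y, p.1), p.2)) (by fun_prop)).integrable]
    simp_rw [integral_const_mul]
  have hq : BoundedMeasurable fun x => ∫ z, h (x, z) ^ 2 ∂P := (hb.pow 2).integral_right P
  have h4 : ∫ y, ∫ x, |h (x, y)| * ∫ z, h (x, z) ^ 2 ∂P ∂P ∂P =
      ∫ x, (∫ y, |h (x, y)| ∂P) * ∫ z, h (x, z) ^ 2 ∂P ∂P := by
    rw [integral_integral_swap (f := fun y x => |h (x, y)| * ∫ z, h (x, z) ^ 2 ∂P)
      ((hb.comp (e := fun p : S × S => (p.2, p.1)) (by fun_prop)).abs.mul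
        (hq.comp measurable_snd)).integrable]
    simp_rw [integral_mul_const]
  have h5 : ∫ x, (∫ y, |h (x, y)| ∂P) * ∫ z, h (x, z) ^ 2 ∂P ∂P ≤
      ∫ x, K * ∫ z, h (x, z) ^ 2 ∂P ∂P := by
    refine integral_mono ((hb.abs.integral_right P).mul hq).integrable
      (hq.const_mul K).integrable fun x => ?_
    exact mul_le_mul_of_nonneg_right (hrow x) (integral_nonneg fun z => sq_nonneg _)
  simp_rw [integral_const_mul, h3] at h2
  rw [h4] at h2
  rw [integral_const_mul] at h5
  calc _ ≤ _ := h2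
    _ ≤ K * (K * ∫ y, ∫ z, h (y, z) ^ 2 ∂P ∂P) := by gcongr
    _ = _ := by ring

/-- A symmetric kernel with values in `[0, 1]` all of whose rows have integral at most `M`. -/
structure IsSmallKernel (G : S × S → ℝ) (P : Measure S) (M : ℝ) : Prop where
  measurable : Measurable G
  nonneg : ∀ q, 0 ≤ G q
  le_one : ∀ q, G q ≤ 1
  symm : ∀ x y, G (x, y) = G (y, x)
  integral_le : ∀ x, ∫ z, G (x, z) ∂P ≤ M

namespace IsSmallKernel

variable {G : S × S → ℝ} {M : ℝ}

lemma boundedMeasurable (hG : IsSmallKernel G P M) : BoundedMeasurable G :=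
  ⟨hG.measurable, 1, fun q => abs_le.2 ⟨by linarith [hG.nonneg q], hG.le_one q⟩⟩

lemma integral_nonneg (hG : IsSmallKernel G P M) (x : S) : 0 ≤ ∫ z, G (x, z) ∂P :=
  MeasureTheory.integral_nonneg fun _ => hG.nonneg _

lemma integral_le_one (hG : IsSmallKernel G P M) (x : S) : ∫ z, G (x, z) ∂P ≤ 1 := by
  have := integral_mono (μ := P)
    (hG.boundedMeasurable.comp (e := fun z : S => (x, z)) (by fun_prop)).integrable
    (integrable_const 1) fun z => hG.le_one (x, z)
  simpa using this

lemma integral_integral_nonneg (hG : IsSmallKernel G P M) : 0 ≤ ∫ y, ∫ z, G (y, z) ∂P ∂P :=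
  MeasureTheory.integral_nonneg fun y => hG.integral_nonneg y

lemma integral_integral_le (hG : IsSmallKernel G P M) : ∫ y, ∫ z, G (y, z) ∂P ∂P ≤ M := by
  have := integral_mono (μ := P) (hG.boundedMeasurable.integral_right P).integrable
    (integrable_const M) fun y => hG.integral_le y
  simpa using this

lemma integral_integral_le_one (hG : IsSmallKernel G P M) : ∫ y, ∫ z, G (y, z) ∂P ∂P ≤ 1 := by
  have := integral_mono (μ := P) (hG.boundedMeasurable.integral_right P).integrable
    (integrable_const 1) fun y => hG.integral_le_one y
  simpa using this

lemma integral_sq_integral_le (hG : IsSmallKernel G P M) :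
    ∫ y, (∫ z, G (y, z) ∂P) ^ 2 ∂P ≤ M ^ 2 := by
  have := integral_mono (μ := P) ((hG.boundedMeasurable.integral_right P).pow 2).integrable
    (integrable_const (M ^ 2)) fun y =>
      pow_le_pow_left₀ (hG.integral_nonneg y) (hG.integral_le y) 2
  simpa using this

lemma abs_doublyCentred_le (hG : IsSmallKernel G P M) (q : S × S) :
    |doublyCentred G P q| ≤ 2 := by
  have h1 := hG.nonneg q
  have h2 := hG.le_one q
  have h3 := hG.integral_nonneg q.1
  have h4 := hG.integral_le_one q.1
  have h5 := hG.integral_nonneg q.2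
  have h6 := hG.integral_le_one q.2
  have h7 := hG.integral_integral_nonneg
  have h8 := hG.integral_integral_le_one
  rw [abs_le, doublyCentred]
  constructor <;> linarith

lemma integral_abs_doublyCentred_le (hG : IsSmallKernel G P M) (x : S) :
    ∫ z, |doublyCentred G P (x, z)| ∂P ≤ 4 * M := by
  have hb := hG.boundedMeasurable
  have b1 : BoundedMeasurable fun z => G (x, z) := hb.comp (by fun_prop)
  have b2 : BoundedMeasurable fun y => ∫ z, G (y, z) ∂P := hb.integral_right P
  have b3 : BoundedMeasurable fun _ : S => ∫ y, ∫ z, G (y, z) ∂P ∂P := BoundedMeasurable.const _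
  have b4 : BoundedMeasurable fun _ : S => ∫ z, G (x, z) ∂P := BoundedMeasurable.const _
  have h1 : ∫ z, |doublyCentred G P (x, z)| ∂P ≤ ∫ z, (G (x, z) + ∫ w, G (x, w) ∂P +
      ∫ w, G (z, w) ∂P + ∫ y, ∫ w, G (y, w) ∂P ∂P) ∂P := by
    refine integral_mono (hb.doublyCentred.abs.comp (e := fun z : S => (x, z))
      (by fun_prop)).integrable (((b1.add b4).add b2).add b3).integrable fun z => ?_
    have h1 := hG.nonneg (x, z)
    have h3 := hG.integral_nonneg x
    have h5 := hG.integral_nonneg z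
    have h7 := hG.integral_integral_nonneg
    simp only [doublyCentred]
    rw [abs_le]
    constructor <;> linarith
  rw [integral_add ((b1.add b4).add b2).integrable b3.integrable,
    integral_add (b1.add b4).integrable b2.integrable,
    integral_add b1.integrable b4.integrable] at h1
  simp only [integral_const, probReal_univ, smul_eq_mul, one_mul] at h1
  have h2 := hG.integral_le x
  have h3 := hG.integral_integral_le
  linarith

lemma integral_sq_doublyCentred_le (hG : IsSmallKernel G P M) (x : S) :
    ∫ z, doublyCentred G P (x, z) ^ 2 ∂P ≤ 8 * M := by
  have hb : BoundedMeasurable fun z => doublyCentred G P (x, z) :=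
    hG.boundedMeasurable.doublyCentred.comp (by fun_prop)
  have h1 : ∫ z, doublyCentred G P (x, z) ^ 2 ∂P ≤ ∫ z, 2 * |doublyCentred G P (x, z)| ∂P := by
    refine integral_mono (hb.pow 2).integrable (hb.abs.const_mul 2).integrable fun z => ?_
    simp only
    rw [← sq_abs]
    nlinarith [hG.abs_doublyCentred_le (x, z), abs_nonneg (doublyCentred G P (x, z))]
  rw [integral_const_mul] at h1
  linarith [hG.integral_abs_doublyCentred_le x]

lemma integral_sq_integral_sq_doublyCentred_le (hG : IsSmallKernel G P M) :
    ∫ y, (∫ z, doublyCentred G P (y, z) ^ 2 ∂P) ^ 2 ∂P ≤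
      8 * M * ∫ y, ∫ z, doublyCentred G P (y, z) ^ 2 ∂P ∂P := by
  have hq : BoundedMeasurable fun y => ∫ z, doublyCentred G P (y, z) ^ 2 ∂P :=
    (hG.boundedMeasurable.doublyCentred.pow 2).integral_right P
  rw [← integral_const_mul]
  refine integral_mono (hq.pow 2).integrable (hq.const_mul _).integrable fun y => ?_
  simp only
  rw [sq]
  exact mul_le_mul_of_nonneg_right (hG.integral_sq_doublyCentred_le y)
    (MeasureTheory.integral_nonneg fun z => sq_nonneg _)

lemma integral_pow_four_doublyCentred_le (hG : IsSmallKernel G P M) :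
    ∫ y, ∫ z, doublyCentred G P (y, z) ^ 4 ∂P ∂P ≤
      4 * ∫ y, ∫ z, doublyCentred G P (y, z) ^ 2 ∂P ∂P := by
  have hb := hG.boundedMeasurable.doublyCentred (P := P)
  simp_rw [← integral_const_mul]
  refine integral_mono ((hb.pow 4).integral_right P).integrable
    (((hb.pow 2).const_mul 4).integral_right P).integrable fun y => ?_
  refine integral_mono ((hb.pow 4).comp (e := fun z : S => (y, z)) (by fun_prop)).integrable
    (((hb.pow 2).const_mul 4).comp (e := fun z : S => (y, z)) (by fun_prop)).integrable fun z => ?_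
  have h1 : doublyCentred G P (y, z) ^ 2 ≤ 4 := by
    have := pow_le_pow_left₀ (abs_nonneg _) (hG.abs_doublyCentred_le (y, z)) 2
    rw [sq_abs] at this
    linarith
  simp only
  nlinarith [sq_nonneg (doublyCentred G P (y, z))]

lemma sq (hG : IsSmallKernel G P M) : IsSmallKernel (fun q => G q ^ 2) P M where
  measurable := hG.measurable.pow_const 2
  nonneg q := sq_nonneg _
  le_one q := pow_le_one₀ (hG.nonneg q) (hG.le_one q)
  symm x y := by simp only [hG.symm x y]
  integral_le x := by
    refine le_trans (integral_mono
      ((hG.boundedMeasurable.pow 2).comp (e := fun z : S => (x, z)) (by fun_prop)).integrable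
      (hG.boundedMeasurable.comp (e := fun z : S => (x, z)) (by fun_prop)).integrable
      fun z => ?_) (hG.integral_le x)
    exact pow_le_of_le_one (hG.nonneg _) (hG.le_one _) two_ne_zero

variable {ι : Type*} [Fintype ι] [DecidableEq ι]

/-- The variance of a U-statistic with a small kernel. -/
lemma integral_sq_pairSum_sub_le (hG : IsSmallKernel G P M) :
    ∫ x : ι → S, (pairSum G x - Fintype.card ι * (Fintype.card ι - 1) *
        ∫ y, ∫ z, G (y, z) ∂P ∂P) ^ 2 ∂sampleLaw P ι ≤
      (16 * (Fintype.card ι : ℝ) ^ 2 + 8 * (Fintype.card ι : ℝ) ^ 3 * M) *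
        ∫ y, ∫ z, G (y, z) ∂P ∂P := by
  have hb := hG.boundedMeasurable
  refine (GaussMMD.integral_sq_pairSum_sub_le hb hG.symm).trans ?_
  have h1 : ∫ y, ∫ z, G (y, z) ^ 2 ∂P ∂P ≤ ∫ y, ∫ z, G (y, z) ∂P ∂P := by
    refine integral_mono ((hb.pow 2).integral_right P).integrable (hb.integral_right P).integrable
      fun y => integral_mono ((hb.pow 2).comp (e := fun z : S => (y, z)) (by fun_prop)).integrable
      (hb.comp (e := fun z : S => (y, z)) (by fun_prop)).integrable fun z => ?_
    exact pow_le_of_le_one (hG.nonneg _) (hG.le_one _) two_ne_zero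
  have h2 : ∫ y, (∫ z, G (y, z) ∂P) ^ 2 ∂P ≤ M * ∫ y, ∫ z, G (y, z) ∂P ∂P := by
    rw [← integral_const_mul]
    refine integral_mono ((hb.integral_right P).pow 2).integrable
      ((hb.integral_right P).const_mul M).integrable fun y => ?_
    simp only
    rw [_root_.sq]
    exact mul_le_mul_of_nonneg_right (hG.integral_le y) (hG.integral_nonneg y)
  calc _ ≤ 16 * (Fintype.card ι : ℝ) ^ 2 * ∫ y, ∫ z, G (y, z) ∂P ∂P +
        8 * (Fintype.card ι : ℝ) ^ 3 * (M * ∫ y, ∫ z, G (y, z) ∂P ∂P) := by gcongr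
    _ = _ := by ring

/-- A product of two kernels, one of which has an index of its own, has small expectation. -/
lemma integral_mul_le (hG : IsSmallKernel G P M) {a b l k : ι} (hab : a ≠ b) (hka : k ≠ a)
    (hkb : k ≠ b) (hkl : k ≠ l) :
    ∫ x : ι → S, G (x a, x b) * G (x l, x k) ∂sampleLaw P ι ≤ M ^ 2 := by
  have hb := hG.boundedMeasurable
  have hbb : ∀ i j : ι, BoundedMeasurable fun x : ι → S => G (x i, x j) :=
    fun i j => hb.comp (by fun_prop)
  have hq : BoundedMeasurable fun x : ι → S => ∫ z, G (x l, z) ∂P :=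
    (hb.integral_right P).comp (by fun_prop)
  rw [integral_eq_integral_update P ((hbb a b).mul (hbb l k)).integrable k]
  simp only [Function.update_self, Function.update_of_ne hka.symm, Function.update_of_ne hkb.symm,
    Function.update_of_ne hkl.symm, integral_const_mul]
  have h1 : ∫ x : ι → S, G (x a, x b) * ∫ z, G (x l, z) ∂P ∂sampleLaw P ι ≤
      ∫ x : ι → S, G (x a, x b) * M ∂sampleLaw P ι :=
    integral_mono ((hbb a b).mul hq).integrable ((hbb a b).mul (BoundedMeasurable.const M)).integrable
      fun x => mul_le_mul_of_nonneg_left (hG.integral_le _) (hG.nonneg _)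
  rw [integral_mul_const, integral_eval_pair hb hab] at h1
  have hM : 0 ≤ M := hG.integral_integral_nonneg.trans hG.integral_integral_le
  nlinarith [mul_le_mul_of_nonneg_right hG.integral_integral_le hM]

end IsSmallKernel

end SmallKernel

/-! ### Limit theorems for small kernels -/

section SmallKernelLimits

variable {S : Type*} [MeasurableSpace S] {P : Measure S} [IsProbabilityMeasure P]

lemma IsDegenerateKernel.const_mul {h : S × S → ℝ} (hh : IsDegenerateKernel h P) (b : ℝ) :
    IsDegenerateKernel (fun q => b * h q) P where
  boundedMeasurable := hh.boundedMeasurable.const_mul b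
  symm x y := by simp only [hh.symm x y]
  integral_eq_zero x := by rw [integral_const_mul, hh.integral_eq_zero, mul_zero]

lemma contraction_const_mul (h : S × S → ℝ) (b : ℝ) (q : S × S) :
    contraction (fun q => b * h q) P q = b ^ 2 * contraction h P q := by
  simp only [contraction, ← integral_const_mul]
  congr with x
  ring

lemma pairSum_const_mul {ι : Type*} [Fintype ι] [DecidableEq ι] (h : S × S → ℝ) (b : ℝ)
    (x : ι → S) : pairSum (fun q => b * h q) x = b * pairSum h x := by
  simp only [pairSum, rowSum, Finset.mul_sum]

/-- A sequence of small kernels `G n` and scalings `c n` in the regime in which the scaled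
U-statistic is asymptotically Gaussian with variance `L`. -/
structure KernelAsymptotics (G : ℕ → S × S → ℝ) (P : Measure S) (M c : ℕ → ℝ) (L : ℝ) : Prop where
  small : ∀ᶠ n in atTop, IsSmallKernel (G n) P (M n)
  bound_pos : ∀ᶠ n in atTop, 0 < M n
  scale_pos : ∀ᶠ n in atTop, 0 < c n
  tendsto_scale_mul_bound : Tendsto (fun n => c n * M n) atTop (𝓝 0)
  tendsto_scale_div : Tendsto (fun n : ℕ => c n / n) atTop (𝓝 0)
  tendsto_second_moment :
    Tendsto (fun n => c n ^ 2 * ∫ y, ∫ z, G n (y, z) ^ 2 ∂P ∂P) atTop (𝓝 L)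

namespace KernelAsymptotics

variable {G : ℕ → S × S → ℝ} {M c : ℕ → ℝ} {L : ℝ}

lemma nonneg (H : KernelAsymptotics G P M c L) : 0 ≤ L :=
  ge_of_tendsto' H.tendsto_second_moment fun _ => mul_nonneg (sq_nonneg _)
    (integral_nonneg fun _ => integral_nonneg fun _ => sq_nonneg _)

/-- Centring the kernel does not change the limit of the second moment. -/
lemma tendsto_second_moment_doublyCentred (H : KernelAsymptotics G P M c L) :
    Tendsto (fun n => c n ^ 2 * ∫ y, ∫ z, doublyCentred (G n) P (y, z) ^ 2 ∂P ∂P) atTop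
      (𝓝 L) := by
  have hsq : Tendsto (fun n => (c n * M n) ^ 2) atTop (𝓝 0) := by
    simpa using H.tendsto_scale_mul_bound.pow 2
  have h1 : Tendsto (fun n => c n ^ 2 * ∫ y, (∫ z, G n (y, z) ∂P) ^ 2 ∂P) atTop (𝓝 0) := by
    refine squeeze_zero' (Eventually.of_forall fun n => mul_nonneg (sq_nonneg _)
      (integral_nonneg fun _ => sq_nonneg _)) ?_ hsq
    filter_upwards [H.small] with n hn
    rw [mul_pow]
    exact mul_le_mul_of_nonneg_left hn.integral_sq_integral_le (sq_nonneg _)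
  have h2 : Tendsto (fun n => c n ^ 2 * (∫ y, ∫ z, G n (y, z) ∂P ∂P) ^ 2) atTop (𝓝 0) := by
    refine squeeze_zero' (Eventually.of_forall fun n => by positivity) ?_ hsq
    filter_upwards [H.small] with n hn
    rw [mul_pow]
    exact mul_le_mul_of_nonneg_left (pow_le_pow_left₀ hn.integral_integral_nonneg
      hn.integral_integral_le 2) (sq_nonneg _)
  have h3 := (H.tendsto_second_moment.sub (h1.const_mul 2)).add h2
  simp only [mul_zero, sub_zero, add_zero] at h3
  refine h3.congr' ?_
  filter_upwards [H.small] with n hn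
  rw [integral_sq_doublyCentred hn.boundedMeasurable hn.symm]
  ring

/-- The degenerate U-statistic with kernel `doublyCentred (G n) P` is asymptotically Gaussian. -/
lemma tendsto_integral_cexp (H : KernelAsymptotics G P M c L) (t : ℝ) :
    Tendsto (fun n : ℕ => ∫ x : Fin n → S, Complex.exp (Complex.I *
      (t * (c n / (√2 * (n - 1)) * pairSum (doublyCentred (G n) P) x) : ℝ))
      ∂sampleLaw P (Fin n)) atTop (𝓝 (Complex.exp (-(L * t ^ 2 / 2) : ℝ))) := by
  set b : ℕ → ℝ := fun n => c n / (√2 * (n - 1)) with hb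
  set m : ℕ → ℝ := fun n => ∫ y, ∫ z, doublyCentred (G n) P (y, z) ^ 2 ∂P ∂P with hm
  have hm0 : ∀ n, 0 ≤ m n := fun n => integral_nonneg fun _ => integral_nonneg fun _ => sq_nonneg _
  have hcm : Tendsto (fun n => c n ^ 2 * m n) atTop (𝓝 L) := H.tendsto_second_moment_doublyCentred
  have hb2 : ∀ n : ℕ, 2 ≤ n → b n ^ 2 = c n ^ 2 / (2 * ((n : ℝ) - 1) ^ 2) := by
    intro n _
    rw [hb]
    simp only [div_pow, mul_pow]
    rw [Real.sq_sqrt (by norm_num)]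
  have hb4 : ∀ n : ℕ, 2 ≤ n → b n ^ 4 ≤ 4 * c n ^ 4 / (n : ℝ) ^ 4 := by
    intro n hn
    have hn' : (2 : ℝ) ≤ n := by exact_mod_cast hn
    have e : b n ^ 4 = c n ^ 4 / (4 * ((n : ℝ) - 1) ^ 4) := by
      calc b n ^ 4 = (b n ^ 2) ^ 2 := by ring
        _ = _ := by rw [hb2 n hn, div_pow]; ring
    have h1 : (n : ℝ) / 2 ≤ n - 1 := by linarith
    have h2 : ((n : ℝ) / 2) ^ 4 ≤ (n - 1) ^ 4 := pow_le_pow_left₀ (by positivity) h1 4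
    have h3 : 0 < ((n : ℝ) / 2) ^ 4 := by positivity
    rw [e]
    calc c n ^ 4 / (4 * ((n : ℝ) - 1) ^ 4) ≤ c n ^ 4 / (4 * ((n : ℝ) / 2) ^ 4) := by gcongr
      _ = _ := by field_simp; ring
  have key := tendsto_integral_cexp_pairSum (P := P) (L := L)
    (h := fun n q => b n * doublyCentred (G n) P q) ?_ H.nonneg ?_ ?_ ?_ ?_ t
  · simpa only [pairSum_const_mul] using key
  · filter_upwards [H.small] with n hn
    exact (isDegenerateKernel_doublyCentred hn.boundedMeasurable hn.symm).const_mul _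
  · have h1 : Tendsto (fun n : ℕ => (1 + 1 / ((n : ℝ) - 1)) * (c n ^ 2 * m n)) atTop
        (𝓝 ((1 + 0) * L)) := by
      refine (tendsto_const_nhds.add ?_).mul hcm
      exact tendsto_const_nhds.div_atTop
        (tendsto_atTop_add_const_right _ _ tendsto_natCast_atTop_atTop)
    rw [add_zero, one_mul] at h1
    refine h1.congr' ?_
    filter_upwards [eventually_ge_atTop 2] with n hn
    have hn' : (2 : ℝ) ≤ n := by exact_mod_cast hn
    simp_rw [mul_pow, integral_const_mul]
    rw [hb2 n hn]
    have : (n : ℝ) - 1 ≠ 0 := by linarith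
    field_simp
    ring
  · refine squeeze_zero' (Eventually.of_forall fun n => mul_nonneg (sq_nonneg _)
      (integral_nonneg fun _ => integral_nonneg fun _ => by positivity))
      (g := fun n : ℕ => 16 * ((c n / n) ^ 2 * (c n ^ 2 * m n))) ?_ ?_
    · filter_upwards [H.small, eventually_ge_atTop 2] with n hn hn2
      have hn' : (2 : ℝ) ≤ n := by exact_mod_cast hn2
      simp_rw [mul_pow, integral_const_mul]
      calc (n : ℝ) ^ 2 * (b n ^ 4 * ∫ y, ∫ z, doublyCentred (G n) P (y, z) ^ 4 ∂P ∂P)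
          ≤ (n : ℝ) ^ 2 * (4 * c n ^ 4 / (n : ℝ) ^ 4 * (4 * m n)) := by
            gcongr
            · exact hb4 n hn2
            · exact hn.integral_pow_four_doublyCentred_le
        _ = _ := by field_simp; ring
    · simpa using ((H.tendsto_scale_div.pow 2).mul hcm).const_mul 16
  · refine squeeze_zero' (Eventually.of_forall fun n => mul_nonneg (by positivity)
      (integral_nonneg fun _ => sq_nonneg _))
      (g := fun n : ℕ => 32 * ((c n / n) * (c n * M n) * (c n ^ 2 * m n))) ?_ ?_
    · filter_upwards [H.small, eventually_ge_atTop 2] with n hn hn2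
      have hn' : (2 : ℝ) ≤ n := by exact_mod_cast hn2
      simp_rw [mul_pow, integral_const_mul, mul_pow, integral_const_mul, ← pow_mul]
      calc (n : ℝ) ^ 3 * (b n ^ (2 * 2) * ∫ y, (∫ z, doublyCentred (G n) P (y, z) ^ 2 ∂P) ^ 2 ∂P)
          ≤ (n : ℝ) ^ 3 * (4 * c n ^ 4 / (n : ℝ) ^ 4 * (8 * M n * m n)) := by
            gcongr
            · exact hb4 n hn2
            · exact hn.integral_sq_integral_sq_doublyCentred_le
        _ = _ := by field_simp; ring
    · simpa using ((H.tendsto_scale_div.mul H.tendsto_scale_mul_bound).mul hcm).const_mul 32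
  · refine squeeze_zero' (Eventually.of_forall fun n => mul_nonneg (by positivity)
      (integral_nonneg fun _ => integral_nonneg fun _ => sq_nonneg _))
      (g := fun n : ℕ => 64 * ((c n * M n) ^ 2 * (c n ^ 2 * m n))) ?_ ?_
    · filter_upwards [H.small, H.bound_pos, eventually_ge_atTop 2] with n hn hMn hn2
      have hn' : (2 : ℝ) ≤ n := by exact_mod_cast hn2
      have hd := isDegenerateKernel_doublyCentred (P := P) hn.boundedMeasurable hn.symm
      simp_rw [contraction_const_mul, mul_pow, integral_const_mul, ← pow_mul]
      calc (n : ℝ) ^ 4 * (b n ^ (2 * 2) *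
            ∫ y, ∫ z, contraction (doublyCentred (G n) P) P (y, z) ^ 2 ∂P ∂P)
          ≤ (n : ℝ) ^ 4 * (4 * c n ^ 4 / (n : ℝ) ^ 4 * ((4 * M n) ^ 2 * m n)) := by
            gcongr
            · exact hb4 n hn2
            · exact integral_sq_contraction_le hd.boundedMeasurable hd.symm (by positivity)
                hn.integral_abs_doublyCentred_le
        _ = _ := by field_simp; ring
    · simpa using ((H.tendsto_scale_mul_bound.pow 2).mul hcm).const_mul 64

end KernelAsymptotics

/-- The sum `∑ G(x_i, x_{j₁}) G(x_i, x_{j₂})` over triples of distinct indices. -/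
def tripleSum {n : ℕ} (G : S × S → ℝ) (x : Fin n → S) : ℝ :=
  ∑ i, ∑ j₁, ∑ j₂, if ({i, j₁, j₂} : Finset (Fin n)).card = 3 then
    G (x i, x j₁) * G (x i, x j₂) else 0

/-- The sum `∑ G(x_{i₁}, x_{j₁}) G(x_{i₂}, x_{j₂})` over quadruples of distinct indices. -/
def quadSum {n : ℕ} (G : S × S → ℝ) (x : Fin n → S) : ℝ :=
  ∑ i₁, ∑ i₂, ∑ j₁, ∑ j₂, if ({i₁, i₂, j₁, j₂} : Finset (Fin n)).card = 4 then
    G (x i₁, x j₁) * G (x i₂, x j₂) else 0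

lemma ne_of_card_triple {n : ℕ} {i j k : Fin n} (h : ({i, j, k} : Finset (Fin n)).card = 3) :
    i ≠ j ∧ i ≠ k ∧ j ≠ k := by
  refine ⟨?_, ?_, ?_⟩ <;> rintro rfl
  · have : ({i, i, k} : Finset (Fin n)).card ≤ 2 := by simpa using Finset.card_le_two
    omega
  · have : ({i, j, i} : Finset (Fin n)) = {i, j} := by ext; simp; tauto
    have h2 : ({i, j} : Finset (Fin n)).card ≤ 2 := Finset.card_le_two
    rw [this] at h; omega
  · have : ({i, j, j} : Finset (Fin n)).card ≤ 2 := by simpa using Finset.card_le_two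
    omega

lemma ne_of_card_quad {n : ℕ} {i j k l : Fin n} (h : ({i, j, k, l} : Finset (Fin n)).card = 4) :
    i ≠ k ∧ l ≠ i ∧ l ≠ k ∧ l ≠ j := by
  have h3 : ∀ a b c : Fin n, ({a, b, c} : Finset (Fin n)).card ≤ 3 := fun _ _ _ =>
    Finset.card_le_three
  refine ⟨?_, ?_, ?_, ?_⟩ <;> rintro rfl
  · have e : ({i, j, i, l} : Finset (Fin n)) = {i, j, l} := by ext; simp; tauto
    have := h3 i j l
    rw [e] at h
    omega
  · have e : ({l, j, k, l} : Finset (Fin n)) = {l, j, k} := by ext; simp; tauto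
    have := h3 l j k
    rw [e] at h
    omega
  · have e : ({i, j, l, l} : Finset (Fin n)) = {i, j, l} := by ext; simp
    have := h3 i j l
    rw [e] at h
    omega
  · have e : ({i, l, k, l} : Finset (Fin n)) = {i, l, k} := by ext; simp; tauto
    have := h3 i l k
    rw [e] at h
    omega

lemma BoundedMeasurable.tripleSum {n : ℕ} {G : S × S → ℝ}
    (hG : BoundedMeasurable G) :
    BoundedMeasurable (GaussMMD.tripleSum (n := n) G) := by
  refine BoundedMeasurable.sum fun i _ => BoundedMeasurable.sum fun j _ =>
    BoundedMeasurable.sum fun k _ => ?_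
  split_ifs
  · exact (hG.comp (by fun_prop)).mul (hG.comp (by fun_prop))
  · exact BoundedMeasurable.const 0

lemma BoundedMeasurable.quadSum {n : ℕ} {G : S × S → ℝ}
    (hG : BoundedMeasurable G) :
    BoundedMeasurable (GaussMMD.quadSum (n := n) G) := by
  refine BoundedMeasurable.sum fun i _ => BoundedMeasurable.sum fun j _ =>
    BoundedMeasurable.sum fun k _ => BoundedMeasurable.sum fun l _ => ?_
  split_ifs
  · exact (hG.comp (by fun_prop)).mul (hG.comp (by fun_prop))
  · exact BoundedMeasurable.const 0

namespace IsSmallKernel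

variable {G : S × S → ℝ} {M : ℝ} {n : ℕ}

lemma tripleSum_nonneg (hG : IsSmallKernel G P M) (x : Fin n → S) : 0 ≤ tripleSum G x :=
  Finset.sum_nonneg fun _ _ => Finset.sum_nonneg fun _ _ => Finset.sum_nonneg fun _ _ => by
    split_ifs
    · exact mul_nonneg (hG.nonneg _) (hG.nonneg _)
    · exact le_rfl

lemma quadSum_nonneg (hG : IsSmallKernel G P M) (x : Fin n → S) : 0 ≤ quadSum G x :=
  Finset.sum_nonneg fun _ _ => Finset.sum_nonneg fun _ _ => Finset.sum_nonneg fun _ _ =>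
    Finset.sum_nonneg fun _ _ => by
      split_ifs
      · exact mul_nonneg (hG.nonneg _) (hG.nonneg _)
      · exact le_rfl

lemma integral_tripleSum_le (hG : IsSmallKernel G P M) :
    ∫ x : Fin n → S, tripleSum G x ∂sampleLaw P (Fin n) ≤ (n : ℝ) ^ 3 * M ^ 2 := by
  have hb := hG.boundedMeasurable
  have ht : ∀ i j k : Fin n, BoundedMeasurable fun x : Fin n → S =>
      if ({i, j, k} : Finset (Fin n)).card = 3 then G (x i, x j) * G (x i, x k) else 0 := by
    intro i j k
    split_ifs
    · exact (hb.comp (by fun_prop)).mul (hb.comp (by fun_prop))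
    · exact BoundedMeasurable.const 0
  have hi : ∀ i j k : Fin n, ∫ x : Fin n → S, (if ({i, j, k} : Finset (Fin n)).card = 3 then
      G (x i, x j) * G (x i, x k) else 0) ∂sampleLaw P (Fin n) ≤ M ^ 2 := by
    intro i j k
    split_ifs with h
    · obtain ⟨h1, h2, h3⟩ := ne_of_card_triple h
      exact hG.integral_mul_le h1 h2.symm h3.symm h2.symm
    · simpa using sq_nonneg M
  simp only [tripleSum]
  rw [integral_finsetSum _ fun i _ => (BoundedMeasurable.sum fun j _ =>
    BoundedMeasurable.sum fun k _ => ht i j k).integrable]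
  calc _ ≤ ∑ _i : Fin n, ∑ _j : Fin n, ∑ _k : Fin n, M ^ 2 := by
        refine Finset.sum_le_sum fun i _ => ?_
        rw [integral_finsetSum _ fun j _ => (BoundedMeasurable.sum fun k _ => ht i j k).integrable]
        refine Finset.sum_le_sum fun j _ => ?_
        rw [integral_finsetSum _ fun k _ => (ht i j k).integrable]
        exact Finset.sum_le_sum fun k _ => hi i j k
    _ = _ := by simp; ring

lemma integral_quadSum_le (hG : IsSmallKernel G P M) :
    ∫ x : Fin n → S, quadSum G x ∂sampleLaw P (Fin n) ≤ (n : ℝ) ^ 4 * M ^ 2 := by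
  have hb := hG.boundedMeasurable
  have ht : ∀ i j k l : Fin n, BoundedMeasurable fun x : Fin n → S =>
      if ({i, j, k, l} : Finset (Fin n)).card = 4 then G (x i, x k) * G (x j, x l) else 0 := by
    intro i j k l
    split_ifs
    · exact (hb.comp (by fun_prop)).mul (hb.comp (by fun_prop))
    · exact BoundedMeasurable.const 0
  have hi : ∀ i j k l : Fin n, ∫ x : Fin n → S, (if ({i, j, k, l} : Finset (Fin n)).card = 4 then
      G (x i, x k) * G (x j, x l) else 0) ∂sampleLaw P (Fin n) ≤ M ^ 2 := by
    intro i j k l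
    split_ifs with h
    · obtain ⟨h1, h2, h3, h4⟩ := ne_of_card_quad h
      exact hG.integral_mul_le h1 h2 h3 h4
    · simpa using sq_nonneg M
  simp only [quadSum]
  rw [integral_finsetSum _ fun i _ => (BoundedMeasurable.sum fun j _ =>
    BoundedMeasurable.sum fun k _ => BoundedMeasurable.sum fun l _ => ht i j k l).integrable]
  calc _ ≤ ∑ _i : Fin n, ∑ _j : Fin n, ∑ _k : Fin n, ∑ _l : Fin n, M ^ 2 := by
        refine Finset.sum_le_sum fun i _ => ?_
        rw [integral_finsetSum _ fun j _ => (BoundedMeasurable.sum fun k _ =>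
          BoundedMeasurable.sum fun l _ => ht i j k l).integrable]
        refine Finset.sum_le_sum fun j _ => ?_
        rw [integral_finsetSum _ fun k _ =>
          (BoundedMeasurable.sum fun l _ => ht i j k l).integrable]
        refine Finset.sum_le_sum fun k _ => ?_
        rw [integral_finsetSum _ fun l _ => (ht i j k l).integrable]
        exact Finset.sum_le_sum fun l _ => hi i j k l
    _ = _ := by simp; ring

end IsSmallKernel

/-- The unbiased variance estimator built from the kernel `G`. -/
def varEstimator {n : ℕ} (G : S × S → ℝ) (x : Fin n → S) : ℝ :=
  1 / ((n : ℝ) * ((n : ℝ) - 1)) * pairSum (fun q => G q ^ 2) x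
    - 2 * ((n - 3)! : ℝ) / (n ! : ℝ) * tripleSum G x + ((n - 4)! : ℝ) / (n ! : ℝ) * quadSum G x

lemma BoundedMeasurable.varEstimator {n : ℕ} {G : S × S → ℝ} (hG : BoundedMeasurable G) :
    BoundedMeasurable (varEstimator (n := n) G) :=
  ((((hG.pow 2).pairSum (h := fun q => G q ^ 2)).const_mul _).sub
    (hG.tripleSum.const_mul _)).add
    (hG.quadSum.const_mul _)

lemma factorial_ratio_three_le {n : ℕ} (hn : 6 ≤ n) :
    ((n - 3)! : ℝ) / (n ! : ℝ) * (n : ℝ) ^ 3 ≤ 8 := by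
  obtain ⟨k, rfl⟩ : ∃ k, n = k + 3 := ⟨n - 3, by omega⟩
  have hk : (3 : ℝ) ≤ k := by exact_mod_cast (by omega : 3 ≤ k)
  have hf : 0 < (k ! : ℝ) := by positivity
  have e : (((k + 3)! : ℕ) : ℝ) = (k + 3) * (k + 2) * (k + 1) * k ! := by
    simp only [Nat.factorial_succ]; push_cast; ring
  rw [Nat.add_sub_cancel, e]
  rw [div_mul_eq_mul_div, div_le_iff₀ (by positivity)]
  push_cast
  nlinarith [mul_nonneg hf.le (by
    nlinarith [mul_nonneg (by linarith : (0 : ℝ) ≤ k - 3) (by linarith : (0 : ℝ) ≤ k)] :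
    (0 : ℝ) ≤ 8 * ((k + 3) * (k + 2) * (k + 1)) - (k + 3) ^ 3)]

lemma factorial_ratio_four_le {n : ℕ} (hn : 6 ≤ n) :
    ((n - 4)! : ℝ) / (n ! : ℝ) * (n : ℝ) ^ 4 ≤ 16 := by
  obtain ⟨k, rfl⟩ : ∃ k, n = k + 4 := ⟨n - 4, by omega⟩
  have hk : (2 : ℝ) ≤ k := by exact_mod_cast (by omega : 2 ≤ k)
  have hf : 0 < (k ! : ℝ) := by positivity
  have e : (((k + 4)! : ℕ) : ℝ) = (k + 4) * (k + 3) * (k + 2) * (k + 1) * k ! := by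
    simp only [Nat.factorial_succ]; push_cast; ring
  rw [Nat.add_sub_cancel, e]
  rw [div_mul_eq_mul_div, div_le_iff₀ (by positivity)]
  push_cast
  have h1 : ((k : ℝ) + 4) ^ 3 ≤ 16 * ((k + 3) * (k + 2) * (k + 1)) := by
    nlinarith [mul_nonneg (by linarith : (0 : ℝ) ≤ k - 2) (by linarith : (0 : ℝ) ≤ k)]
  have h2 := mul_le_mul_of_nonneg_left h1 (by positivity : 0 ≤ (k ! : ℝ) * (k + 4))
  linarith

/-- The scaled variance estimator converges to `L` in mean. Only its first term matters: the other
two are nonnegative with expectation of the order of the squared row bound. -/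
lemma KernelAsymptotics.tendsto_integral_abs_varEstimator_sub {G : ℕ → S × S → ℝ}
    {M c : ℕ → ℝ} {L : ℝ} (H : KernelAsymptotics G P M c L) :
    Tendsto (fun n : ℕ => ∫ x : Fin n → S, |c n ^ 2 * varEstimator (G n) x - L|
      ∂sampleLaw P (Fin n)) atTop (𝓝 0) := by
  set m : ℕ → ℝ := fun n => ∫ y, ∫ z, G n (y, z) ^ 2 ∂P ∂P with hm
  have hm0 : ∀ n, 0 ≤ m n := fun n => integral_nonneg fun _ => integral_nonneg fun _ => sq_nonneg _
  have hcm : Tendsto (fun n => c n ^ 2 * m n) atTop (𝓝 L) := H.tendsto_second_moment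
  refine squeeze_zero' (g := fun n : ℕ => √(64 * ((c n / n) ^ 2 * (c n ^ 2 * m n)) +
      32 * ((c n / n) * (c n * M n) * (c n ^ 2 * m n))) + |c n ^ 2 * m n - L| +
      32 * (c n * M n) ^ 2) (Eventually.of_forall fun n => integral_nonneg fun _ => abs_nonneg _)
      ?_ ?_
  · filter_upwards [H.small, H.scale_pos, eventually_ge_atTop 6] with n hn hcn hn6
    have hn' : (6 : ℝ) ≤ n := by exact_mod_cast hn6
    have hb := hn.boundedMeasurable
    set A : (Fin n → S) → ℝ := fun x => c n ^ 2 / ((n : ℝ) * (n - 1)) *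
      (pairSum (fun q => G n q ^ 2) x - (n : ℝ) * (n - 1) * m n) with hA
    have hAb : BoundedMeasurable A :=
      (((hb.pow 2).pairSum (h := fun q => G n q ^ 2)).sub (BoundedMeasurable.const _)).const_mul _
    set r3 : ℝ := ((n - 3)! : ℝ) / (n ! : ℝ) with hr3
    set r4 : ℝ := ((n - 4)! : ℝ) / (n ! : ℝ) with hr4
    have hr30 : 0 ≤ r3 := by positivity
    have hr40 : 0 ≤ r4 := by positivity
    have hT := hb.tripleSum (n := n)
    have hQ := hb.quadSum (n := n)
    have hpt : ∀ x, |c n ^ 2 * varEstimator (G n) x - L| ≤ |A x| + |c n ^ 2 * m n - L| +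
        c n ^ 2 * (2 * r3) * tripleSum (G n) x + c n ^ 2 * r4 * quadSum (G n) x := by
      intro x
      have e : c n ^ 2 * varEstimator (G n) x - L = A x + (c n ^ 2 * m n - L) -
          c n ^ 2 * (2 * r3) * tripleSum (G n) x + c n ^ 2 * r4 * quadSum (G n) x := by
        have h1 : (n : ℝ) ≠ 0 := by linarith
        have h2 : (n : ℝ) - 1 ≠ 0 := by linarith
        simp only [varEstimator, hA, hr3, hr4]
        field_simp
        ring
      have h1 := mul_nonneg (by positivity : 0 ≤ c n ^ 2 * (2 * r3)) (hn.tripleSum_nonneg x)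
      have h2 := mul_nonneg (by positivity : 0 ≤ c n ^ 2 * r4) (hn.quadSum_nonneg x)
      rw [e, abs_le]
      have h3 := abs_le.1 (le_refl |A x|)
      have h4 := abs_le.1 (le_refl |c n ^ 2 * m n - L|)
      constructor <;> linarith
    have hI := integral_mono (μ := sampleLaw P (Fin n))
      (((hb.varEstimator.const_mul (c n ^ 2)).sub (BoundedMeasurable.const L)).abs).integrable
      (((hAb.abs.add (BoundedMeasurable.const |c n ^ 2 * m n - L|)).add (hT.const_mul _)).add
        (hQ.const_mul _)).integrable hpt
    refine hI.trans ?_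
    rw [integral_add ((hAb.abs.add (BoundedMeasurable.const _)).add (hT.const_mul _)).integrable
        (hQ.const_mul _).integrable,
      integral_add (hAb.abs.add (BoundedMeasurable.const _)).integrable (hT.const_mul _).integrable,
      integral_add hAb.abs.integrable (BoundedMeasurable.const _).integrable,
      integral_const_mul, integral_const_mul]
    simp only [integral_const, probReal_univ, smul_eq_mul, one_mul]
    have t1 : ∫ x, |A x| ∂sampleLaw P (Fin n) ≤ √(64 * ((c n / n) ^ 2 * (c n ^ 2 * m n)) +
        32 * ((c n / n) * (c n * M n) * (c n ^ 2 * m n))) := by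
      refine (integral_le_sqrt_integral_sq hAb).trans (Real.sqrt_le_sqrt ?_)
      have h1 := hn.sq.integral_sq_pairSum_sub_le (ι := Fin n)
      rw [Fintype.card_fin] at h1
      simp_rw [hA, mul_pow, integral_const_mul]
      have hMn : 0 ≤ M n := hn.integral_integral_nonneg.trans hn.integral_integral_le
      calc (c n ^ 2 / ((n : ℝ) * (n - 1))) ^ 2 * _
          ≤ (c n ^ 2 / ((n : ℝ) * (n / 2))) ^ 2 *
            ((16 * (n : ℝ) ^ 2 + 8 * (n : ℝ) ^ 3 * M n) * m n) := by
            have h2 : 0 < (n : ℝ) * (n - 1) := mul_pos (by linarith) (by linarith)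
            have h3 : c n ^ 2 / ((n : ℝ) * (n - 1)) ≤ c n ^ 2 / ((n : ℝ) * (n / 2)) := by
              gcongr
              linarith
            exact mul_le_mul (pow_le_pow_left₀ (by positivity) h3 2) h1
              (integral_nonneg fun _ => sq_nonneg _) (sq_nonneg _)
        _ = _ := by field_simp; ring
    have t2 : c n ^ 2 * (2 * r3) * ∫ x, tripleSum (G n) x ∂sampleLaw P (Fin n) ≤
        16 * (c n * M n) ^ 2 := by
      calc _ ≤ c n ^ 2 * (2 * r3) * ((n : ℝ) ^ 3 * M n ^ 2) := by
            gcongr; exact hn.integral_tripleSum_le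
        _ = (r3 * (n : ℝ) ^ 3) * (2 * (c n * M n) ^ 2) := by ring
        _ ≤ 8 * (2 * (c n * M n) ^ 2) := by gcongr; exact factorial_ratio_three_le hn6
        _ = _ := by ring
    have t3 : c n ^ 2 * r4 * ∫ x, quadSum (G n) x ∂sampleLaw P (Fin n) ≤
        16 * (c n * M n) ^ 2 := by
      calc _ ≤ c n ^ 2 * r4 * ((n : ℝ) ^ 4 * M n ^ 2) := by
            gcongr; exact hn.integral_quadSum_le
        _ = (r4 * (n : ℝ) ^ 4) * (c n * M n) ^ 2 := by ring
        _ ≤ 16 * (c n * M n) ^ 2 := by gcongr; exact factorial_ratio_four_le hn6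
    linarith
  · have l1 : Tendsto (fun n : ℕ => 64 * ((c n / n) ^ 2 * (c n ^ 2 * m n)) +
        32 * ((c n / n) * (c n * M n) * (c n ^ 2 * m n))) atTop (𝓝 0) := by
      simpa using (((H.tendsto_scale_div.pow 2).mul hcm).const_mul 64).add
        (((H.tendsto_scale_div.mul H.tendsto_scale_mul_bound).mul hcm).const_mul 32)
    have l2 := (Real.continuous_sqrt.tendsto 0).comp l1
    have l3 := (hcm.sub_const L).abs
    have l4 := (H.tendsto_scale_mul_bound.pow 2).const_mul 32
    simpa using (l2.add l3).add l4

end SmallKernelLimits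

/-! ### Gaussian smoothing of a density -/

section Gaussian

variable {d : ℕ}

lemma gaussKernel_symm (ν : ℝ) (x y : Space d) : gaussKernel ν x y = gaussKernel ν y x := by
  rw [gaussKernel, gaussKernel, norm_sub_rev]

lemma gaussKernel_pos (ν : ℝ) (x y : Space d) : 0 < gaussKernel ν x y := Real.exp_pos _

lemma gaussKernel_le_one {ν : ℝ} (hν : 0 ≤ ν) (x y : Space d) : gaussKernel ν x y ≤ 1 := by
  rw [gaussKernel, Real.exp_le_one_iff]
  nlinarith [mul_nonneg hν (sq_nonneg ‖x - y‖)]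

lemma gaussKernel_two_mul (ν : ℝ) (x y : Space d) :
    gaussKernel (2 * ν) x y = gaussKernel ν x y ^ 2 := by
  rw [gaussKernel, gaussKernel, ← Real.exp_nat_mul]
  congr 1
  push_cast
  ring

@[fun_prop]
lemma continuous_gaussKernel (ν : ℝ) :
    Continuous fun q : Space d × Space d => gaussKernel ν q.1 q.2 := by
  unfold gaussKernel
  fun_prop

lemma measurable_gaussKernel (ν : ℝ) :
    Measurable fun q : Space d × Space d => gaussKernel ν q.1 q.2 :=
  (continuous_gaussKernel ν).measurable

lemma measurable_gaussKernel_right (ν : ℝ) (x : Space d) : Measurable (gaussKernel ν x) := by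
  unfold gaussKernel
  fun_prop

/-- The Gaussian kernel normalized to be a probability density in each variable. -/
def gaussDensity (a : ℝ) (x y : Space d) : ℝ :=
  (a / Real.pi) ^ ((d : ℝ) / 2) * gaussKernel a x y

lemma gaussDensity_nonneg {a : ℝ} (ha : 0 ≤ a) (x y : Space d) : 0 ≤ gaussDensity a x y := by
  unfold gaussDensity
  exact mul_nonneg (by positivity) (gaussKernel_pos _ _ _).le

lemma gaussDensity_symm (a : ℝ) (x y : Space d) : gaussDensity a x y = gaussDensity a y x := by
  rw [gaussDensity, gaussDensity, gaussKernel_symm]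

lemma measurable_gaussDensity (a : ℝ) :
    Measurable fun q : Space d × Space d => gaussDensity a q.1 q.2 :=
  (measurable_gaussKernel a).const_mul _

lemma measurable_gaussDensity_right (a : ℝ) (x : Space d) : Measurable (gaussDensity a x) :=
  (measurable_gaussKernel_right a x).const_mul _

lemma integral_gaussKernel {ν : ℝ} (hν : 0 < ν) (x : Space d) :
    ∫ y, gaussKernel ν x y = (Real.pi / ν) ^ ((d : ℝ) / 2) := by
  have h := GaussianFourier.integral_rexp_neg_mul_sq_norm (V := Space d) hν
  rw [finrank_euclideanSpace_fin] at h
  rw [← h]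
  exact integral_sub_left_eq_self (fun v : Space d => Real.exp (-ν * ‖v‖ ^ 2)) volume x

lemma integrable_gaussKernel {ν : ℝ} (hν : 0 < ν) (x : Space d) :
    Integrable (gaussKernel ν x) := by
  refine Integrable.of_integral_ne_zero ?_
  rw [integral_gaussKernel hν]
  positivity

lemma integral_gaussDensity {a : ℝ} (ha : 0 < a) (x : Space d) :
    ∫ y, gaussDensity a x y = 1 := by
  simp only [gaussDensity]
  rw [integral_const_mul, integral_gaussKernel ha, ← Real.mul_rpow (by positivity) (by positivity)]
  have : a / Real.pi * (Real.pi / a) = 1 := by field_simp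
  rw [this, Real.one_rpow]

lemma lintegral_gaussDensity {a : ℝ} (ha : 0 < a) (x : Space d) :
    ∫⁻ y, ENNReal.ofReal (gaussDensity a x y) = 1 := by
  have hi : Integrable (gaussDensity a x) := (integrable_gaussKernel ha x).const_mul _
  rw [← ofReal_integral_eq_lintegral_ofReal hi
    (ae_of_all _ fun y => gaussDensity_nonneg ha.le x y), integral_gaussDensity ha,
    ENNReal.ofReal_one]

/-- The scaling `(2ν/π)^(d/4)` turns the squared Gaussian kernel into a probability density. -/
lemma scale_sq_mul_gaussKernel_sq {ν : ℝ} (hν : 0 < ν) (x y : Space d) :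
    ((2 * ν / Real.pi) ^ ((d : ℝ) / 4)) ^ 2 * gaussKernel ν x y ^ 2 =
      gaussDensity (2 * ν) x y := by
  rw [gaussDensity, gaussKernel_two_mul, ← Real.rpow_natCast, ← Real.rpow_mul (by positivity)]
  congr 2
  push_cast
  ring

/-- Gaussian smoothing converges at the continuity points of an integrable function. -/
lemma tendsto_integral_gaussDensity {p : Space d → ℝ} (hp : Integrable p) {x : Space d}
    (hx : ContinuousAt p x) :
    Tendsto (fun a : ℝ => ∫ y, gaussDensity a x y * p y) atTop (𝓝 (p x)) := by
  have h1 := Real.tendsto_integral_gaussian_smul' (V := Space d) (E := ℂ)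
    (f := fun y => (p y : ℂ)) hp.ofReal (v := x) (Complex.continuous_ofReal.continuousAt.comp hx)
  have h2 : Tendsto (fun a : ℝ => a / Real.pi ^ 2) atTop atTop :=
    tendsto_id.atTop_div_const (by positivity)
  -- Mathlib's kernel is `exp (-π² b ‖x - y‖²)`, whence the substitution `b = a / π²`
  have h3 := (Complex.continuous_re.tendsto _).comp (h1.comp h2)
  simp only [Complex.ofReal_re] at h3
  refine h3.congr' ?_
  filter_upwards [eventually_gt_atTop 0] with a ha
  have e : ∀ y : Space d, ((Real.pi * ((a / Real.pi ^ 2 : ℝ) : ℂ)) ^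
      ((Module.finrank ℝ (Space d) : ℂ) / 2) *
      Complex.exp (-Real.pi ^ 2 * ((a / Real.pi ^ 2 : ℝ) : ℂ) * ‖x - y‖ ^ 2)) • (p y : ℂ) =
      ((gaussDensity a x y * p y : ℝ) : ℂ) := by
    intro y
    rw [finrank_euclideanSpace_fin, smul_eq_mul, gaussDensity, gaussKernel]
    have e1 : (Real.pi : ℂ) * ((a / Real.pi ^ 2 : ℝ) : ℂ) = ((a / Real.pi : ℝ) : ℂ) := by
      rw [← Complex.ofReal_mul]; congr 1; field_simp
    have e2 : -(Real.pi : ℂ) ^ 2 * ((a / Real.pi ^ 2 : ℝ) : ℂ) * (‖x - y‖ : ℂ) ^ 2 =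
        ((-a * ‖x - y‖ ^ 2 : ℝ) : ℂ) := by
      have : Real.pi ≠ 0 := Real.pi_ne_zero
      have h : -Real.pi ^ 2 * (a / Real.pi ^ 2) * ‖x - y‖ ^ 2 = -a * ‖x - y‖ ^ 2 := by field_simp
      rw [← h]; push_cast; ring
    have e3 : ((d : ℂ) / 2) = (((d : ℝ) / 2 : ℝ) : ℂ) := by push_cast; rfl
    rw [e1, e2, e3, ← Complex.ofReal_cpow (by positivity), ← Complex.ofReal_exp,
      ← Complex.ofReal_mul, ← Complex.ofReal_mul]
  simp only [Function.comp_apply]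
  simp_rw [e]
  rw [integral_complex_ofReal, Complex.ofReal_re]

section Density

variable {p : Space d → ℝ}

lemma IsDensity.integrable (hp : IsDensity p) : Integrable p :=
  Integrable.of_integral_ne_zero (by rw [hp.2.2]; exact one_ne_zero)

lemma IsDensity.isProbabilityMeasure (hp : IsDensity p) :
    IsProbabilityMeasure (densityMeasure p) := by
  refine ⟨?_⟩
  rw [densityMeasure, withDensity_apply _ MeasurableSet.univ, Measure.restrict_univ,
    ← ofReal_integral_eq_lintegral_ofReal hp.integrable (ae_of_all _ hp.2.1), hp.2.2,
    ENNReal.ofReal_one]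

lemma IsDensity.integral_densityMeasure (hp : IsDensity p) {E : Type*} [NormedAddCommGroup E]
    [NormedSpace ℝ E] (f : Space d → E) : ∫ x, f x ∂densityMeasure p = ∫ x, p x • f x := by
  rw [densityMeasure, integral_withDensity_eq_integral_toReal_smul hp.1.ennreal_ofReal
    (ae_of_all _ fun x => ENNReal.ofReal_lt_top)]
  simp_rw [ENNReal.toReal_ofReal (hp.2.1 _)]

lemma IsDensity.lintegral_densityMeasure (hp : IsDensity p) {f : Space d → ENNReal}
    (hf : Measurable f) :
    ∫⁻ x, f x ∂densityMeasure p = ∫⁻ x, ENNReal.ofReal (p x) * f x := by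
  rw [densityMeasure, lintegral_withDensity_eq_lintegral_mul _ hp.1.ennreal_ofReal hf]
  rfl

/-- The integral of the normalized Gaussian kernel against the squared distribution. -/
def smoothedEnergy (p : Space d → ℝ) (a : ℝ) : ENNReal :=
  ∫⁻ x, ∫⁻ y, ENNReal.ofReal (gaussDensity a x y) ∂densityMeasure p ∂densityMeasure p

lemma IsDensity.integrable_gaussDensity (hp : IsDensity p) {a : ℝ} (ha : 0 ≤ a) (x : Space d) :
    Integrable (gaussDensity a x) (densityMeasure p) := by
  have := hp.isProbabilityMeasure
  refine Integrable.of_bound (measurable_gaussDensity_right a x).aestronglyMeasurable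
    ((a / Real.pi) ^ ((d : ℝ) / 2)) (ae_of_all _ fun y => ?_)
  rw [Real.norm_eq_abs, abs_of_nonneg (gaussDensity_nonneg ha x y), gaussDensity]
  exact mul_le_of_le_one_right (by positivity) (gaussKernel_le_one ha x y)

/-- Fatou's lemma, with the convergence of the smoothed density at its continuity points. -/
lemma IsDensity.lintegral_sq_le_liminf (hp : IsDensity p) (hc : ∀ᵐ x, ContinuousAt p x)
    {a : ℕ → ℝ} (ha : Tendsto a atTop atTop) :
    ∫⁻ x, ENNReal.ofReal (p x) ^ 2 ≤ liminf (fun n => smoothedEnergy p (a n)) atTop := by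
  have := hp.isProbabilityMeasure
  have hm : ∀ n, Measurable fun x =>
      ∫⁻ y, ENNReal.ofReal (gaussDensity (a n) x y) ∂densityMeasure p := fun n =>
    (measurable_gaussDensity (a n)).ennreal_ofReal.lintegral_prod_right'
  refine le_trans ?_ (lintegral_liminf_le hm)
  have e : ∫⁻ x, ENNReal.ofReal (p x) ^ 2 = ∫⁻ x, ENNReal.ofReal (p x) ∂densityMeasure p := by
    rw [hp.lintegral_densityMeasure hp.1.ennreal_ofReal]
    simp_rw [sq]
  rw [e]
  have hac : densityMeasure p ≪ volume := withDensity_absolutelyContinuous _ _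
  refine lintegral_mono_ae ?_
  filter_upwards [hac.ae_le hc] with x hx
  have h1 := (tendsto_integral_gaussDensity hp.integrable hx).comp ha
  have h2 := (ENNReal.continuous_ofReal.tendsto _).comp h1
  refine le_of_eq (Tendsto.liminf_eq (h2.congr' ?_)).symm
  filter_upwards [ha.eventually_gt_atTop 0] with n hn
  simp only [Function.comp_apply]
  rw [← ofReal_integral_eq_lintegral_ofReal (hp.integrable_gaussDensity hn.le x)
    (ae_of_all _ fun y => gaussDensity_nonneg hn.le x y), hp.integral_densityMeasure]
  simp only [smul_eq_mul, mul_comm]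

/-- Convolution with a probability density does not increase the `L²` norm. -/
lemma IsDensity.smoothedEnergy_le (hp : IsDensity p) {a : ℝ} (ha : 0 < a) :
    smoothedEnergy p a ≤ ∫⁻ x, ENNReal.ofReal (p x) ^ 2 := by
  have := hp.isProbabilityMeasure
  set K : Space d → Space d → ENNReal := fun x y => ENNReal.ofReal (gaussDensity a x y) with hK
  have hKm : Measurable (Function.uncurry K) := (measurable_gaussDensity a).ennreal_ofReal
  have hKx : ∀ x, Measurable (K x) := fun x => (measurable_gaussDensity_right a x).ennreal_ofReal
  have hpm : Measurable fun x => ENNReal.ofReal (p x) := hp.1.ennreal_ofReal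
  have e : smoothedEnergy p a =
      ∫⁻ x, ∫⁻ y, ENNReal.ofReal (p x) * (ENNReal.ofReal (p y) * K x y) := by
    rw [smoothedEnergy, hp.lintegral_densityMeasure
      ((measurable_gaussDensity a).ennreal_ofReal.lintegral_prod_right')]
    congr with x
    rw [hp.lintegral_densityMeasure (hKx x)]
    exact (lintegral_const_mul _ (hpm.mul (hKx x))).symm
  -- `2uv ≤ u² + v²`, in a form which needs no subtraction
  have h1 : ∀ u v k : ENNReal, 2 * (u * (v * k)) ≤ u ^ 2 * k + v ^ 2 * k := by
    intro u v k
    rw [← add_mul, ← mul_assoc u, ← mul_assoc 2]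
    gcongr
    rcases le_total u v with h | h
    · obtain ⟨w, rfl⟩ := exists_add_of_le h
      calc 2 * (u * (u + w)) ≤ 2 * (u * (u + w)) + w ^ 2 := le_self_add
        _ = _ := by ring
    · obtain ⟨w, rfl⟩ := exists_add_of_le h
      calc 2 * ((v + w) * v) ≤ 2 * ((v + w) * v) + w ^ 2 := le_self_add
        _ = _ := by ring
  have h2 : 2 * smoothedEnergy p a ≤ 2 * ∫⁻ x, ENNReal.ofReal (p x) ^ 2 := by
    calc 2 * smoothedEnergy p a
        = ∫⁻ x, ∫⁻ y, 2 * (ENNReal.ofReal (p x) * (ENNReal.ofReal (p y) * K x y)) := by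
          rw [e, ← lintegral_const_mul' _ _ (by norm_num)]
          congr with x
          exact (lintegral_const_mul' _ _ (by norm_num)).symm
      _ ≤ ∫⁻ x, ∫⁻ y, (ENNReal.ofReal (p x) ^ 2 * K x y + ENNReal.ofReal (p y) ^ 2 * K x y) :=
          lintegral_mono fun x => lintegral_mono fun y => h1 _ _ _
      _ = ∫⁻ x, (ENNReal.ofReal (p x) ^ 2 + ∫⁻ y, ENNReal.ofReal (p y) ^ 2 * K x y) := by
          congr with x
          rw [lintegral_add_left ((hKx x).const_mul _), lintegral_const_mul _ (hKx x),
            lintegral_gaussDensity ha, mul_one]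
      _ = (∫⁻ x, ENNReal.ofReal (p x) ^ 2) +
            ∫⁻ y, ∫⁻ x, ENNReal.ofReal (p y) ^ 2 * K x y := by
          rw [lintegral_add_left (hpm.pow_const 2), lintegral_lintegral_swap]
          exact (((hpm.comp measurable_snd).pow_const 2).mul hKm).aemeasurable
      _ = (∫⁻ x, ENNReal.ofReal (p x) ^ 2) + ∫⁻ y, ENNReal.ofReal (p y) ^ 2 := by
          congr 2 with y
          simp_rw [hK, fun x => gaussDensity_symm a x y]
          rw [lintegral_const_mul _ (hKx y), lintegral_gaussDensity ha, mul_one]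
      _ = _ := by rw [two_mul]
  exact (ENNReal.mul_le_mul_iff_right (by norm_num) (by norm_num)).1 h2

/-- The Fourier transform of a density and the characteristic function of its distribution have the
same modulus, up to normalization. -/
lemma IsDensity.norm_fourierTransform_sq (hp : IsDensity p) (ω : Space d) :
    ‖fourierTransform p ω‖ ^ 2 =
      (2 * Real.pi) ^ (-(d : ℝ)) * ‖charFun (densityMeasure p) ω‖ ^ 2 := by
  have e : charFun (densityMeasure p) ω = (starRingEnd ℂ)
      (∫ x, (p x : ℂ) * Complex.exp (-Complex.I * ((inner ℝ x ω : ℝ) : ℂ))) := by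
    rw [charFun_apply, hp.integral_densityMeasure, ← integral_conj]
    congr with x
    rw [map_mul, Complex.conj_ofReal, ← Complex.exp_conj, map_mul, map_neg, Complex.conj_I,
      Complex.conj_ofReal, Complex.real_smul]
    congr 2
    ring
  rw [e, RCLike.norm_conj, fourierTransform, norm_mul, mul_pow, Complex.norm_real,
    Real.norm_eq_abs, abs_of_nonneg (by positivity), ← Real.rpow_natCast, ← Real.rpow_mul
    (by positivity)]
  congr 2
  push_cast
  ring

/-- The normalized Gaussian kernel as a Fourier integral. -/
lemma integral_exp_mul_cexp_inner {a : ℝ} (ha : 0 < a) (x y : Space d) :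
    ∫ ω : Space d, ((((2 * Real.pi) ^ (-(d : ℝ)) * Real.exp (-(1 / (4 * a)) * ‖ω‖ ^ 2) : ℝ)) : ℂ) *
      Complex.exp (((inner ℝ (x - y) ω : ℝ) : ℂ) * Complex.I) = (gaussDensity a x y : ℂ) := by
  have hb : 0 < ((1 / (4 * a) : ℝ) : ℂ).re := by rw [Complex.ofReal_re]; positivity
  have h := GaussianFourier.integral_cexp_neg_mul_sq_norm_add hb Complex.I (x - y)
  rw [finrank_euclideanSpace_fin] at h
  have e : ∀ ω : Space d,
      ((((2 * Real.pi) ^ (-(d : ℝ)) * Real.exp (-(1 / (4 * a)) * ‖ω‖ ^ 2) : ℝ)) : ℂ) *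
      Complex.exp (((inner ℝ (x - y) ω : ℝ) : ℂ) * Complex.I) =
      (((2 * Real.pi) ^ (-(d : ℝ)) : ℝ) : ℂ) *
        Complex.exp (-((1 / (4 * a) : ℝ) : ℂ) * ‖ω‖ ^ 2 + Complex.I * ((inner ℝ (x - y) ω : ℝ) : ℂ))
      := by
    intro ω
    rw [Complex.ofReal_mul, mul_assoc, Complex.ofReal_exp, ← Complex.exp_add]
    congr 2
    push_cast
    ring
  simp_rw [e]
  rw [integral_const_mul, h, gaussDensity, gaussKernel]
  have e1 : (Real.pi : ℂ) / ((1 / (4 * a) : ℝ) : ℂ) = ((4 * a * Real.pi : ℝ) : ℂ) := by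
    rw [← Complex.ofReal_div]; congr 1; field_simp
  have e2 : Complex.I ^ 2 * (‖x - y‖ : ℂ) ^ 2 / (4 * ((1 / (4 * a) : ℝ) : ℂ)) =
      ((-a * ‖x - y‖ ^ 2 : ℝ) : ℂ) := by
    have ha' : (a : ℂ) ≠ 0 := by exact_mod_cast ha.ne'
    rw [Complex.I_sq]; push_cast; field_simp
  have e3 : ((d : ℂ) / 2) = (((d : ℝ) / 2 : ℝ) : ℂ) := by push_cast; rfl
  rw [e1, e2, e3, ← Complex.ofReal_cpow (by positivity), ← Complex.ofReal_exp, ← Complex.ofReal_mul,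
    ← Complex.ofReal_mul, ← mul_assoc]
  congr 2
  have e4 : (2 * Real.pi) ^ (-(d : ℝ)) = ((2 * Real.pi) ^ 2) ^ (-((d : ℝ) / 2)) := by
    rw [← Real.rpow_natCast, ← Real.rpow_mul (by positivity)]
    congr 1
    push_cast
    ring
  rw [e4, Real.rpow_neg (by positivity), ← Real.inv_rpow (by positivity),
    ← Real.mul_rpow (by positivity) (by positivity)]
  congr 1
  field_simp
  ring

/-- The smoothed energy is dominated by the `L²` norm of the Fourier transform. -/
lemma IsDensity.smoothedEnergy_le_fourier (hp : IsDensity p)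
    (hF : Integrable fun ω => ‖fourierTransform p ω‖ ^ 2) {a : ℝ} (ha : 0 < a) :
    smoothedEnergy p a ≤ ENNReal.ofReal (∫ ω, ‖fourierTransform p ω‖ ^ 2) := by
  have := hp.isProbabilityMeasure
  set P := densityMeasure p with hP
  have hK0 : ∀ x y : Space d, 0 ≤ gaussDensity a x y := gaussDensity_nonneg ha.le
  have hKint : Integrable (fun q : Space d × Space d => gaussDensity a q.1 q.2) (P.prod P) := by
    refine Integrable.of_bound (measurable_gaussDensity a).aestronglyMeasurable
      ((a / Real.pi) ^ ((d : ℝ) / 2)) (ae_of_all _ fun q => ?_)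
    rw [Real.norm_eq_abs, abs_of_nonneg (hK0 _ _), gaussDensity]
    exact mul_le_of_le_one_right (by positivity) (gaussKernel_le_one ha.le _ _)
  have e1 : smoothedEnergy p a =
      ENNReal.ofReal (∫ q : Space d × Space d, gaussDensity a q.1 q.2 ∂(P.prod P)) := by
    rw [ofReal_integral_eq_lintegral_ofReal hKint (ae_of_all _ fun q => hK0 _ _),
      lintegral_prod _ (measurable_gaussDensity a).ennreal_ofReal.aemeasurable]
    rfl
  rw [e1]
  refine ENNReal.ofReal_le_ofReal ?_
  set g : Space d → ℝ := fun ω =>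
    (2 * Real.pi) ^ (-(d : ℝ)) * Real.exp (-(1 / (4 * a)) * ‖ω‖ ^ 2) with hg
  have hg0 : ∀ ω, 0 ≤ g ω := fun ω => by positivity
  have hgint : Integrable g := by
    have := (integrable_gaussKernel (d := d) (ν := 1 / (4 * a)) (by positivity) 0).const_mul
      ((2 * Real.pi) ^ (-(d : ℝ)))
    simpa [gaussKernel, hg] using this
  have e2 : ((∫ q : Space d × Space d, gaussDensity a q.1 q.2 ∂(P.prod P) : ℝ) : ℂ) =
      ((∫ ω, g ω * ‖charFun P ω‖ ^ 2 : ℝ) : ℂ) := by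
    rw [← integral_complex_ofReal, ← integral_complex_ofReal]
    simp_rw [← integral_exp_mul_cexp_inner ha]
    rw [integral_integral_swap (f := fun (q : Space d × Space d) (ω : Space d) => ((g ω : ℝ) : ℂ) *
      Complex.exp (((inner ℝ (q.1 - q.2) ω : ℝ) : ℂ) * Complex.I))]
    · congr with ω
      rw [integral_const_mul, Complex.ofReal_mul]
      have e3 : ∀ q : Space d × Space d,
          Complex.exp (((inner ℝ (q.1 - q.2) ω : ℝ) : ℂ) * Complex.I) =
          Complex.exp (((inner ℝ q.1 ω : ℝ) : ℂ) * Complex.I) *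
            (starRingEnd ℂ) (Complex.exp (((inner ℝ q.2 ω : ℝ) : ℂ) * Complex.I)) := by
        intro q
        rw [← Complex.exp_conj, map_mul, Complex.conj_I, Complex.conj_ofReal, ← Complex.exp_add,
          inner_sub_left]
        congr 1
        push_cast
        ring
      simp_rw [e3]
      rw [integral_prod_mul (fun x : Space d => Complex.exp (((inner ℝ x ω : ℝ) : ℂ) * Complex.I))
        (fun y : Space d => (starRingEnd ℂ) (Complex.exp (((inner ℝ y ω : ℝ) : ℂ) * Complex.I))),
        integral_conj, ← charFun_apply, Complex.mul_conj, Complex.normSq_eq_norm_sq]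
      simp only [hg]
      push_cast
      rfl
    · have hnorm : Integrable (fun z : (Space d × Space d) × Space d => g z.2)
          ((P.prod P).prod volume) := hgint.comp_snd _
      refine hnorm.mono' (by
        have : Continuous g := by rw [hg]; fun_prop
        exact Continuous.aestronglyMeasurable (by
          simp only [Function.uncurry_def]; fun_prop)) (ae_of_all _ fun z => ?_)
      simp only [Function.uncurry_def]
      rw [norm_mul, Complex.norm_exp_ofReal_mul_I, mul_one, Complex.norm_real, Real.norm_eq_abs,
        abs_of_nonneg (hg0 _)]
  rw [Complex.ofReal_inj.1 e2]
  refine integral_mono_of_nonneg (ae_of_all _ fun ω => mul_nonneg (hg0 ω) (sq_nonneg _)) hF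
    (ae_of_all _ fun ω => ?_)
  simp only
  rw [hp.norm_fourierTransform_sq, hg]
  simp only
  refine mul_le_mul_of_nonneg_right (mul_le_of_le_one_right (by positivity) ?_) (sq_nonneg _)
  rw [Real.exp_le_one_iff, neg_mul, neg_nonpos]
  positivity

end Density

end Gaussian

/-! ### Asymptotics of the Gaussian kernel -/

section GaussianAsymptotics

variable {d : ℕ} {p : Space d → ℝ}

lemma measurable_fourierTransform (hp : IsDensity p) : Measurable (fourierTransform p) := by
  have := hp.isProbabilityMeasure
  have e : fourierTransform p = fun ω => (((2 * Real.pi) ^ (-((d : ℝ) / 2)) : ℝ) : ℂ) *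
      charFun (densityMeasure p) (-ω) := by
    funext ω
    rw [fourierTransform, charFun_apply, hp.integral_densityMeasure]
    congr 2 with x
    rw [Complex.real_smul, inner_neg_right]
    congr 2
    push_cast
    ring
  rw [e]
  fun_prop

/-- For `s ≥ 0` the Sobolev weight is at least `1`. -/
lemma integrable_norm_fourierTransform_sq {s : ℝ} (hs : 0 ≤ s) (hp : IsDensity p)
    (hsob : MemSobolev s p) : Integrable fun ω => ‖fourierTransform p ω‖ ^ 2 := by
  refine hsob.2.2.mono' ((measurable_fourierTransform hp).norm.pow_const 2).aestronglyMeasurable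
    (ae_of_all _ fun ω => ?_)
  rw [Real.norm_eq_abs, abs_of_nonneg (sq_nonneg _)]
  exact le_mul_of_one_le_left (sq_nonneg _)
    (Real.one_le_rpow (by linarith [sq_nonneg ‖ω‖]) hs)

/-- A density in a Sobolev space of nonnegative order is square integrable. -/
lemma MemSobolev.integrable_sq {s : ℝ} (hs : 0 ≤ s) (hp : IsDensity p) (hsob : MemSobolev s p) :
    Integrable fun x => p x ^ 2 := by
  have hF := integrable_norm_fourierTransform_sq hs hp hsob
  have h1 := hp.lintegral_sq_le_liminf hsob.2.1 (a := fun n : ℕ => (n : ℝ) + 1)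
    (tendsto_atTop_add_const_right _ _ tendsto_natCast_atTop_atTop)
  have h2 : liminf (fun n : ℕ => smoothedEnergy p ((n : ℝ) + 1)) atTop ≤
      ENNReal.ofReal (∫ ω, ‖fourierTransform p ω‖ ^ 2) :=
    liminf_le_of_le (by isBoundedDefault) fun b hb => by
      obtain ⟨n, hn⟩ := hb.exists
      exact hn.trans (hp.smoothedEnergy_le_fourier hF (by positivity))
  refine ⟨(hp.1.pow_const 2).aestronglyMeasurable, ?_⟩
  rw [hasFiniteIntegral_iff_ofReal (ae_of_all _ fun x => sq_nonneg _)]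
  simp_rw [ENNReal.ofReal_pow (hp.2.1 _)]
  exact (h1.trans h2).trans_lt ENNReal.ofReal_lt_top

lemma IsDensity.ofReal_l2NormSq (hp : IsDensity p) (h2 : Integrable fun x => p x ^ 2) :
    ENNReal.ofReal (l2NormSq p) = ∫⁻ x, ENNReal.ofReal (p x) ^ 2 := by
  rw [l2NormSq, ofReal_integral_eq_lintegral_ofReal h2 (ae_of_all _ fun x => sq_nonneg _)]
  simp_rw [ENNReal.ofReal_pow (hp.2.1 _)]

lemma IsDensity.l2NormSq_pos (hp : IsDensity p) (h2 : Integrable fun x => p x ^ 2) :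
    0 < l2NormSq p := by
  refine lt_of_le_of_ne (integral_nonneg fun x => sq_nonneg _) fun h => ?_
  have h3 := (integral_eq_zero_iff_of_nonneg (fun x => sq_nonneg (p x)) h2).1 h.symm
  have h4 : ∫ x, p x = 0 := by
    rw [integral_eq_zero_of_ae]
    filter_upwards [h3] with x hx
    exact pow_eq_zero_iff two_ne_zero |>.1 hx
  rw [hp.2.2] at h4
  exact one_ne_zero h4

/-- The smoothed energy converges to the squared `L²` norm. -/
lemma IsDensity.tendsto_smoothedEnergy (hp : IsDensity p) (h2 : Integrable fun x => p x ^ 2)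
    (hc : ∀ᵐ x, ContinuousAt p x) {a : ℕ → ℝ} (ha : Tendsto a atTop atTop) :
    Tendsto (fun n => smoothedEnergy p (a n)) atTop (𝓝 (ENNReal.ofReal (l2NormSq p))) := by
  rw [hp.ofReal_l2NormSq h2]
  refine tendsto_of_le_liminf_of_limsup_le (hp.lintegral_sq_le_liminf hc ha) ?_
  refine limsup_le_of_le (by isBoundedDefault) ?_
  filter_upwards [ha.eventually_gt_atTop 0] with n hn using hp.smoothedEnergy_le hn

/-- The Gaussian kernel as a function on pairs. -/
def pairKernel (d : ℕ) (ν : ℝ) (q : Space d × Space d) : ℝ := gaussKernel ν q.1 q.2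

/-- The scaled second moment of the Gaussian kernel is a smoothed energy. -/
lemma IsDensity.smoothedEnergy_eq (hp : IsDensity p) {ν : ℝ} (hν : 0 < ν) :
    smoothedEnergy p (2 * ν) = ENNReal.ofReal (((2 * ν / Real.pi) ^ ((d : ℝ) / 4)) ^ 2 *
      ∫ x, ∫ y, pairKernel d ν (x, y) ^ 2 ∂densityMeasure p ∂densityMeasure p) := by
  have := hp.isProbabilityMeasure
  have hb : BoundedMeasurable fun q : Space d × Space d => gaussDensity (2 * ν) q.1 q.2 := by
    refine ⟨measurable_gaussDensity _, (2 * ν / Real.pi) ^ ((d : ℝ) / 2), fun q => ?_⟩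
    rw [abs_of_nonneg (gaussDensity_nonneg (by positivity) _ _), gaussDensity]
    exact mul_le_of_le_one_right (by positivity) (gaussKernel_le_one (by positivity) _ _)
  simp_rw [← integral_const_mul, pairKernel, scale_sq_mul_gaussKernel_sq hν]
  rw [ofReal_integral_eq_lintegral_ofReal (hb.integral_right _).integrable
    (ae_of_all _ fun x => integral_nonneg fun y => gaussDensity_nonneg (by positivity) x y),
    smoothedEnergy]
  congr with x
  rw [ofReal_integral_eq_lintegral_ofReal (hp.integrable_gaussDensity (by positivity) x)
    (ae_of_all _ fun y => gaussDensity_nonneg (by positivity) x y)]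

lemma IsDensity.tendsto_second_moment (hp : IsDensity p) (h2 : Integrable fun x => p x ^ 2)
    (hc : ∀ᵐ x, ContinuousAt p x) {ν : ℕ → ℝ} (hν : Tendsto ν atTop atTop) :
    Tendsto (fun n => ((2 * ν n / Real.pi) ^ ((d : ℝ) / 4)) ^ 2 *
      ∫ x, ∫ y, pairKernel d (ν n) (x, y) ^ 2 ∂densityMeasure p ∂densityMeasure p) atTop
      (𝓝 (l2NormSq p)) := by
  have h := (ENNReal.tendsto_toReal ENNReal.ofReal_ne_top).comp
    (hp.tendsto_smoothedEnergy h2 hc (hν.const_mul_atTop (r := 2) (by norm_num)))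
  rw [ENNReal.toReal_ofReal (hp.l2NormSq_pos h2).le] at h
  refine h.congr' ?_
  filter_upwards [hν.eventually_gt_atTop 0] with n hn
  simp only [Function.comp_apply]
  rw [hp.smoothedEnergy_eq hn, ENNReal.toReal_ofReal]
  exact mul_nonneg (sq_nonneg _) (integral_nonneg fun _ => integral_nonneg fun _ => sq_nonneg _)

/-- The tails `(p - k)⁺` of a square integrable function are small in `L²`. -/
lemma IsDensity.tendsto_integral_sq_tail (hp : IsDensity p) (h2 : Integrable fun x => p x ^ 2) :
    Tendsto (fun k : ℕ => ∫ x, max (p x - k) 0 ^ 2) atTop (𝓝 0) := by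
  have hm : ∀ k : ℕ, Measurable fun x => max (p x - k) 0 ^ 2 := fun k =>
    ((hp.1.sub_const _).max measurable_const).pow_const 2
  have := tendsto_integral_of_dominated_convergence (F := fun (k : ℕ) x => max (p x - k) 0 ^ 2)
    (f := fun _ => (0 : ℝ)) (fun x => p x ^ 2) (fun k => (hm k).aestronglyMeasurable) h2
    (fun k => ae_of_all _ fun x => ?_) (ae_of_all _ fun x => ?_)
  · simpa using this
  · rw [Real.norm_eq_abs, abs_of_nonneg (sq_nonneg _)]
    refine pow_le_pow_left₀ (le_max_right _ _) (max_le ?_ (hp.2.1 x)) 2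
    have : (0 : ℝ) ≤ k := Nat.cast_nonneg k
    linarith
  · refine tendsto_const_nhds.congr' ?_
    obtain ⟨k₀, hk₀⟩ := exists_nat_ge (p x)
    filter_upwards [eventually_ge_atTop k₀] with k hk
    have : (k₀ : ℝ) ≤ k := by exact_mod_cast hk
    rw [max_eq_right (by linarith)]
    norm_num

/-- The rows of the Gaussian kernel are uniformly of smaller order than the inverse scaling. The
density is cut at a level `k`: the bounded part contributes `k (π/ν)^(d/2)`, and the rest is small
by the Cauchy–Schwarz inequality, because its `L²` norm is. -/
lemma IsDensity.eventually_scale_mul_integral_le (hd : 0 < d) (hp : IsDensity p)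
    (h2 : Integrable fun x => p x ^ 2) {η : ℝ} (hη : 0 < η) :
    ∀ᶠ ν : ℝ in atTop, ∀ x : Space d,
      (2 * ν / Real.pi) ^ ((d : ℝ) / 4) * ∫ y, gaussKernel ν x y ∂densityMeasure p ≤ η := by
  have hd' : (0 : ℝ) < d := by exact_mod_cast hd
  obtain ⟨k, hk⟩ := ((hp.tendsto_integral_sq_tail h2).eventually_lt_const
    (show 0 < (η / 2) ^ 2 by positivity)).exists
  set r : Space d → ℝ := fun x => max (p x - k) 0 with hr
  have hrint : Integrable fun x => r x ^ 2 := by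
    refine h2.mono' (((hp.1.sub_const _).max measurable_const).pow_const 2).aestronglyMeasurable
      (ae_of_all _ fun x => ?_)
    rw [Real.norm_eq_abs, abs_of_nonneg (sq_nonneg _)]
    refine pow_le_pow_left₀ (le_max_right _ _) (max_le ?_ (hp.2.1 x)) 2
    have : (0 : ℝ) ≤ k := Nat.cast_nonneg k
    linarith
  have hlim : Tendsto (fun ν : ℝ => (k : ℝ) * (2 ^ ((d : ℝ) / 4) *
      (Real.pi / ν) ^ ((d : ℝ) / 4))) atTop (𝓝 0) := by
    have h1 : Tendsto (fun ν : ℝ => Real.pi / ν) atTop (𝓝 0) :=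
      tendsto_const_nhds.div_atTop tendsto_id
    have h3 := h1.rpow_const (p := (d : ℝ) / 4) (Or.inr (by positivity))
    rw [Real.zero_rpow (by positivity)] at h3
    simpa using (h3.const_mul (2 ^ ((d : ℝ) / 4))).const_mul (k : ℝ)
  filter_upwards [eventually_gt_atTop 0,
    hlim.eventually_lt_const (show 0 < η / 2 by positivity)] with ν hν hlt x
  set c := (2 * ν / Real.pi) ^ ((d : ℝ) / 4) with hc
  have hc0 : 0 < c := by positivity
  have hdens : Integrable (gaussDensity (2 * ν) x) :=
    (integrable_gaussKernel (by positivity) x).const_mul _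
  -- `c G` has unit `L²` norm, so the weighted inequality between means below acts as a
  -- Cauchy–Schwarz inequality for the part above the level `k`
  have hpt : ∀ y, c * (p y * gaussKernel ν x y) ≤ (c * k) * gaussKernel ν x y +
      (2⁻¹ * (η / 2) * gaussDensity (2 * ν) x y + (2⁻¹ * (η / 2)⁻¹) * r y ^ 2) := by
    intro y
    have h1 : p y ≤ k + r y := by
      have := le_max_left (p y - k) 0
      simp only [hr]; linarith
    have hG := gaussKernel_pos ν x y
    rw [← scale_sq_mul_gaussKernel_sq hν, ← hc]
    have h3 : c * gaussKernel ν x y * r y ≤ 2⁻¹ * (η / 2) * (c ^ 2 * gaussKernel ν x y ^ 2) +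
        (2⁻¹ * (η / 2)⁻¹) * r y ^ 2 := by
      have h4 : 0 ≤ 2⁻¹ * (η / 2)⁻¹ * ((η / 2) * (c * gaussKernel ν x y) - r y) ^ 2 := by positivity
      have e : 2⁻¹ * (η / 2)⁻¹ * ((η / 2) * (c * gaussKernel ν x y) - r y) ^ 2 =
          2⁻¹ * (η / 2) * (c ^ 2 * gaussKernel ν x y ^ 2) + (2⁻¹ * (η / 2)⁻¹) * r y ^ 2 -
            c * gaussKernel ν x y * r y := by
        field_simp
        ring
      linarith
    have h5 := mul_le_mul_of_nonneg_left h1 (mul_pos hc0 hG).le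
    linarith
  rw [hp.integral_densityMeasure, ← integral_const_mul]
  simp only [smul_eq_mul]
  have i1 := (integrable_gaussKernel hν x).const_mul (c * k)
  have i2 := hdens.const_mul (2⁻¹ * (η / 2))
  have i3 := hrint.const_mul (2⁻¹ * (η / 2)⁻¹)
  have i23 : Integrable fun y => 2⁻¹ * (η / 2) * gaussDensity (2 * ν) x y +
      (2⁻¹ * (η / 2)⁻¹) * r y ^ 2 := i2.add i3
  have hI := integral_mono_of_nonneg (ae_of_all _ fun y => mul_nonneg hc0.le
    (mul_nonneg (hp.2.1 y) (gaussKernel_pos ν x y).le)) (i1.add i23) (ae_of_all _ hpt)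
  refine hI.trans ?_
  have e1 : ∫ y, (fun y => (c * k) * gaussKernel ν x y) y + (2⁻¹ * (η / 2) *
      gaussDensity (2 * ν) x y + (2⁻¹ * (η / 2)⁻¹) * r y ^ 2) =
      (c * k) * (Real.pi / ν) ^ ((d : ℝ) / 2) + (2⁻¹ * (η / 2) +
        (2⁻¹ * (η / 2)⁻¹) * ∫ y, r y ^ 2) := by
    rw [integral_add i1 i23, integral_add i2 i3, integral_const_mul, integral_const_mul,
      integral_const_mul, integral_gaussKernel hν, integral_gaussDensity (by positivity), mul_one]
  have e2 : (c * k) * (Real.pi / ν) ^ ((d : ℝ) / 2) =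
      (k : ℝ) * (2 ^ ((d : ℝ) / 4) * (Real.pi / ν) ^ ((d : ℝ) / 4)) := by
    have e3 : (Real.pi / ν) ^ ((d : ℝ) / 2) =
        (Real.pi / ν) ^ ((d : ℝ) / 4) * (Real.pi / ν) ^ ((d : ℝ) / 4) := by
      rw [← Real.rpow_add (by positivity)]; congr 1; ring
    have e4 : c * (Real.pi / ν) ^ ((d : ℝ) / 4) = 2 ^ ((d : ℝ) / 4) := by
      rw [hc, ← Real.mul_rpow (by positivity) (by positivity)]
      congr 1
      field_simp
    rw [e3, ← e4]; ring
  have e5 : (2⁻¹ * (η / 2)⁻¹) * ∫ y, r y ^ 2 ≤ 2⁻¹ * (η / 2) := by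
    calc (2⁻¹ * (η / 2)⁻¹) * ∫ y, r y ^ 2 ≤ (2⁻¹ * (η / 2)⁻¹) * (η / 2) ^ 2 := by
          gcongr
      _ = _ := by field_simp
  calc _ = _ := e1
    _ ≤ η := by rw [e2]; linarith

/-- The growth condition on `ν` says that `(2ν/π)^(d/4)` is negligible against `n`. -/
lemma tendsto_scale_div (hd : 0 < d) {ν : ℕ → ℝ} (hν : Tendsto ν atTop atTop)
    (hνo : ν =o[atTop] fun n : ℕ => (n : ℝ) ^ (4 / (d : ℝ))) :
    Tendsto (fun n : ℕ => (2 * ν n / Real.pi) ^ ((d : ℝ) / 4) / n) atTop (𝓝 0) := by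
  have hd' : (0 : ℝ) < d := by exact_mod_cast hd
  have h1 := (hνo.tendsto_div_nhds_zero.const_mul (2 / Real.pi)).rpow_const
    (p := (d : ℝ) / 4) (Or.inr (by positivity))
  rw [mul_zero, Real.zero_rpow (by positivity)] at h1
  refine h1.congr' ?_
  filter_upwards [hν.eventually_gt_atTop 0, eventually_gt_atTop 0] with n hn hn0
  have hn' : (0 : ℝ) < n := by exact_mod_cast hn0
  have e : 2 / Real.pi * (ν n / (n : ℝ) ^ (4 / (d : ℝ))) =
      (2 * ν n / Real.pi) / (n : ℝ) ^ (4 / (d : ℝ)) := by ring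
  rw [e, Real.div_rpow (by positivity) (by positivity), ← Real.rpow_mul hn'.le]
  have : 4 / (d : ℝ) * ((d : ℝ) / 4) = 1 := by field_simp
  rw [this, Real.rpow_one]

/-- The Gaussian kernels with the scaling `(2ν/π)^(d/4)` are in the asymptotic regime of
degenerate U-statistics. -/
lemma IsDensity.kernelAsymptotics (hd : 0 < d) (hp : IsDensity p)
    (h2 : Integrable fun x => p x ^ 2) (hc : ∀ᵐ x, ContinuousAt p x) {ν : ℕ → ℝ}
    (hν : Tendsto ν atTop atTop) (hνo : ν =o[atTop] fun n : ℕ => (n : ℝ) ^ (4 / (d : ℝ))) :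
    KernelAsymptotics (fun n => pairKernel d (ν n)) (densityMeasure p)
      (fun n => ⨆ x, ∫ y, gaussKernel (ν n) x y ∂densityMeasure p)
      (fun n => (2 * ν n / Real.pi) ^ ((d : ℝ) / 4)) (l2NormSq p) := by
  have := hp.isProbabilityMeasure
  have hint : ∀ ν : ℝ, 0 ≤ ν → ∀ x : Space d,
      Integrable (gaussKernel ν x) (densityMeasure p) := by
    intro ν hν x
    refine Integrable.of_bound (measurable_gaussKernel_right ν x).aestronglyMeasurable 1
      (ae_of_all _ fun y => ?_)
    rw [Real.norm_eq_abs, abs_of_pos (gaussKernel_pos _ _ _)]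
    exact gaussKernel_le_one hν x y
  have hbdd : ∀ ν : ℝ, 0 ≤ ν →
      BddAbove (Set.range fun x : Space d => ∫ y, gaussKernel ν x y ∂densityMeasure p) := by
    intro ν hν
    refine ⟨1, ?_⟩
    rintro _ ⟨x, rfl⟩
    simpa using integral_mono (hint ν hν x) (integrable_const 1) fun y => gaussKernel_le_one hν x y
  have hpos : ∀ᶠ n in atTop, 0 < ⨆ x, ∫ y, gaussKernel (ν n) x y ∂densityMeasure p := by
    filter_upwards [hν.eventually_ge_atTop 0] with n hn
    exact (integral_exp_pos (hint (ν n) hn 0)).trans_le (le_ciSup (hbdd _ hn) 0)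
  refine ⟨?_, hpos, ?_, ?_, tendsto_scale_div hd hν hνo, hp.tendsto_second_moment h2 hc hν⟩
  · filter_upwards [hν.eventually_ge_atTop 0] with n hn
    exact ⟨measurable_gaussKernel _, fun q => (gaussKernel_pos _ _ _).le,
      fun q => gaussKernel_le_one hn _ _, fun x y => gaussKernel_symm _ _ _,
      fun x => le_ciSup (hbdd _ hn) x⟩
  · filter_upwards [hν.eventually_gt_atTop 0] with n hn
    positivity
  · rw [Metric.tendsto_nhds]
    intro ε hε
    filter_upwards [hν.eventually (hp.eventually_scale_mul_integral_le hd h2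
      (show 0 < ε / 2 by positivity)), hν.eventually_gt_atTop 0, hpos] with n h3 hn hM
    have hc0 : 0 < (2 * ν n / Real.pi) ^ ((d : ℝ) / 4) := by positivity
    rw [Real.dist_eq, sub_zero, abs_of_pos (mul_pos hc0 hM)]
    have h4 : ⨆ x, ∫ y, gaussKernel (ν n) x y ∂densityMeasure p ≤
        ε / 2 / (2 * ν n / Real.pi) ^ ((d : ℝ) / 4) :=
      ciSup_le fun x => by
        rw [le_div_iff₀ hc0, mul_comm]
        exact h3 x
    rw [le_div_iff₀ hc0, mul_comm] at h4
    linarith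

end GaussianAsymptotics

/-! ### The statistics as functions of the sample -/

section Statistics

variable {d : ℕ}

lemma pairSum_eq_sum_ite {S : Type*} {n : ℕ} (f : S × S → ℝ) (x : Fin n → S) :
    pairSum f x = ∑ i, ∑ j, if i ≠ j then f (x i, x j) else 0 := by
  refine Finset.sum_congr rfl fun i _ => ?_
  rw [rowSum, ← Finset.sum_filter]
  refine Finset.sum_congr ?_ fun _ _ => rfl
  ext j
  simp [eq_comm]

lemma centredKernel_eq_doublyCentred {ν : ℝ} (hν : 0 ≤ ν) (P : Measure (Space d))
    [IsProbabilityMeasure P] (x y : Space d) :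
    centredKernel ν P x y = doublyCentred (pairKernel d ν) P (x, y) := by
  have hint : Integrable (fun z : Space d × Space d => gaussKernel ν z.1 z.2) (P.prod P) := by
    refine Integrable.of_bound (measurable_gaussKernel ν).aestronglyMeasurable 1
      (ae_of_all _ fun q => ?_)
    rw [Real.norm_eq_abs, abs_of_pos (gaussKernel_pos _ _ _)]
    exact gaussKernel_le_one hν _ _
  rw [centredKernel, integral_prod _ hint, doublyCentred]
  simp only [pairKernel]
  simp_rw [fun z => gaussKernel_symm ν z y]
  ring

lemma varU_eq_varEstimator {n : ℕ} (ν : ℝ) (x : Fin n → Space d) :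
    varU ν x = varEstimator (pairKernel d ν) x := by
  rw [varU, varEstimator, pairSum_eq_sum_ite]
  simp only [tripleSum, quadSum, pairKernel, gaussKernel_two_mul]

/-- The normalized statistic as a degenerate U-statistic. For `n = 1` both sides vanish, since
`1 / 0 = 0`. -/
lemma normalizedStat_eq {n : ℕ} (hn : n ≠ 0) {ν : ℝ} (hν : 0 ≤ ν) (P : Measure (Space d))
    [IsProbabilityMeasure P] (x : Fin n → Space d) :
    normalizedStat ν P x = (2 * ν / Real.pi) ^ ((d : ℝ) / 4) / (√2 * (n - 1)) *
      pairSum (doublyCentred (pairKernel d ν) P) x := by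
  have hn' : (n : ℝ) ≠ 0 := by exact_mod_cast hn
  rw [normalizedStat, mmdU, pairSum_eq_sum_ite]
  simp only [centredKernel_eq_doublyCentred hν]
  rw [← mul_assoc]
  congr 1
  generalize (2 * ν / Real.pi) ^ ((d : ℝ) / 4) = c
  rw [one_div, mul_inv, div_eq_mul_inv, div_eq_mul_inv, mul_inv]
  calc _ = (n * (n : ℝ)⁻¹) * (c * ((√2)⁻¹ * ((n : ℝ) - 1)⁻¹)) := by ring
    _ = _ := by rw [mul_inv_cancel₀ hn', one_mul]

/-- The studentized statistic is the normalized one, divided by the square root of the scaled variance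
estimator. -/
lemma studentizedStat_eq {n : ℕ} {ν : ℝ} (hν : 0 < ν) (P : Measure (Space d))
    (x : Fin n → Space d) :
    studentizedStat ν P x = normalizedStat ν P x *
      (√(((2 * ν / Real.pi) ^ ((d : ℝ) / 4)) ^ 2 * varHat ν x))⁻¹ := by
  have hc : 0 < (2 * ν / Real.pi) ^ ((d : ℝ) / 4) := by positivity
  rw [studentizedStat, normalizedStat, Real.sqrt_mul (sq_nonneg _), Real.sqrt_sq hc.le, mul_inv]
  field_simp

lemma measurable_mmdU {n : ℕ} (ν : ℝ) (P : Measure (Space d)) [IsProbabilityMeasure P] :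
    Measurable fun x : Fin n → Space d => mmdU ν P x := by
  have h1 : Measurable fun y : Space d => ∫ z, gaussKernel ν y z ∂P :=
    (StronglyMeasurable.integral_prod_right' (ν := P)
      (measurable_gaussKernel ν).stronglyMeasurable).measurable
  have h2 : Measurable fun y : Space d => ∫ z, gaussKernel ν z y ∂P := by
    simpa only [fun z y : Space d => gaussKernel_symm ν z y] using h1
  have h1' : Measurable fun q : Space d × Space d => ∫ z, gaussKernel ν q.1 z ∂P :=
    Measurable.comp (g := fun y => ∫ z, gaussKernel ν y z ∂P) h1 measurable_fst
  have h2' : Measurable fun q : Space d × Space d => ∫ z, gaussKernel ν z q.2 ∂P :=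
    Measurable.comp (g := fun y => ∫ z, gaussKernel ν z y ∂P) h2 measurable_snd
  have h3 : Measurable fun q : Space d × Space d => centredKernel ν P q.1 q.2 := by
    unfold centredKernel
    exact (((measurable_gaussKernel ν).sub h2').sub h1').add_const _
  unfold mmdU
  refine (Finset.measurable_sum _ fun i _ => Finset.measurable_sum _ fun j _ => ?_).const_mul _
  split_ifs
  · exact Measurable.comp (g := fun q : Space d × Space d => centredKernel ν P q.1 q.2)
      (f := fun x : Fin n → Space d => (x i, x j)) h3 (by fun_prop)
  · exact measurable_const

lemma measurable_varU {n : ℕ} (ν : ℝ) : Measurable fun x : Fin n → Space d => varU ν x := by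
  have h : ∀ (ν : ℝ) (i j : Fin n), Measurable fun x : Fin n → Space d =>
      gaussKernel ν (x i) (x j) := fun ν i j =>
    Measurable.comp (g := fun q : Space d × Space d => gaussKernel ν q.1 q.2)
      (f := fun x : Fin n → Space d => (x i, x j)) (measurable_gaussKernel ν) (by fun_prop)
  unfold varU
  refine ((Measurable.const_mul ?_ _).sub (Measurable.const_mul ?_ _)).add
    (Measurable.const_mul ?_ _)
  · refine Finset.measurable_sum _ fun i _ => Finset.measurable_sum _ fun j _ => ?_
    split_ifs
    · exact h _ i j
    · exact measurable_const
  · refine Finset.measurable_sum _ fun i _ => Finset.measurable_sum _ fun j _ =>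
      Finset.measurable_sum _ fun k _ => ?_
    split_ifs
    · exact (h _ i j).mul (h _ i k)
    · exact measurable_const
  · refine Finset.measurable_sum _ fun i _ => Finset.measurable_sum _ fun j _ =>
      Finset.measurable_sum _ fun k _ => Finset.measurable_sum _ fun l _ => ?_
    split_ifs
    · exact (h _ i k).mul (h _ j l)
    · exact measurable_const

lemma measurable_varHat {n : ℕ} (ν : ℝ) : Measurable fun x : Fin n → Space d => varHat ν x :=
  (measurable_varU ν).max measurable_const

lemma measurable_normalizedStat {n : ℕ} (ν : ℝ) (P : Measure (Space d)) [IsProbabilityMeasure P] :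
    Measurable fun x : Fin n → Space d => normalizedStat ν P x :=
  (measurable_mmdU ν P).const_mul _

lemma measurable_studentizedStat {n : ℕ} (ν : ℝ) (P : Measure (Space d))
    [IsProbabilityMeasure P] : Measurable fun x : Fin n → Space d => studentizedStat ν P x :=
  ((measurable_varHat ν).sqrt.inv.const_mul _).mul (measurable_mmdU ν P)

end Statistics

/-! ### Convergence in distribution -/

section Convergence

variable {Ω : Type*} [MeasurableSpace Ω] {μ : Measure Ω} [IsProbabilityMeasure μ]

/-- The first `n` members of an i.i.d. sequence form an i.i.d. sample. -/
lemma map_sample_eq {S : Type*} [MeasurableSpace S] {P : Measure S} [IsProbabilityMeasure P]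
    {X : ℕ → Ω → S} (hindep : iIndepFun X μ) (hlaw : ∀ i, HasLaw (X i) P μ) (n : ℕ) :
    μ.map (fun ω (i : Fin n) => X i ω) = sampleLaw P (Fin n) := by
  have h := iIndepFun.map_fun_eq_pi_map (f := fun (i : Fin n) ω => X i ω)
    (fun i => (hlaw i).aemeasurable) (hindep.precomp Fin.val_injective)
  simp only [(hlaw _).map_eq] at h
  exact h

/-- Continuous mapping for convergence in probability to a constant. -/
lemma tendstoInMeasure_comp_const {V : ℕ → Ω → ℝ} {L : ℝ} {f : ℝ → ℝ}
    (hV : TendstoInMeasure μ V atTop fun _ => L) (hf : ContinuousAt f L) :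
    TendstoInMeasure μ (fun n ω => f (V n ω)) atTop fun _ => f L := by
  rw [tendstoInMeasure_iff_dist] at hV ⊢
  intro ε hε
  obtain ⟨δ, hδ, h⟩ := Metric.continuousAt_iff.1 hf ε hε
  refine tendsto_of_tendsto_of_tendsto_of_le_of_le tendsto_const_nhds (hV δ hδ)
    (fun _ => zero_le) fun n => measure_mono fun ω hω => ?_
  by_contra hlt
  exact absurd (h (not_le.1 hlt)) (not_lt.2 hω)

/-- Markov's inequality: convergence in mean implies convergence in probability. -/
lemma tendstoInMeasure_of_tendsto_integral {V : ℕ → Ω → ℝ} {L : ℝ}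
    (hint : ∀ᶠ n in atTop, Integrable (fun ω => V n ω - L) μ)
    (h : Tendsto (fun n => ∫ ω, |V n ω - L| ∂μ) atTop (𝓝 0)) :
    TendstoInMeasure μ V atTop fun _ => L := by
  rw [tendstoInMeasure_iff_measureReal_dist]
  intro ε hε
  have h2 := h.div_const ε
  rw [zero_div] at h2
  refine squeeze_zero' (Eventually.of_forall fun _ => measureReal_nonneg) ?_ h2
  filter_upwards [hint] with n hn
  rw [le_div_iff₀ hε, mul_comm]
  exact mul_meas_ge_le_integral_of_nonneg (ae_of_all _ fun ω => abs_nonneg _) hn.abs ε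

/-- Convergence in distribution depends only on the tail of the sequence. -/
lemma tendstoInDistribution_congr_eventually {A B : ℕ → Ω → ℝ} {Ω' : Type*} [MeasurableSpace Ω']
    {μ' : Measure Ω'} [IsProbabilityMeasure μ'] {Z : Ω' → ℝ}
    (hA : TendstoInDistribution A atTop Z (fun _ => μ) μ') (hAB : ∀ᶠ n in atTop, A n = B n)
    (hB : ∀ n, AEMeasurable (B n) μ) : TendstoInDistribution B atTop Z (fun _ => μ) μ' := by
  refine tendstoInDistribution_of_tendstoInMeasure_sub B Z hA ?_ hB
  intro ε hε
  refine tendsto_const_nhds.congr' ?_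
  filter_upwards [hAB] with n hn
  simp [hn, hε.ne']

variable {d : ℕ} {p : Space d → ℝ} {ν : ℕ → ℝ} {X : ℕ → Ω → Space d}

/-- Asymptotic normality of the normalized statistic, by Lévy's continuity theorem. -/
lemma tendstoInDistribution_normalizedStat (hd : 0 < d) (hp : IsDensity p)
    (h2 : Integrable fun x => p x ^ 2) (hc : ∀ᵐ x, ContinuousAt p x)
    (hν : Tendsto ν atTop atTop) (hνo : ν =o[atTop] fun n : ℕ => (n : ℝ) ^ (4 / (d : ℝ)))
    (hindep : iIndepFun X μ) (hlaw : ∀ i, HasLaw (X i) (densityMeasure p) μ) :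
    TendstoInDistribution
      (fun (n : ℕ) (ω : Ω) => normalizedStat (ν n) (densityMeasure p) fun i : Fin n => X i ω)
      atTop (id : ℝ → ℝ) (fun _ => μ) (gaussianReal 0 (l2NormSq p).toNNReal) := by
  have := hp.isProbabilityMeasure
  have H := hp.kernelAsymptotics hd h2 hc hν hνo
  have hXm : ∀ n : ℕ, AEMeasurable (fun ω (i : Fin n) => X i ω) μ := fun n =>
    aemeasurable_pi_lambda _ fun i => (hlaw i).aemeasurable
  have hWm : ∀ n : ℕ, AEMeasurable
      (fun ω => normalizedStat (ν n) (densityMeasure p) fun i : Fin n => X i ω) μ := fun n =>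
    (measurable_normalizedStat _ _).comp_aemeasurable (hXm n)
  refine ⟨hWm, aemeasurable_id, ProbabilityMeasure.tendsto_iff_tendsto_charFun.2 fun t => ?_⟩
  simp only [ProbabilityMeasure.coe_mk, Measure.map_id]
  rw [charFun_gaussianReal]
  have e0 : Complex.exp ((t : ℂ) * ((0 : ℝ) : ℂ) * Complex.I -
      (((l2NormSq p).toNNReal : ℝ) : ℂ) * (t : ℂ) ^ 2 / 2) =
      Complex.exp (-(l2NormSq p * t ^ 2 / 2) : ℝ) := by
    rw [Real.coe_toNNReal _ H.nonneg]
    push_cast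
    ring_nf
  rw [e0]
  refine (H.tendsto_integral_cexp t).congr' ?_
  filter_upwards [hν.eventually_ge_atTop 0, eventually_ne_atTop 0] with n hn hn0
  have hg : Measurable fun x : Fin n → Space d => normalizedStat (ν n) (densityMeasure p) x :=
    measurable_normalizedStat _ _
  rw [charFun_apply_real, integral_map (hWm n) (by fun_prop), ← map_sample_eq hindep hlaw n,
    integral_map (hXm n)]
  · congr with ω
    rw [normalizedStat_eq hn0 hn]
    congr 1
    push_cast
    ring
  · simp only [← normalizedStat_eq hn0 hn]
    fun_prop

/-- Consistency of the scaled variance estimator. The truncation at `1 / n ^ 2` changes it by at most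
`(c / n) ^ 2`. -/
lemma tendstoInMeasure_scale_mul_varHat (hd : 0 < d) (hp : IsDensity p)
    (h2 : Integrable fun x => p x ^ 2) (hc : ∀ᵐ x, ContinuousAt p x)
    (hν : Tendsto ν atTop atTop) (hνo : ν =o[atTop] fun n : ℕ => (n : ℝ) ^ (4 / (d : ℝ)))
    (hindep : iIndepFun X μ) (hlaw : ∀ i, HasLaw (X i) (densityMeasure p) μ) :
    TendstoInMeasure μ (fun (n : ℕ) (ω : Ω) => ((2 * ν n / Real.pi) ^ ((d : ℝ) / 4)) ^ 2 *
      varHat (ν n) fun i : Fin n => X i ω) atTop fun _ => l2NormSq p := by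
  have := hp.isProbabilityMeasure
  have H := hp.kernelAsymptotics hd h2 hc hν hνo
  set c : ℕ → ℝ := fun n => (2 * ν n / Real.pi) ^ ((d : ℝ) / 4) with hcdef
  set L := l2NormSq p
  have hL : 0 ≤ L := H.nonneg
  have hXm : ∀ n : ℕ, AEMeasurable (fun ω (i : Fin n) => X i ω) μ := fun n =>
    aemeasurable_pi_lambda _ fun i => (hlaw i).aemeasurable
  have hb : ∀ᶠ n in atTop, BoundedMeasurable fun x : Fin n → Space d =>
      c n ^ 2 * varU (ν n) x - L := by
    filter_upwards [H.small] with n hn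
    simp only [varU_eq_varEstimator]
    exact (hn.boundedMeasurable.varEstimator.const_mul _).sub (BoundedMeasurable.const _)
  have hU : ∀ᶠ n in atTop, Integrable
      (fun ω => c n ^ 2 * varU (ν n) (fun i : Fin n => X i ω) - L) μ := by
    filter_upwards [hb] with n hn
    obtain ⟨C, hC⟩ := hn.bounded
    exact Integrable.of_bound (hn.measurable.comp_aemeasurable (hXm n)).aestronglyMeasurable C
      (ae_of_all _ fun ω => hC _)
  have hlim : Tendsto (fun n => ∫ ω, |c n ^ 2 * varU (ν n) (fun i : Fin n => X i ω) - L| ∂μ)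
      atTop (𝓝 0) := by
    refine H.tendsto_integral_abs_varEstimator_sub.congr' ?_
    filter_upwards [hb] with n hn
    simp only [← varU_eq_varEstimator]
    rw [← map_sample_eq hindep hlaw n]
    exact integral_map (hXm n) (by exact hn.abs.measurable.aestronglyMeasurable)
  have hmax : ∀ n : ℕ, ∀ x : Fin n → Space d, |c n ^ 2 * varHat (ν n) x - L| ≤
      |c n ^ 2 * varU (ν n) x - L| + (c n / n) ^ 2 := by
    intro n x
    have e : c n ^ 2 * varHat (ν n) x = max (c n ^ 2 * varU (ν n) x) ((c n / n) ^ 2) := by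
      rw [varHat, mul_max_of_nonneg _ _ (sq_nonneg (c n))]
      congr 1
      ring
    rw [e]
    have h0 : 0 ≤ (c n / n) ^ 2 := sq_nonneg _
    have h1 := abs_le.1 (le_refl |c n ^ 2 * varU (ν n) x - L|)
    rw [abs_le]
    constructor
    · have := le_max_left (c n ^ 2 * varU (ν n) x) ((c n / n) ^ 2)
      linarith
    · rcases max_cases (c n ^ 2 * varU (ν n) x) ((c n / n) ^ 2) with ⟨h, _⟩ | ⟨h, _⟩ <;>
        rw [h] <;> linarith [abs_nonneg (c n ^ 2 * varU (ν n) x - L)]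
  have hmeas : ∀ n : ℕ, AEStronglyMeasurable
      (fun ω => c n ^ 2 * varHat (ν n) (fun i : Fin n => X i ω) - L) μ := fun n =>
    ((((measurable_varHat (ν n)).comp_aemeasurable (hXm n)).const_mul _).sub_const
      L).aestronglyMeasurable
  have hint : ∀ᶠ n in atTop, Integrable
      (fun ω => c n ^ 2 * varHat (ν n) (fun i : Fin n => X i ω) - L) μ := by
    filter_upwards [hU] with n hn
    exact (hn.abs.add (integrable_const ((c n / n) ^ 2))).mono' (hmeas n)
      (ae_of_all _ fun ω => hmax n _)
  refine tendstoInMeasure_of_tendsto_integral hint ?_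
  refine squeeze_zero' (g := fun n : ℕ =>
      ∫ ω, |c n ^ 2 * varU (ν n) (fun i : Fin n => X i ω) - L| ∂μ + (c n / n) ^ 2)
    (Eventually.of_forall fun n => integral_nonneg fun _ => abs_nonneg _) ?_ ?_
  · filter_upwards [hU, hint] with n hn hn'
    have h3 := integral_mono hn'.abs (hn.abs.add (integrable_const ((c n / n) ^ 2)))
      fun ω => hmax n _
    refine h3.trans (le_of_eq ?_)
    rw [integral_add' hn.abs (integrable_const _)]
    simp
  · simpa using hlim.add (H.tendsto_scale_div.pow 2)

/-- Asymptotic normality of the studentized statistic, by Slutsky's theorem. -/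
lemma tendstoInDistribution_studentizedStat (hd : 0 < d) (hp : IsDensity p)
    (h2 : Integrable fun x => p x ^ 2) (hc : ∀ᵐ x, ContinuousAt p x)
    (hν : Tendsto ν atTop atTop) (hνo : ν =o[atTop] fun n : ℕ => (n : ℝ) ^ (4 / (d : ℝ)))
    (hindep : iIndepFun X μ) (hlaw : ∀ i, HasLaw (X i) (densityMeasure p) μ) :
    TendstoInDistribution
      (fun (n : ℕ) (ω : Ω) => studentizedStat (ν n) (densityMeasure p) fun i : Fin n => X i ω)
      atTop (id : ℝ → ℝ) (fun _ => μ) (gaussianReal 0 1) := by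
  have := hp.isProbabilityMeasure
  have hL : 0 < l2NormSq p := hp.l2NormSq_pos h2
  have hXm : ∀ n : ℕ, AEMeasurable (fun ω (i : Fin n) => X i ω) μ := fun n =>
    aemeasurable_pi_lambda _ fun i => (hlaw i).aemeasurable
  have hW := tendstoInDistribution_normalizedStat hd hp h2 hc hν hνo hindep hlaw
  have hV := tendstoInMeasure_comp_const (f := fun v => (√v)⁻¹)
    (tendstoInMeasure_scale_mul_varHat hd hp h2 hc hν hνo hindep hlaw)
    (Real.continuous_sqrt.continuousAt.inv₀ (Real.sqrt_pos.2 hL).ne')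
  have hprod := hW.continuous_comp_prodMk_of_tendstoInMeasure_const
    (g := fun q : ℝ × ℝ => q.1 * q.2) (by fun_prop) hV
    fun n => (((measurable_varHat (ν n)).comp_aemeasurable (hXm n)).const_mul _).sqrt.inv
  have hT := tendstoInDistribution_congr_eventually hprod (B := fun (n : ℕ) (ω : Ω) =>
    studentizedStat (ν n) (densityMeasure p) fun i : Fin n => X i ω) (by
      filter_upwards [hν.eventually_gt_atTop 0] with n hn
      funext ω
      exact (studentizedStat_eq hn _ _).symm)
    fun n => (measurable_studentizedStat _ _).comp_aemeasurable (hXm n)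
  refine ⟨hT.forall_aemeasurable, aemeasurable_id, ?_⟩
  have hmap : (gaussianReal 0 (l2NormSq p).toNNReal).map (fun w => id w * (√(l2NormSq p))⁻¹) =
      (gaussianReal 0 1).map id := by
    simp only [id]
    rw [gaussianReal_map_mul_const, Measure.map_id]
    congr 1
    · simp
    · ext
      simp only [NNReal.coe_mul, NNReal.coe_mk, Real.coe_toNNReal _ hL.le, NNReal.coe_one]
      rw [inv_pow, Real.sq_sqrt hL.le, inv_mul_cancel₀ hL.ne']
  have hlim := hT.tendsto
  convert hlim using 2
  exact congrArg 𝓝 (Subtype.ext hmap.symm)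

end Convergence

end GaussMMD

end

theorem theorem1 {d : ℕ} (hd : 0 < d) {s : ℝ} (hs : 0 ≤ s)
    (p₀ : GaussMMD.Space d → ℝ) (hp₀ : GaussMMD.IsDensity p₀) (hsob : GaussMMD.MemSobolev s p₀)
    (ν : ℕ → ℝ) (hν : Tendsto ν atTop atTop)
    (hνo : ν =o[atTop] fun n : ℕ => (n : ℝ) ^ (4 / (d : ℝ)))
    {Ω : Type*} [MeasurableSpace Ω] (μ : Measure Ω) [IsProbabilityMeasure μ]
    (X : ℕ → Ω → GaussMMD.Space d) (hindep : iIndepFun X μ)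
    (hlaw : ∀ i, HasLaw (X i) (GaussMMD.densityMeasure p₀) μ) :
    MemLp p₀ 2 volume ∧
    TendstoInDistribution
      (fun (n : ℕ) (ω : Ω) =>
        GaussMMD.normalizedStat (ν n) (GaussMMD.densityMeasure p₀) fun i : Fin n => X i ω)
      atTop (id : ℝ → ℝ) (fun _ => μ) (gaussianReal 0 (GaussMMD.l2NormSq p₀).toNNReal) ∧
    TendstoInDistribution
      (fun (n : ℕ) (ω : Ω) =>
        GaussMMD.studentizedStat (ν n) (GaussMMD.densityMeasure p₀) fun i : Fin n => X i ω)
      atTop (id : ℝ → ℝ) (fun _ => μ) (gaussianReal 0 1) := by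
  have h2 := hsob.integrable_sq hs hp₀
  exact ⟨(memLp_two_iff_integrable_sq hp₀.1.aestronglyMeasurable).2 h2,
    GaussMMD.tendstoInDistribution_normalizedStat hd hp₀ h2 hsob.2.1 hν hνo hindep hlaw,
    GaussMMD.tendstoInDistribution_studentizedStat hd hp₀ h2 hsob.2.1 hν hνo hindep hlaw⟩
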